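/- Let $n\ge 3$ and let $$y^{(n)}+f(x,y,y',\dots,y^{(n-1)})=0,\qquad f\in\mathbb C(x,y,y',\dots,y^{(n-1)}),$$ be an equation that is linearizable near a point $z_0=(x_0,y_0)\in\mathbb C^2$: some locally invertible holomorphic change of variables $t=\phi(x,y)$, $u=\psi(x,y)$ near $z_0$ maps it into a linear homogeneous equation $u^{(n)}+\sum_{i<n}a_i(t)u^{(i)}=0$ with $a_i$ holomorphic near $\phi(z_0)$. Let $L$ be its Lie algebra of point symmetries at $z_0$, that is, the germs at $z_0$ of holomorphic vector fields $\xi(x,y)\partial_x+\eta(x,y)\partial_y$ whose $n$-th prolongation annihilates $y^{(n)}+f$ on the equation. Assume $m=\dim L=n+2$, and let $D=[L,L]$ be the derived algebra. Then: 1. $D$ is abelian and $\dim D=n$. 2. If the classes of $e_1,e_2\in L$ span $L/D$, then at least one of the maps $Z\mapsto[e_1,Z]$, $Z\mapsto[e_2,Z]$ on $D$ is not a scalar multiple of the identity. 3. Let $X\in L$ and let $A$ be the matrix of $Z\mapsto [X,Z]$ on $D$ in some basis of $D$. If the equation is equivalent, by a locally invertible holomorphic change of variables near $z_0$, to the constant-coefficient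 equation $u^{(n)}+\sum_{i<n}c_iu^{(i)}=0$, whose characteristic polynomial is $z^n+\sum_{i<n}c_iz^i=\prod_{i=1}^n(z-\lambda_i)$, then there are $k,b\in\mathbb C$ such that the characteristic polynomial of $A$ is $\prod_{i=1}^n(z-(k\lambda_i+b))$, and $k=0$ if and only if $X$ acts on $D$ as a scalar multiple of the identity. 4. If $X\in L$ does not act on $D$ as a scalar multiple of the identity and $z^n+\sum_{i<n}c_iz^i$ is the characteristic polynomial of $Z\mapsto[X,Z]$ on $D$, then the given equation is equivalent, by a locally invertible holomorphic change of variables near $z_0$, to the constant-coefficient equation $u^{(n)}+\sum_{i<n}c_iu^{(i)}=0$. -/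

import Mathlib

noncomputable section

open Filter Topology Polynomial VectorField
open scoped ContDiff

namespace ODESymm

/-- The jet space of order `n` of scalar functions `y(x)`: the coordinate `0` is `x`, the coordinate
`k + 1` is the derivative `y^(k)`, for `k = 0, …, n`. -/
abbrev Jet (n : ℕ) : Type := Fin (n + 2) → ℂ

namespace Jet

variable {n : ℕ}

/-- The point `(x, y)` below a jet. -/
def base (j : Jet n) : ℂ × ℂ := (j 0, j 1)

/-- The coordinate `y^(k)` of a jet (`0` when `k` exceeds the order `n` of the jet). -/
def dcoord (k : ℕ) (j : Jet n) : ℂ :=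
  if h : k + 1 < n + 2 then j ⟨k + 1, h⟩ else 0

/-- The total derivative operator `D_x = ∂_x + ∑ y^(k+1) ∂_{y^(k)}` as a vector field on the jet space.
The sum stops at `k = n - 1`, so it acts as the total derivative on functions of order `< n`,
the only ones it is applied to. -/
def totalField (j : Jet n) : Jet n :=
  Fin.cons (1 : ℂ) (fun k : Fin (n + 1) => dcoord (k.val + 1) j)

/-- The total derivative `D_x F`. -/
def totalDeriv (F : Jet n → ℂ) (j : Jet n) : ℂ :=
  fderiv ℂ F j (totalField j)

/-- The coefficients of the prolongation of the vector field `v = ξ ∂_x + η ∂_y`: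
`η^(0) = η` and `η^(k+1) = D_x η^(k) - y^(k+1) D_x ξ`. -/
def prolongCoeff (v : ℂ × ℂ → ℂ × ℂ) : ℕ → Jet n → ℂ
  | 0 => fun j => (v j.base).2
  | k + 1 => fun j =>
      totalDeriv (prolongCoeff v k) j
        - dcoord (k + 1) j * totalDeriv (fun j => (v j.base).1) j

/-- The prolonged vector field `ξ ∂_x + ∑_{k ≤ n} η^(k) ∂_{y^(k)}`. -/
def prolong (v : ℂ × ℂ → ℂ × ℂ) (j : Jet n) : Jet n :=
  Fin.cons (v j.base).1 (fun k : Fin (n + 1) => prolongCoeff v k.val j)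

/-- For a point transformation `Φ = (φ, ψ)`, `t = φ(x, y)`, `u = ψ(x, y)`, the derivative
`u^(k) = d^k u / dt^k` as a function of the jet of `y(x)`: `u^(0) = ψ` and
`u^(k+1) = D_x u^(k) / D_x φ`. -/
def pointMapCoord (Φ : ℂ × ℂ → ℂ × ℂ) : ℕ → Jet n → ℂ
  | 0 => fun j => (Φ j.base).2
  | k + 1 => fun j =>
      totalDeriv (pointMapCoord Φ k) j / totalDeriv (fun j => (Φ j.base).1) j

theorem contDiff_base : ContDiff ℂ ω (base : Jet n → ℂ × ℂ) := by
  unfold base; fun_prop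

theorem contDiff_dcoord (k : ℕ) : ContDiff ℂ ω (dcoord k : Jet n → ℂ) := by
  unfold dcoord
  by_cases h : k + 1 < n + 2
  · simp only [h, dite_true]; fun_prop
  · simp only [h, dite_false]; fun_prop

theorem contDiff_totalField : ContDiff ℂ ω (totalField : Jet n → Jet n) := by
  rw [contDiff_pi]
  intro i
  refine Fin.cases ?_ (fun k => ?_) i
  · simpa [totalField] using contDiff_const
  · simpa [totalField] using contDiff_dcoord _

theorem contDiffAt_totalDeriv {F : Jet n → ℂ} {j : Jet n} (h : ContDiffAt ℂ ω F j) :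
    ContDiffAt ℂ ω (totalDeriv F) j :=
  (h.fderiv_right (m := ω) (by simp)).clm_apply contDiff_totalField.contDiffAt

theorem contDiffAt_fst {v : ℂ × ℂ → ℂ × ℂ} {j : Jet n} (h : AnalyticAt ℂ v j.base) :
    ContDiffAt ℂ ω (fun j : Jet n => (v j.base).1) j :=
  (h.contDiffAt.comp j contDiff_base.contDiffAt).fst

theorem contDiffAt_prolongCoeff {v : ℂ × ℂ → ℂ × ℂ} {j : Jet n}
    (h : AnalyticAt ℂ v j.base) (k : ℕ) : ContDiffAt ℂ ω (prolongCoeff v k) j := by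
  induction k with
  | zero => exact (h.contDiffAt.comp j contDiff_base.contDiffAt).snd
  | succ k ih =>
    exact (contDiffAt_totalDeriv ih).sub
      ((contDiff_dcoord _).contDiffAt.mul (contDiffAt_totalDeriv (contDiffAt_fst h)))

theorem contDiffAt_prolong {v : ℂ × ℂ → ℂ × ℂ} {j : Jet n}
    (h : AnalyticAt ℂ v j.base) : ContDiffAt ℂ ω (prolong v : Jet n → Jet n) j := by
  rw [contDiffAt_pi]
  intro i
  refine Fin.cases ?_ (fun k => ?_) i
  · simpa [prolong] using contDiffAt_fst h
  · simpa [prolong] using contDiffAt_prolongCoeff h _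

theorem eventually_base {P : ℂ × ℂ → Prop} {j : Jet n} (h : ∀ᶠ z in 𝓝 j.base, P z) :
    ∀ᶠ j' in 𝓝 j, P (base j') :=
  contDiff_base.continuous.continuousAt.eventually h

theorem dcoord_add (k : ℕ) (a b : Jet n) : dcoord k (a + b) = dcoord k a + dcoord k b := by
  unfold dcoord; split <;> simp

theorem dcoord_smul (k : ℕ) (c : ℂ) (a : Jet n) : dcoord k (c • a) = c * dcoord k a := by
  unfold dcoord; split <;> simp

theorem fderiv_dcoord (k : ℕ) (j w : Jet n) : fderiv ℂ (dcoord k) j w = dcoord k w := by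
  have : (dcoord k : Jet n → ℂ) = (LinearMap.toContinuousLinearMap
      { toFun := dcoord k, map_add' := dcoord_add k, map_smul' := dcoord_smul k :
        Jet n →ₗ[ℂ] ℂ } : Jet n →L[ℂ] ℂ) := by
    ext x; simp
  rw [this, ContinuousLinearMap.fderiv]

/-! Functions that depend only on the first coordinates of a jet. -/

/-- `F` depends on the coordinates `0, …, m` of the jet only. -/
def Indep (F : Jet n → ℂ) (m : ℕ) : Prop :=
  ∀ j e : Jet n, (∀ i, i.val ≤ m → e i = 0) → F (j + e) = F j

theorem Indep.fderiv_zero {F : Jet n → ℂ} {m : ℕ} (h : Indep F m) (j e : Jet n)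
    (he : ∀ i, i.val ≤ m → e i = 0) : fderiv ℂ F j e = 0 := by
  by_cases hd : DifferentiableAt ℂ F j
  · have h1 : HasLineDerivAt ℂ F (fderiv ℂ F j e) j e := hd.hasFDerivAt.hasLineDerivAt e
    have h2 : HasLineDerivAt ℂ F 0 j e := by
      unfold HasLineDerivAt
      have : (fun t : ℂ => F (j + t • e)) = fun _ => F j := by
        ext t
        exact h j _ (fun i hi => by simp [he i hi])
      rw [this]; exact hasDerivAt_const _ _
    exact h1.unique h2
  · simp [fderiv_zero_of_not_differentiableAt hd]

theorem Indep.totalDeriv {F : Jet n → ℂ} {m : ℕ} (h : Indep F m) :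
    Indep (totalDeriv F) (m + 1) := by
  intro j e he
  have h1 : fderiv ℂ F (j + e) = fderiv ℂ F j := by
    rw [← fderiv_comp_add_right]
    congr 1
    ext x
    exact h x e (fun i hi => he i (by omega))
  unfold Jet.totalDeriv
  rw [h1, ← sub_eq_zero, ← map_sub]
  refine h.fderiv_zero _ _ (fun i hi => ?_)
  refine Fin.cases (fun _ => ?_) (fun k hk => ?_) i hi
  · simp [totalField]
  · simp only [totalField, Pi.sub_apply, Fin.cons_succ, dcoord_add, add_sub_cancel_left]
    unfold dcoord
    split
    · exact he _ (by simp at hk ⊢; omega)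
    · rfl

theorem indep_base {G : ℂ × ℂ → ℂ} : Indep (fun j : Jet n => G j.base) 1 := by
  intro j e he
  have h0 : e 0 = 0 := he 0 (by simp)
  have h1 : e 1 = 0 := he 1 (by rw [Fin.val_one])
  simp [base, h0, h1]

theorem Indep.mono {F : Jet n → ℂ} {m m' : ℕ} (h : Indep F m) (hm : m ≤ m') : Indep F m' :=
  fun j e he => h j e (fun i hi => he i (hi.trans hm))

theorem indep_prolongCoeff (v : ℂ × ℂ → ℂ × ℂ) (k : ℕ) :
    Indep (prolongCoeff v k : Jet n → ℂ) (k + 1) := by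
  induction k with
  | zero => exact indep_base (G := fun z => (v z).2)
  | succ k ih =>
    intro j e he
    have h1 := ih.totalDeriv j e he
    have h2 := ((indep_base (n := n) (G := fun z => (v z).1)).totalDeriv.mono
      (by omega : 1 + 1 ≤ k + 1 + 1)) j e he
    have h3 : dcoord (k + 1) (j + e) = dcoord (k + 1) j := by
      rw [dcoord_add]
      unfold dcoord
      split
      · rw [he _ (by simp)]; simp
      · simp
    simp only [prolongCoeff, h1, h2, h3]

/-! Commutator of a prolonged field with the total derivative. -/

theorem lieBracket_apply' {V W : Jet n → Jet n} {j : Jet n} (hV : DifferentiableAt ℂ V j)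
    (hW : DifferentiableAt ℂ W j) (i : Fin (n + 2)) :
    lieBracket ℂ V W j i = fderiv ℂ (fun j => W j i) j (V j)
      - fderiv ℂ (fun j => V j i) j (W j) := by
  rw [lieBracket_eq, fderiv_apply hV, fderiv_apply hW]
  simp

theorem commutator {v : ℂ × ℂ → ℂ × ℂ} {j : Jet n} (h : AnalyticAt ℂ v j.base)
    {F : Jet n → ℂ} (hF : ContDiffAt ℂ ω F j) (hi : Indep F n) :
    fderiv ℂ (totalDeriv F) j (prolong v j) =
      totalDeriv (fun j => fderiv ℂ F j (prolong v j)) j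
        - totalDeriv (fun j => (v j.base).1) j * totalDeriv F j := by
  have hV := (contDiffAt_prolong h).differentiableAt (by simp)
  have hD := (contDiff_totalField (n := n)).contDiffAt.differentiableAt (x := j) (by simp)
  have key := fderiv_apply_lieBracket hF (by simp) hD hV
  have h0 : fderiv ℂ F j (lieBracket ℂ (prolong v) totalField j
      + totalDeriv (fun j => (v j.base).1) j • totalField j) = 0 := by
    refine hi.fderiv_zero _ _ (fun i hi => ?_)
    rw [Pi.add_apply, lieBracket_apply' hV hD, Pi.smul_apply]
    refine Fin.cases (fun _ => ?_) (fun k hk => ?_) i hi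
    · simp [totalField, prolong, totalDeriv]
    · have hk' : k.val + 1 < n + 1 := by simp at hk; omega
      simp only [totalField, prolong, Fin.cons_succ, smul_eq_mul]
      rw [show (fun j : Jet n => dcoord (k.val + 1) j) = dcoord (k.val + 1) from rfl, fderiv_dcoord]
      have : dcoord (k.val + 1) (Fin.cons (v j.base).1
          (fun k : Fin (n + 1) => prolongCoeff v k.val j) : Jet n)
          = prolongCoeff v (k.val + 1) j := by
        unfold dcoord
        rw [dif_pos (by omega)]
        exact Fin.cons_succ (α := fun _ => ℂ) _ _ (⟨k.val + 1, hk'⟩ : Fin (n + 1))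
      rw [this]
      simp only [prolongCoeff, totalDeriv, totalField]
      ring
  rw [map_add, map_smul, key] at h0
  rw [show totalDeriv F = fun x => fderiv ℂ F x (totalField x) from rfl]
  simp only [totalDeriv, smul_eq_mul] at h0 ⊢
  linear_combination h0

theorem prolongCoeff_congr {v w : ℂ × ℂ → ℂ × ℂ} {z : ℂ × ℂ} (h : v =ᶠ[𝓝 z] w) (k : ℕ)
    (j : Jet n) (hj : j.base = z) : prolongCoeff v k j = prolongCoeff w k j := by
  induction k generalizing z j with
  | zero => simp [prolongCoeff, hj, h.eq_of_nhds]
  | succ k ih =>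
    subst hj
    have h1 : prolongCoeff v k =ᶠ[𝓝 j] prolongCoeff w k :=
      (eventually_base h.eventually_nhds).mono (fun j' hj' => ih hj' j' rfl)
    have h2 : (fun j : Jet n => (v j.base).1) =ᶠ[𝓝 j] (fun j : Jet n => (w j.base).1) :=
      (eventually_base h).mono (fun j' hj' => by simp [hj'])
    simp only [prolongCoeff, totalDeriv, h1.fderiv_eq, h2.fderiv_eq]

theorem fderiv_comp_base {G : ℂ × ℂ → ℂ} {j : Jet n} (h : DifferentiableAt ℂ G j.base)
    (u : Jet n) : fderiv ℂ (fun j : Jet n => G j.base) j u = fderiv ℂ G j.base u.base := by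
  have hb : HasFDerivAt (base : Jet n → ℂ × ℂ)
      ((ContinuousLinearMap.proj 0 : Jet n →L[ℂ] ℂ).prod (ContinuousLinearMap.proj 1)) j :=
    ((ContinuousLinearMap.proj 0 : Jet n →L[ℂ] ℂ).prod (ContinuousLinearMap.proj 1)).hasFDerivAt
  have hc : HasFDerivAt (fun j : Jet n => G j.base) _ j := h.hasFDerivAt.comp j hb
  rw [hc.fderiv]
  rfl

theorem base_prolong (v : ℂ × ℂ → ℂ × ℂ) (j : Jet n) : (prolong v j).base = v j.base := by
  have h1 : prolong v j 1 = prolongCoeff v 0 j :=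
    Fin.cons_succ (α := fun _ => ℂ) _ _ (0 : Fin (n + 1))
  ext
  · simp [base, prolong]
  · simp [base, h1, prolongCoeff]

theorem lieBracket_fst {v w : ℂ × ℂ → ℂ × ℂ} {j : Jet n}
    (hv : AnalyticAt ℂ v j.base) (hw : AnalyticAt ℂ w j.base) :
    (lieBracket ℂ v w j.base).1 =
      fderiv ℂ (fun j : Jet n => (w j.base).1) j (prolong v j)
        - fderiv ℂ (fun j : Jet n => (v j.base).1) j (prolong w j) := by
  have hv' := hv.differentiableAt
  have hw' := hw.differentiableAt
  rw [fderiv_comp_base (G := fun z => (w z).1) hw'.fst,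
    fderiv_comp_base (G := fun z => (v z).1) hv'.fst, base_prolong, base_prolong,
    fderiv.fst hw', fderiv.fst hv']
  simp [lieBracket_eq]

theorem lieBracket_snd {v w : ℂ × ℂ → ℂ × ℂ} {j : Jet n}
    (hv : AnalyticAt ℂ v j.base) (hw : AnalyticAt ℂ w j.base) :
    (lieBracket ℂ v w j.base).2 =
      fderiv ℂ (fun j : Jet n => (w j.base).2) j (prolong v j)
        - fderiv ℂ (fun j : Jet n => (v j.base).2) j (prolong w j) := by
  have hv' := hv.differentiableAt
  have hw' := hw.differentiableAt
  rw [fderiv_comp_base (G := fun z => (w z).2) hw'.snd,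
    fderiv_comp_base (G := fun z => (v z).2) hv'.snd, base_prolong, base_prolong,
    fderiv.snd hw', fderiv.snd hv']
  simp [lieBracket_eq]

theorem totalDeriv_sub {F G : Jet n → ℂ} {j : Jet n} (hF : DifferentiableAt ℂ F j)
    (hG : DifferentiableAt ℂ G j) :
    totalDeriv (fun j => F j - G j) j = totalDeriv F j - totalDeriv G j := by
  simp only [totalDeriv]
  rw [fderiv_fun_sub hF hG]; rfl

theorem totalDeriv_congr {F G : Jet n → ℂ} {j : Jet n} (h : F =ᶠ[𝓝 j] G) :
    totalDeriv F j = totalDeriv G j := by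
  simp only [totalDeriv, h.fderiv_eq]

theorem diff_along {F : Jet n → ℂ} {v : ℂ × ℂ → ℂ × ℂ} {j : Jet n} (hF : ContDiffAt ℂ ω F j)
    (h : AnalyticAt ℂ v j.base) :
    ContDiffAt ℂ ω (fun j => fderiv ℂ F j (prolong v j)) j :=
  (hF.fderiv_right (m := ω) (by simp)).clm_apply (contDiffAt_prolong h)

theorem fderiv_prolongCoeff_succ {v w : ℂ × ℂ → ℂ × ℂ} {k : ℕ} (hk : k < n) {j : Jet n}
    (hv : AnalyticAt ℂ v j.base) (hw : AnalyticAt ℂ w j.base) :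
    fderiv ℂ (prolongCoeff w (k + 1)) j (prolong v j) =
      totalDeriv (fun j => fderiv ℂ (prolongCoeff w k) j (prolong v j)) j
        - totalDeriv (fun j => (v j.base).1) j * totalDeriv (prolongCoeff w k) j
        - prolongCoeff v (k + 1) j * totalDeriv (fun j => (w j.base).1) j
        - dcoord (k + 1) j *
          (totalDeriv (fun j => fderiv ℂ (fun j : Jet n => (w j.base).1) j (prolong v j)) j
            - totalDeriv (fun j => (v j.base).1) j * totalDeriv (fun j => (w j.base).1) j) := by
  have hW := contDiffAt_prolongCoeff hw k
  have hw1 := contDiffAt_fst hw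
  rw [← commutator hv hw1 ((indep_base (G := fun z => (w z).1)).mono (by omega)),
    ← commutator hv hW ((indep_prolongCoeff w k).mono (by omega))]
  have h1 := (contDiffAt_totalDeriv hW).differentiableAt (by simp)
  have h2 := (contDiffAt_totalDeriv hw1).differentiableAt (by simp)
  have h3 := (contDiff_dcoord (n := n) (k + 1)).contDiffAt.differentiableAt (x := j) (by simp)
  have e : prolongCoeff w (k + 1) = fun j : Jet n => totalDeriv (prolongCoeff w k) j
        - dcoord (k + 1) j * totalDeriv (fun j => (w j.base).1) j := rfl
  rw [e, fderiv_fun_sub h1 (h3.fun_mul h2), fderiv_fun_mul h3 h2]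
  have h4 : dcoord (k + 1) (prolong v j) = prolongCoeff v (k + 1) j := by
    unfold dcoord
    rw [dif_pos (by omega)]
    exact Fin.cons_succ (α := fun _ => ℂ) _ _ (⟨k + 1, by omega⟩ : Fin (n + 1))
  have h5 := fderiv_dcoord (n := n) (k + 1) j (prolong v j)
  rw [h4] at h5
  simp only [sub_apply, add_apply,
    smul_apply, smul_eq_mul]
  rw [h5]
  ring

theorem prolongCoeff_lieBracket {v w : ℂ × ℂ → ℂ × ℂ} {k : ℕ} (hk : k ≤ n) {j : Jet n}
    (hv : AnalyticAt ℂ v j.base) (hw : AnalyticAt ℂ w j.base) :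
    prolongCoeff (lieBracket ℂ v w) k j =
      fderiv ℂ (prolongCoeff w k) j (prolong v j)
        - fderiv ℂ (prolongCoeff v k) j (prolong w j) := by
  induction k generalizing j with
  | zero => exact lieBracket_snd hv hw
  | succ k ih =>
    have hev : ∀ᶠ j' in 𝓝 j, AnalyticAt ℂ v (base j') ∧ AnalyticAt ℂ w (base j') :=
      eventually_base (hv.eventually_analyticAt.and hw.eventually_analyticAt)
    have h1 : prolongCoeff (lieBracket ℂ v w) k =ᶠ[𝓝 j] fun j =>
        fderiv ℂ (prolongCoeff w k) j (prolong v j)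
        - fderiv ℂ (prolongCoeff v k) j (prolong w j) :=
      hev.mono (fun j' h => ih (by omega) h.1 h.2)
    have h2 : (fun j : Jet n => (lieBracket ℂ v w j.base).1) =ᶠ[𝓝 j] fun j =>
        fderiv ℂ (fun j : Jet n => (w j.base).1) j (prolong v j)
        - fderiv ℂ (fun j : Jet n => (v j.base).1) j (prolong w j) :=
      hev.mono (fun j' h => lieBracket_fst h.1 h.2)
    rw [fderiv_prolongCoeff_succ (by omega) hv hw, fderiv_prolongCoeff_succ (by omega) hw hv]
    have e : prolongCoeff (lieBracket ℂ v w) (k + 1) j =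
        totalDeriv (prolongCoeff (lieBracket ℂ v w) k) j
        - dcoord (k + 1) j * totalDeriv (fun j => (lieBracket ℂ v w j.base).1) j := rfl
    have d {F : Jet n → ℂ} {u : ℂ × ℂ → ℂ × ℂ} (hF : ContDiffAt ℂ ω F j)
      (h : AnalyticAt ℂ u j.base) := (diff_along hF h).differentiableAt (by simp)
    rw [e, totalDeriv_congr h1, totalDeriv_congr h2,
      totalDeriv_sub (d (contDiffAt_prolongCoeff hw k) hv) (d (contDiffAt_prolongCoeff hv k) hw),
      totalDeriv_sub (d (contDiffAt_fst hw) hv) (d (contDiffAt_fst hv) hw)]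
    simp only [prolongCoeff]
    ring

theorem prolong_lieBracket {v w : ℂ × ℂ → ℂ × ℂ} {j : Jet n}
    (hv : AnalyticAt ℂ v j.base) (hw : AnalyticAt ℂ w j.base) :
    prolong (lieBracket ℂ v w) j = lieBracket ℂ (prolong v) (prolong w) j := by
  ext i
  rw [lieBracket_apply' ((contDiffAt_prolong hv).differentiableAt (by simp))
    ((contDiffAt_prolong hw).differentiableAt (by simp))]
  refine Fin.cases ?_ (fun k => ?_) i
  · simpa [prolong] using lieBracket_fst hv hw
  · simpa only [prolong, Fin.cons_succ] using prolongCoeff_lieBracket (by omega) hv hw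

theorem prolongCoeff_add {v w : ℂ × ℂ → ℂ × ℂ} (k : ℕ) {j : Jet n}
    (hv : AnalyticAt ℂ v j.base) (hw : AnalyticAt ℂ w j.base) :
    prolongCoeff (v + w) k j = prolongCoeff v k j + prolongCoeff w k j := by
  induction k generalizing j with
  | zero => rfl
  | succ k ih =>
    have hev : ∀ᶠ j' in 𝓝 j, AnalyticAt ℂ v (base j') ∧ AnalyticAt ℂ w (base j') :=
      eventually_base (hv.eventually_analyticAt.and hw.eventually_analyticAt)
    have h1 : prolongCoeff (v + w) k =ᶠ[𝓝 j] fun j => prolongCoeff v k j + prolongCoeff w k j :=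
      hev.mono (fun j' h => ih h.1 h.2)
    have a1 := (contDiffAt_prolongCoeff hv k).differentiableAt (by simp)
    have a2 := (contDiffAt_prolongCoeff hw k).differentiableAt (by simp)
    have b1 := (contDiffAt_fst hv).differentiableAt (by simp)
    have b2 := (contDiffAt_fst hw).differentiableAt (by simp)
    have e : (fun j : Jet n => ((v + w) j.base).1)
      = fun j => (v j.base).1 + (w j.base).1 := rfl
    simp only [prolongCoeff]
    rw [totalDeriv_congr h1, e]
    simp only [totalDeriv]
    rw [fderiv_fun_add a1 a2, fderiv_fun_add b1 b2]
    simp only [add_apply]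
    ring

theorem prolongCoeff_smul {v : ℂ × ℂ → ℂ × ℂ} (c : ℂ) (k : ℕ) {j : Jet n}
    (hv : AnalyticAt ℂ v j.base) :
    prolongCoeff (c • v) k j = c * prolongCoeff v k j := by
  induction k generalizing j with
  | zero => rfl
  | succ k ih =>
    have h1 : prolongCoeff (c • v) k =ᶠ[𝓝 j] fun j => c * prolongCoeff v k j :=
      (eventually_base hv.eventually_analyticAt).mono (fun j' h => ih h)
    have a1 := (contDiffAt_prolongCoeff hv k).differentiableAt (by simp)
    have b1 := (contDiffAt_fst hv).differentiableAt (by simp)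
    have e : (fun j : Jet n => ((c • v) j.base).1) = fun j => c * (v j.base).1 := rfl
    simp only [prolongCoeff]
    rw [totalDeriv_congr h1, e]
    simp only [totalDeriv]
    rw [fderiv_const_mul a1, fderiv_const_mul b1]
    simp only [smul_apply, smul_eq_mul]
    ring

theorem prolong_add {v w : ℂ × ℂ → ℂ × ℂ} {j : Jet n}
    (hv : AnalyticAt ℂ v j.base) (hw : AnalyticAt ℂ w j.base) :
    prolong (v + w) j = prolong v j + prolong w j := by
  ext i
  refine Fin.cases ?_ (fun k => ?_) i
  · simp [prolong]
  · simpa [prolong] using prolongCoeff_add _ hv hw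

theorem prolong_smul {v : ℂ × ℂ → ℂ × ℂ} (c : ℂ) {j : Jet n} (hv : AnalyticAt ℂ v j.base) :
    prolong (c • v) j = c • prolong v j := by
  ext i
  refine Fin.cases ?_ (fun k => ?_) i
  · simp [prolong]
  · simpa [prolong] using prolongCoeff_smul c _ hv

end Jet

/-! Germs of analytic vector fields -/

/-- Germs at `z₀` of holomorphic vector fields `v = (ξ, η)`, that is `ξ ∂_x + η ∂_y`, on `ℂ²`. -/
def VFGerm (z₀ : ℂ × ℂ) : Type :=
  ↥({ carrier := {V | ∃ v : ℂ × ℂ → ℂ × ℂ, AnalyticAt ℂ v z₀ ∧ (v : Germ (𝓝 z₀) (ℂ × ℂ)) = V}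
      zero_mem' := ⟨0, analyticAt_const, rfl⟩
      add_mem' := by
        rintro _ _ ⟨v, hv, rfl⟩ ⟨w, hw, rfl⟩
        exact ⟨v + w, hv.add hw, rfl⟩
      smul_mem' := by
        rintro c _ ⟨v, hv, rfl⟩
        exact ⟨c • v, hv.const_smul, rfl⟩ } : Submodule ℂ (Germ (𝓝 z₀) (ℂ × ℂ)))

namespace VFGerm

variable {z₀ : ℂ × ℂ}

instance : AddCommGroup (VFGerm z₀) := by unfold VFGerm; infer_instance

instance : Module ℂ (VFGerm z₀) := by unfold VFGerm; infer_instance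

/-- The germ of a vector field. -/
def mk (v : ℂ × ℂ → ℂ × ℂ) (hv : AnalyticAt ℂ v z₀) : VFGerm z₀ := ⟨↑v, v, hv, rfl⟩

theorem mk_eq_mk {v w : ℂ × ℂ → ℂ × ℂ} {hv : AnalyticAt ℂ v z₀} {hw : AnalyticAt ℂ w z₀} :
    mk v hv = mk w hw ↔ v =ᶠ[𝓝 z₀] w :=
  Subtype.ext_iff.trans Germ.coe_eq

theorem exists_mk (V : VFGerm z₀) : ∃ v, ∃ hv : AnalyticAt ℂ v z₀, mk v hv = V := by
  obtain ⟨_, v, hv, rfl⟩ := V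
  exact ⟨v, hv, rfl⟩

theorem mk_add {v w : ℂ × ℂ → ℂ × ℂ} (hv : AnalyticAt ℂ v z₀) (hw : AnalyticAt ℂ w z₀) :
    mk v hv + mk w hw = mk (v + w) (hv.add hw) := rfl

theorem mk_smul {v : ℂ × ℂ → ℂ × ℂ} (c : ℂ) (hv : AnalyticAt ℂ v z₀) :
    c • mk v hv = mk (c • v) hv.const_smul := rfl

theorem zero_eq : (0 : VFGerm z₀) = mk 0 analyticAt_const := rfl

theorem analyticAt_lieBracket {v w : ℂ × ℂ → ℂ × ℂ} (hv : AnalyticAt ℂ v z₀)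
    (hw : AnalyticAt ℂ w z₀) : AnalyticAt ℂ (lieBracket ℂ v w) z₀ := by
  have h : ContDiffAt ℂ ω (lieBracket ℂ v w) z₀ :=
    hv.contDiffAt.lieBracket_vectorField (n := ω) hw.contDiffAt (by simp)
  exact h.analyticAt

/-- The commutator of vector fields. -/
instance : Bracket (VFGerm z₀) (VFGerm z₀) where
  bracket V W := ⟨Quotient.map₂ (lieBracket ℂ) (fun _ _ h _ _ h' =>
      EventuallyEq.lieBracket_vectorField h h') V.1 W.1, by
    obtain ⟨_, v, hv, rfl⟩ := V
    obtain ⟨_, w, hw, rfl⟩ := W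
    exact ⟨lieBracket ℂ v w, analyticAt_lieBracket hv hw, rfl⟩⟩

theorem mk_bracket {v w : ℂ × ℂ → ℂ × ℂ} (hv : AnalyticAt ℂ v z₀) (hw : AnalyticAt ℂ w z₀) :
    ⁅mk v hv, mk w hw⁆ = mk (lieBracket ℂ v w) (analyticAt_lieBracket hv hw) := rfl

instance : LieRing (VFGerm z₀) where
  add_lie U V W := by
    obtain ⟨u, hu, rfl⟩ := exists_mk U
    obtain ⟨v, hv, rfl⟩ := exists_mk V
    obtain ⟨w, hw, rfl⟩ := exists_mk W
    simp only [mk_add, mk_bracket, mk_eq_mk]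
    filter_upwards [hu.eventually_analyticAt, hv.eventually_analyticAt] with z h1 h2
    exact lieBracket_add_left h1.differentiableAt h2.differentiableAt
  lie_add U V W := by
    obtain ⟨u, hu, rfl⟩ := exists_mk U
    obtain ⟨v, hv, rfl⟩ := exists_mk V
    obtain ⟨w, hw, rfl⟩ := exists_mk W
    simp only [mk_add, mk_bracket, mk_eq_mk]
    filter_upwards [hv.eventually_analyticAt, hw.eventually_analyticAt] with z h1 h2
    exact lieBracket_add_right h1.differentiableAt h2.differentiableAt
  lie_self U := by
    obtain ⟨u, hu, rfl⟩ := exists_mk U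
    simp only [zero_eq, mk_bracket, lieBracket_self]
  leibniz_lie U V W := by
    obtain ⟨u, hu, rfl⟩ := exists_mk U
    obtain ⟨v, hv, rfl⟩ := exists_mk V
    obtain ⟨w, hw, rfl⟩ := exists_mk W
    simp only [mk_add, mk_bracket, mk_eq_mk]
    filter_upwards [hu.eventually_analyticAt, hv.eventually_analyticAt,
      hw.eventually_analyticAt] with z h1 h2 h3
    exact leibniz_identity_lieBracket (n := ω) (by simp) h1.contDiffAt h2.contDiffAt h3.contDiffAt

instance : LieAlgebra ℂ (VFGerm z₀) where
  lie_smul c V W := by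
    obtain ⟨v, hv, rfl⟩ := exists_mk V
    obtain ⟨w, hw, rfl⟩ := exists_mk W
    simp only [mk_smul, mk_bracket, mk_eq_mk]
    filter_upwards [hw.eventually_analyticAt] with z h1
    exact lieBracket_const_smul_right h1.differentiableAt

end VFGerm

/-- The equation `y^(n) + f(x, y, y', …, y^(n-1)) = 0` with the rational function `f = num / den`; the
variable `0` is `x`, the variable `k + 1` is `y^(k)`. -/
structure RationalODE (n : ℕ) where
  num : MvPolynomial (Fin (n + 1)) ℂ
  den : MvPolynomial (Fin (n + 1)) ℂ
  den_ne_zero : den ≠ 0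

namespace RationalODE

variable {n : ℕ} (q : RationalODE n)

/-- The denominator of `f` at a jet. -/
def denAt (j : Jet n) : ℂ := MvPolynomial.eval (fun i : Fin (n + 1) => j i.castSucc) q.den

/-- The numerator of `f` at a jet. -/
def numAt (j : Jet n) : ℂ := MvPolynomial.eval (fun i : Fin (n + 1) => j i.castSucc) q.num

/-- The left-hand side `y^(n) + f(x, y, …, y^(n-1))`, meaningful where the denominator is nonzero. -/
def lhs (j : Jet n) : ℂ := j (Fin.last (n + 1)) + q.numAt j / q.denAt j

/-- Infinitesimal invariance near `z₀`: the prolonged field annihilates `y^(n) + f` at the jets that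
satisfy the equation. -/
def IsSymmetryNear (z₀ : ℂ × ℂ) (v : ℂ × ℂ → ℂ × ℂ) : Prop :=
  ∀ᶠ z in 𝓝 z₀, ∀ j : Jet n, j.base = z → q.denAt j ≠ 0 → q.lhs j = 0 →
    fderiv ℂ q.lhs j (j.prolong v) = 0

theorem contDiff_eval (p : MvPolynomial (Fin (n + 1)) ℂ) :
    ContDiff ℂ ω (fun j : Jet n => MvPolynomial.eval (fun i : Fin (n + 1) => j i.castSucc) p) := by
  induction p using MvPolynomial.induction_on with
  | C a => simpa using contDiff_const
  | add p q hp hq => simpa using hp.add hq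
  | mul_X p i hp => simpa using hp.mul (contDiff_apply _ _ _)

theorem contDiffAt_lhs {j : Jet n} (h : q.denAt j ≠ 0) : ContDiffAt ℂ ω q.lhs j :=
  (contDiff_apply _ _ _).contDiffAt.add
    ((contDiff_eval q.num).contDiffAt.div (contDiff_eval q.den).contDiffAt h)

theorem tangent_aux {v w : ℂ × ℂ → ℂ × ℂ} {j : Jet n}
    (hw : q.IsSymmetryNear j.base w) (hw' : AnalyticAt ℂ w j.base)
    (hden : q.denAt j ≠ 0) (hj : q.lhs j = 0) (hV : fderiv ℂ q.lhs j (j.prolong v) = 0) :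
    fderiv ℂ (fun j => fderiv ℂ q.lhs j (j.prolong w)) j (j.prolong v) = 0 := by
  set e : Jet n := Pi.single (Fin.last (n + 1)) 1 with he
  set γ : Jet n → Jet n := fun j => j - q.lhs j • e with hγ
  set G : Jet n → ℂ := fun j => fderiv ℂ q.lhs j (j.prolong w) with hG
  have hcast : ∀ (j' : Jet n) (i : Fin (n + 1)), γ j' i.castSucc = j' i.castSucc := by
    intro j' i
    simp [hγ, he, (Fin.castSucc_lt_last i).ne]
  have hγj : γ j = j := by simp [hγ, hj]
  have hlhs := (q.contDiffAt_lhs hden).differentiableAt (by simp)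
  have hγd : HasFDerivAt γ (ContinuousLinearMap.id ℂ (Jet n)
      - (fderiv ℂ q.lhs j).smulRight e) j :=
    (hasFDerivAt_id j).sub (hlhs.hasFDerivAt.smul_const e)
  have hGd : DifferentiableAt ℂ G (γ j) := by
    rw [hγj]
    exact ((((q.contDiffAt_lhs hden).fderiv_right (m := ω) (by simp)).clm_apply
      (Jet.contDiffAt_prolong hw')).differentiableAt (by simp))
  have hden' : ∀ᶠ j' in 𝓝 j, q.denAt j' ≠ 0 :=
    (contDiff_eval q.den).continuous.continuousAt.eventually_ne hden
  have hcont : Tendsto γ (𝓝 j) (𝓝 j) := by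
    have := hγd.continuousAt
    rwa [ContinuousAt, hγj] at this
  have hz : G ∘ γ =ᶠ[𝓝 j] fun _ => 0 := by
    filter_upwards [hden', hcont.eventually (Jet.eventually_base hw)] with j' h1 h2
    refine h2 (γ j') rfl ?_ ?_
    · simpa only [denAt, hcast] using h1
    · simp only [lhs, denAt, numAt, hcast]
      simp [hγ, he, lhs, denAt, numAt]
  have h := (hGd.hasFDerivAt.comp j hγd).fderiv
  rw [hz.fderiv_eq, hγj] at h
  have h' := congrArg (fun L => L (j.prolong v)) h
  simpa [hV] using h'.symm

theorem isSymmetryNear_lieBracket {z₀ : ℂ × ℂ} {v w : ℂ × ℂ → ℂ × ℂ}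
    (hv : AnalyticAt ℂ v z₀) (hw : AnalyticAt ℂ w z₀)
    (hsv : q.IsSymmetryNear z₀ v) (hsw : q.IsSymmetryNear z₀ w) :
    q.IsSymmetryNear z₀ (lieBracket ℂ v w) := by
  filter_upwards [hv.eventually_analyticAt, hw.eventually_analyticAt,
    hsv.eventually_nhds, hsw.eventually_nhds] with z hv hw hsv hsw j hjz hden hj
  subst hjz
  rw [Jet.prolong_lieBracket hv hw, fderiv_apply_lieBracket (q.contDiffAt_lhs hden) (by simp)
    ((Jet.contDiffAt_prolong hw).differentiableAt (by simp))
    ((Jet.contDiffAt_prolong hv).differentiableAt (by simp)),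
    q.tangent_aux hsw hw hden hj (hsv.self_of_nhds j rfl hden hj),
    q.tangent_aux hsv hv hden hj (hsw.self_of_nhds j rfl hden hj), sub_zero]

/-- The Lie algebra of point symmetries at `z₀`: germs of holomorphic vector fields satisfying the
invariance condition. -/
def symmetryAlgebra (z₀ : ℂ × ℂ) : LieSubalgebra ℂ (VFGerm z₀) where
  carrier := {V | ∃ v, ∃ hv : AnalyticAt ℂ v z₀, VFGerm.mk v hv = V ∧ q.IsSymmetryNear z₀ v}
  zero_mem' := by
    refine ⟨0, analyticAt_const, rfl, Eventually.of_forall fun z j _ _ _ => ?_⟩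
    have h := Jet.prolong_smul (v := 0) 0 (j := j) analyticAt_const
    rw [zero_smul, zero_smul] at h
    rw [h, map_zero]
  add_mem' := by
    rintro _ _ ⟨v, hv, rfl, hsv⟩ ⟨w, hw, rfl, hsw⟩
    refine ⟨v + w, hv.add hw, rfl, ?_⟩
    filter_upwards [hv.eventually_analyticAt, hw.eventually_analyticAt, hsv, hsw]
      with z hv hw hsv hsw j hjz hden hj
    subst hjz
    rw [Jet.prolong_add hv hw, map_add, hsv j rfl hden hj, hsw j rfl hden hj, add_zero]
  smul_mem' := by
    rintro c _ ⟨v, hv, rfl, hsv⟩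
    refine ⟨c • v, hv.const_smul, rfl, ?_⟩
    filter_upwards [hv.eventually_analyticAt, hsv] with z hv hsv j hjz hden hj
    subst hjz
    rw [Jet.prolong_smul c hv, map_smul, hsv j rfl hden hj, smul_zero]
  lie_mem' := by
    rintro _ _ ⟨v, hv, rfl, hsv⟩ ⟨w, hw, rfl, hsw⟩
    exact ⟨lieBracket ℂ v w, VFGerm.analyticAt_lieBracket hv hw, rfl,
      q.isSymmetryNear_lieBracket hv hw hsv hsw⟩

/-- The derived algebra of the symmetry algebra. -/
abbrev derivedAlgebra (z₀ : ℂ × ℂ) : LieIdeal ℂ (q.symmetryAlgebra z₀) :=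
  LieAlgebra.derivedSeries ℂ (q.symmetryAlgebra z₀) 1

/-- Some invertible holomorphic transformation `t = φ(x, y)`, `u = ψ(x, y)` near `z₀` maps the
equation into the linear equation `u^(n) + ∑_{k < n} a_k(t) u^(k) = 0` with holomorphic coefficients. -/
def EquivToLinearAt (z₀ : ℂ × ℂ) (a : Fin n → ℂ → ℂ) : Prop :=
  ∃ Φ : ℂ × ℂ → ℂ × ℂ, AnalyticAt ℂ Φ z₀ ∧ (fderiv ℂ Φ z₀).det ≠ 0 ∧
    (∀ k, AnalyticAt ℂ (a k) (Φ z₀).1) ∧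
    ∀ᶠ z in 𝓝 z₀, ∀ j : Jet n, j.base = z → q.denAt j ≠ 0 →
      Jet.totalDeriv (fun j => (Φ j.base).1) j ≠ 0 →
      (q.lhs j = 0 ↔
        j.pointMapCoord Φ n + ∑ k : Fin n, a k (Φ j.base).1 * j.pointMapCoord Φ k = 0)

/-- The symmetry `X` acts on the derived algebra as a multiple of the identity. -/
def ActsAsScalar (z₀ : ℂ × ℂ) (X : q.symmetryAlgebra z₀) : Prop :=
  ∃ μ : ℂ, ∀ Z : q.derivedAlgebra z₀, ⁅X, Z⁆ = μ • Z

/-- The matrix of `Z ↦ [X, Z]` on the derived algebra in a basis. -/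
def adMatrix (z₀ : ℂ × ℂ) (X : q.symmetryAlgebra z₀)
    (B : Module.Basis (Fin n) ℂ (q.derivedAlgebra z₀)) : Matrix (Fin n) (Fin n) ℂ :=
  LinearMap.toMatrix B B
    (LieModule.toEnd ℂ (q.symmetryAlgebra z₀) (q.derivedAlgebra z₀) X)

/-- Linearizability by a point transformation near `z₀`. -/
def LinearizableAt (z₀ : ℂ × ℂ) : Prop := ∃ a, q.EquivToLinearAt z₀ a

end RationalODE

/-- The characteristic polynomial of `u^(n) + ∑_{k < n} c_k u^(k) = 0`. -/
def charPoly {n : ℕ} (c : Fin n → ℂ) : ℂ[X] := X ^ n + ∑ k : Fin n, C (c k) * X ^ (k : ℕ)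

/-- The monic polynomial `∏ (z - (k λ + b))`, over the roots `λ` of `p` with multiplicity. -/
def affineRoots (p : ℂ[X]) (k b : ℂ) : ℂ[X] := (p.roots.map fun r => X - C (k * r + b)).prod

end ODESymm
end

noncomputable section

open Filter Topology Polynomial VectorField
open scoped ContDiff

namespace ODESymm

/-! Linear holomorphic differential equations -/

/-! In linearizing coordinates `(t, u)` every symmetry has the form `ξ(t) ∂_t + (c(t) u + e(t))
∂_u`, where `e` is a solution of the linear equation and `s ↦ ξ s' - c s` preserves its solutions
(`IsLinSymmetryNear.exists_isLinSym`). The reason is that the characteristic `η - s' ξ` of a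
symmetry along a solution `s` is again a solution. Its second difference in the direction of a
solution `r` of order `n - 1` vanishes to order `n`, hence identically, and comparing orders of
vanishing gives `ξ_u = 0` and `η_uu = 0`. Here `n ≥ 3` is used.

The fields `s(t) ∂_u` form a space of dimension `n`, and `u ∂_u` is always a symmetry. Dimension `n
+ 2` thus leaves one further generator, with `ξ₀` not identically zero, and all pairs `(ξ, c)` lie
in the plane spanned by `(0, 1)` and `(ξ₀, c₀)`. Brackets therefore have zero `ξ` and `c`
components, while the bracket with `u ∂_u` reproduces every `s ∂_u`. So `D` is the space of
solutions, abelian of dimension `n`, and a symmetry acts on it as `ξ d/dt - c`.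

The delicate point is that `ξ₀` might vanish at the base point. In that case the solutions are
exactly `s₀ F(H)` with `H` a local coordinate and `F` a polynomial of degree less than `n`, and
`d/dH` yields a symmetry with nonvanishing `ξ` (`IsLinSym.exists_ne_zero_of_eq_zero`). Since all `ξ`
are multiples of `ξ₀`, this is a contradiction. Hence a symmetry acts on `D` as a scalar exactly
when `ξ = 0`, and otherwise `ξ ≠ 0` at the base point.

If the linear equation has constant coefficients, `∂_t` is a symmetry acting on solutions as `d/dt`.
The characteristic polynomial of this action is that of the equation, and every symmetry acts as `k
d/dt + b`. Conversely, a symmetry with nonscalar action is straightened to `∂_τ`, and the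
Cayley–Hamilton theorem for its action on `D` is a constant-coefficient equation in `τ` satisfied by
all solutions.

The two equations are compared only at jets where the denominator and `D_x φ` are nonzero. The
identity theorem carries symmetries to the linear equation across the excluded jets, and a
continuity argument carries them back. -/

theorem exists_hasDerivAt_clm_apply {E : Type*} [NormedAddCommGroup E] [NormedSpace ℂ E]
    [CompleteSpace E] {A : ℂ → E →L[ℂ] E} {t₀ : ℂ} (hA : AnalyticAt ℂ A t₀) (y₀ : E) :
    ∃ Y : ℂ → E, Y t₀ = y₀ ∧ ∀ᶠ t in 𝓝 t₀, HasDerivAt Y (A t (Y t)) t := by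
  obtain ⟨M, hM0, hM⟩ : ∃ M : ℝ, 0 < M ∧ ∀ᶠ t in 𝓝 t₀, ‖A t‖ ≤ M := by
    refine ⟨‖A t₀‖ + 1, by positivity, ?_⟩
    have : Tendsto (fun t => ‖A t‖) (𝓝 t₀) (𝓝 ‖A t₀‖) := hA.continuousAt.norm
    exact this.eventually_le_const (by linarith)
  obtain ⟨R, hR, hball⟩ := Metric.eventually_nhds_iff_ball.1 (hM.and hA.eventually_analyticAt)
  -- With `M * r ≤ 1 / 2` each integration halves the bound, so the Picard corrections form a
  -- geometric series on the whole disc.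
  set r : ℝ := min R (1 / (2 * M)) with hr
  have hr0 : 0 < r := by positivity
  have hMr : M * r ≤ 1 / 2 := by
    calc M * r ≤ M * (1 / (2 * M)) := by gcongr; exact min_le_right _ _
      _ = 1 / 2 := by field_simp
  set B := Metric.ball t₀ r with hB
  have hsub : ∀ t ∈ B, ‖A t‖ ≤ M ∧ AnalyticAt ℂ A t := fun t ht =>
    hball t (Metric.ball_subset_ball (min_le_left _ _) ht)
  have ht₀ : t₀ ∈ B := Metric.mem_ball_self hr0
  -- Picard iteration written through its successive corrections: the next correction is the
  -- primitive of `A Z` that vanishes at `t₀`. The solution is the sum of all corrections, starting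
  -- with the constant `y₀`.
  have step : ∀ Z : {Z : ℂ → E // DifferentiableOn ℂ Z B},
      ∃ Z' : {Z : ℂ → E // DifferentiableOn ℂ Z B},
      Z'.1 t₀ = 0 ∧ ∀ t ∈ B, HasDerivAt Z'.1 (A t (Z.1 t)) t := by
    rintro ⟨Z, hZ⟩
    have h : DifferentiableOn ℂ (fun t => A t (Z t)) B := fun t ht =>
      ((hsub t ht).2.differentiableAt.differentiableWithinAt).clm_apply (hZ t ht)
    obtain ⟨g, hg0, hg⟩ := h.isExactOn_ball.with_val_at t₀ 0
    exact ⟨⟨g, fun t ht => (hg t ht).differentiableAt.differentiableWithinAt⟩, hg0, hg⟩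
  choose F hF0 hF using step
  set Z : ℕ → {Z : ℂ → E // DifferentiableOn ℂ Z B} := fun k =>
    F^[k] ⟨fun _ => y₀, differentiableOn_const _⟩ with hZ
  have hZs : ∀ k, Z (k + 1) = F (Z k) := fun k => Function.iterate_succ_apply' _ _ _
  have hbound : ∀ k, ∀ t ∈ B, ‖(Z k).1 t‖ ≤ ‖y₀‖ * (1 / 2) ^ k := by
    intro k
    induction k with
    | zero => intro t _; simp [hZ]
    | succ k ih =>
      intro t ht
      have h := (convex_ball t₀ r).norm_image_sub_le_of_norm_hasDerivWithin_le
        (f := (Z (k + 1)).1) (f' := fun t => A t ((Z k).1 t)) (C := M * (‖y₀‖ * (1 / 2) ^ k))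
        (fun x hx => by rw [hZs]; exact (hF _ x hx).hasDerivWithinAt)
        (fun x hx => (ContinuousLinearMap.le_opNorm _ _).trans
          (mul_le_mul (hsub x hx).1 (ih x hx) (norm_nonneg _) hM0.le)) ht₀ ht
      rw [show (Z (k + 1)).1 t₀ = 0 by rw [hZs]; exact hF0 _, sub_zero] at h
      have ht' : ‖t - t₀‖ ≤ r := (mem_ball_iff_norm.1 ht).le
      calc _ ≤ _ := h
        _ ≤ M * (‖y₀‖ * (1 / 2) ^ k) * r := by gcongr
        _ = (M * r) * (‖y₀‖ * (1 / 2) ^ k) := by ring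
        _ ≤ 1 / 2 * (‖y₀‖ * (1 / 2) ^ k) := by gcongr
        _ = _ := by ring
  have hu : Summable fun k : ℕ => ‖y₀‖ * (1 / 2 : ℝ) ^ k := summable_geometric_two.mul_left _
  have hdiff := Complex.differentiableOn_tsum_of_summable_norm hu (fun k => (Z k).2)
    Metric.isOpen_ball hbound
  have hsum : ∀ t ∈ B, HasSum (fun k => (Z k).1 t) (∑' k, (Z k).1 t) := fun t ht =>
    (hu.of_norm_bounded (fun k => hbound k t ht)).hasSum
  refine ⟨fun t => ∑' k, (Z k).1 t, ?_, ?_⟩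
  · refine (tsum_eq_single 0 ?_).trans ?_
    rotate_left
    · simp [hZ]
    · intro k hk
      obtain ⟨k, rfl⟩ := Nat.exists_eq_succ_of_ne_zero hk
      rw [Nat.succ_eq_add_one, hZs]; exact hF0 _
  · filter_upwards [Metric.isOpen_ball.mem_nhds ht₀] with t ht
    have h1 := Complex.hasSum_deriv_of_summable_norm hu (fun k => (Z k).2)
      Metric.isOpen_ball hbound ht
    have h2 : HasSum (fun k => deriv (Z k).1 t) (A t (∑' k, (Z k).1 t)) := by
      -- Differentiation shifts the index by one, and the constant term `Z 0` contributes nothing.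
      have h3 : HasSum (fun k => deriv (Z (k + 1)).1 t) (A t (∑' k, (Z k).1 t)) := by
        simp_rw [hZs, (hF _ t ht).deriv]
        exact (A t).hasSum (hsum t ht)
      have h4 := (hasSum_nat_add_iff (f := fun k => deriv (Z k).1 t) 1).1 h3
      simpa [hZ] using h4
    rw [← h1.unique h2]
    exact (hdiff.differentiableAt (Metric.isOpen_ball.mem_nhds ht)).hasDerivAt

variable {n : ℕ}

/-- The linear differential operator `s ↦ s^(n) + ∑_{k < n} a_k s^(k)`. -/
def linOp (a : Fin n → ℂ → ℂ) (s : ℂ → ℂ) (t : ℂ) : ℂ :=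
  iteratedDeriv n s t + ∑ k : Fin n, a k t * iteratedDeriv k s t

/-- Holomorphic solutions near `t₀` of the linear equation with coefficients `a`. -/
structure IsSol (a : Fin n → ℂ → ℂ) (t₀ : ℂ) (s : ℂ → ℂ) : Prop where
  analyticAt : AnalyticAt ℂ s t₀
  eq_zero : ∀ᶠ t in 𝓝 t₀, linOp a s t = 0

theorem analyticAt_iteratedDeriv {s : ℂ → ℂ} {t : ℂ} (h : AnalyticAt ℂ s t) (k : ℕ) :
    AnalyticAt ℂ (iteratedDeriv k s) t := by
  induction k with
  | zero => simpa using h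
  | succ k ih => rw [iteratedDeriv_succ]; exact ih.deriv

theorem iteratedDeriv_eventuallyEq {s s' : ℂ → ℂ} {t : ℂ} (h : s =ᶠ[𝓝 t] s') (k : ℕ) :
    iteratedDeriv k s =ᶠ[𝓝 t] iteratedDeriv k s' := by
  induction k with
  | zero => simpa using h
  | succ k ih => simp only [iteratedDeriv_succ]; exact ih.deriv

theorem iteratedDeriv_iteratedDeriv_add (s : ℂ → ℂ) (i k : ℕ) :
    iteratedDeriv i (iteratedDeriv k s) = iteratedDeriv (i + k) s := by
  simp only [iteratedDeriv_eq_iterate, Function.iterate_add_apply]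

theorem linOp_eventuallyEq {a : Fin n → ℂ → ℂ} {s s' : ℂ → ℂ} {t : ℂ} (h : s =ᶠ[𝓝 t] s') :
    linOp a s =ᶠ[𝓝 t] linOp a s' := by
  have h1 : ∀ k : Fin n, ∀ᶠ x in 𝓝 t, iteratedDeriv k s x = iteratedDeriv k s' x := fun k =>
    iteratedDeriv_eventuallyEq h k
  filter_upwards [iteratedDeriv_eventuallyEq h n, eventually_all.2 h1] with x h1 h2
  simp only [linOp, h1, h2]

theorem linOp_add {a : Fin n → ℂ → ℂ} {s s' : ℂ → ℂ} {t : ℂ} (h : AnalyticAt ℂ s t)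
    (h' : AnalyticAt ℂ s' t) :
    linOp a (fun t => s t + s' t) t = linOp a s t + linOp a s' t := by
  simp only [linOp]
  have h1 (k : ℕ) : iteratedDeriv k (fun t => s t + s' t) t
      = iteratedDeriv k s t + iteratedDeriv k s' t :=
    iteratedDeriv_fun_add h.contDiffAt h'.contDiffAt
  simp only [h1, mul_add, Finset.sum_add_distrib]
  ring

theorem linOp_const_mul {a : Fin n → ℂ → ℂ} {s : ℂ → ℂ} {t : ℂ} (c : ℂ) (h : AnalyticAt ℂ s t) :
    linOp a (fun t => c * s t) t = c * linOp a s t := by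
  simp only [linOp]
  have h1 (k : ℕ) : iteratedDeriv k (fun t => c * s t) t = c * iteratedDeriv k s t :=
    iteratedDeriv_const_mul c h.contDiffAt
  simp only [h1, mul_add, Finset.mul_sum]
  congr 1
  exact Finset.sum_congr rfl fun _ _ => by ring

namespace IsSol

variable {a : Fin n → ℂ → ℂ} {t₀ : ℂ} {s s' : ℂ → ℂ}

theorem congr (h : IsSol a t₀ s) (he : s =ᶠ[𝓝 t₀] s') : IsSol a t₀ s' :=
  ⟨h.analyticAt.congr he, (linOp_eventuallyEq he).symm.trans h.eq_zero⟩

theorem zero : IsSol a t₀ fun _ => 0 :=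
  ⟨analyticAt_const, Eventually.of_forall fun t => by simp [linOp]⟩

theorem add (h : IsSol a t₀ s) (h' : IsSol a t₀ s') : IsSol a t₀ fun t => s t + s' t := by
  refine ⟨h.analyticAt.add h'.analyticAt, ?_⟩
  filter_upwards [h.eq_zero, h'.eq_zero, h.analyticAt.eventually_analyticAt,
    h'.analyticAt.eventually_analyticAt] with t h1 h2 h3 h4
  rw [linOp_add h3 h4, h1, h2, add_zero]

theorem const_mul (c : ℂ) (h : IsSol a t₀ s) : IsSol a t₀ fun t => c * s t := by
  refine ⟨analyticAt_const.mul h.analyticAt, ?_⟩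
  filter_upwards [h.eq_zero, h.analyticAt.eventually_analyticAt] with t h1 h3
  rw [linOp_const_mul c h3, h1, mul_zero]

theorem sub (h : IsSol a t₀ s) (h' : IsSol a t₀ s') : IsSol a t₀ fun t => s t - s' t :=
  (h.add (h'.const_mul (-1))).congr (Eventually.of_forall fun t => by ring)

theorem sum {ι : Type*} (S : Finset ι) {f : ι → ℂ → ℂ} (h : ∀ i ∈ S, IsSol a t₀ (f i)) :
    IsSol a t₀ fun t => ∑ i ∈ S, f i t := by
  classical
  induction S using Finset.induction_on with
  | empty => simpa using zero
  | insert i S hi ih =>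
    simp only [Finset.sum_insert hi]
    exact (h i (by simp)).add (ih fun j hj => h j (by simp [hj]))

theorem eventually (h : IsSol a t₀ s) : ∀ᶠ t in 𝓝 t₀, IsSol a t s := by
  filter_upwards [h.eq_zero.eventually_nhds, h.analyticAt.eventually_analyticAt] with t h1 h2
  exact ⟨h2, h1⟩

/-- Uniqueness for the initial value problem: the equation differentiated `m` times expresses the
derivative of order `n + m` at `t₀` through lower ones, so all Taylor coefficients vanish. It is
used throughout to identify solutions that agree to order `n`. -/
theorem eventually_eq_zero (ha : ∀ k, AnalyticAt ℂ (a k) t₀) (h : IsSol a t₀ s)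
    (hn : n ≤ analyticOrderAt s t₀) : s =ᶠ[𝓝 t₀] 0 := by
  have key : ∀ m i, i < n + m → iteratedDeriv i s t₀ = 0 := by
    intro m
    induction m with
    | zero => exact (natCast_le_analyticOrderAt_iff_iteratedDeriv_eq_zero h.analyticAt).1 hn
    | succ m ih =>
      intro i hi
      rcases Nat.lt_or_ge i (n + m) with hi' | hi'
      · exact ih i hi'
      obtain rfl : i = m + n := by omega
      have hk : ∀ k : Fin n, AnalyticAt ℂ (fun t => a k t * iteratedDeriv k s t) t₀ := fun k =>
        (ha k).mul (analyticAt_iteratedDeriv h.analyticAt k)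
      have hord : ∀ k : Fin n, ∀ j < m + 1,
          iteratedDeriv j (fun t => a k t * iteratedDeriv k s t) t₀ = 0 := by
        intro k
        rw [← natCast_le_analyticOrderAt_iff_iteratedDeriv_eq_zero (hk k)]
        -- All derivatives of `s` of order below `n + m` vanish and `k < n`, which leaves at least
        -- `m + 1` zeros for the `k`-th derivative.
        have h1 : ((m + 1 : ℕ) : ℕ∞) ≤ analyticOrderAt (iteratedDeriv k s) t₀ := by
          rw [natCast_le_analyticOrderAt_iff_iteratedDeriv_eq_zero
            (analyticAt_iteratedDeriv h.analyticAt k)]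
          intro j hj
          rw [iteratedDeriv_iteratedDeriv_add]
          exact ih _ (by have := k.2; omega)
        have h2 := analyticOrderAt_mul (ha k) (analyticAt_iteratedDeriv h.analyticAt k)
        calc _ ≤ _ := h1
          _ ≤ analyticOrderAt (a k) t₀ + analyticOrderAt (iteratedDeriv k s) t₀ :=
            le_add_of_nonneg_left (zero_le)
          _ = _ := h2.symm
      have h3 : iteratedDeriv n s =ᶠ[𝓝 t₀]
          fun t => (-1 : ℂ) * ∑ k : Fin n, a k t * iteratedDeriv k s t := by
        filter_upwards [h.eq_zero] with t ht
        rw [linOp] at ht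
        linear_combination ht
      rw [← iteratedDeriv_iteratedDeriv_add, (iteratedDeriv_eventuallyEq h3 m).eq_of_nhds,
        iteratedDeriv_const_mul _ (Finset.analyticAt_fun_sum _ fun k _ => hk k).contDiffAt,
        iteratedDeriv_fun_sum fun k _ => (hk k).contDiffAt,
        Finset.sum_eq_zero fun k _ => hord k m (by omega), mul_zero]
  have : analyticOrderAt s t₀ = ⊤ := by
    rw [ENat.eq_top_iff_forall_ge]
    intro m
    rw [natCast_le_analyticOrderAt_iff_iteratedDeriv_eq_zero h.analyticAt]
    exact fun i hi => key m i (by omega)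
  exact analyticOrderAt_eq_top.1 this

/-- The initial value problem. -/
theorem exists_iteratedDeriv_eq (hn : 0 < n) (ha : ∀ k, AnalyticAt ℂ (a k) t₀) (α : Fin n → ℂ) :
    ∃ s, IsSol a t₀ s ∧ ∀ k : Fin n, iteratedDeriv k s t₀ = α k := by
  -- The companion system: `L₀` is the shift `Y_k' = Y_(k+1)`, and `L₁ i` places the `i`-th
  -- coordinate in the last row. Coordinate `0` of its solution is the function sought.
  let P : Fin n → (Fin n → ℂ) →L[ℂ] ℂ := ContinuousLinearMap.proj
  let L₀ : (Fin n → ℂ) →L[ℂ] (Fin n → ℂ) := ContinuousLinearMap.pi fun k : Fin n =>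
    if h : k.val + 1 < n then P ⟨k + 1, h⟩ else 0
  let L₁ : Fin n → (Fin n → ℂ) →L[ℂ] (Fin n → ℂ) := fun i => ContinuousLinearMap.pi fun k : Fin n =>
    if k.val + 1 < n then 0 else P i
  let L : ℂ → (Fin n → ℂ) →L[ℂ] (Fin n → ℂ) := fun t => L₀ + ∑ i : Fin n, (-a i t) • L₁ i
  have hL : AnalyticAt ℂ L t₀ := analyticAt_const.add
    (Finset.analyticAt_fun_sum _ fun i _ => (ha i).neg.smul analyticAt_const)
  obtain ⟨Y, hY0, hY⟩ := exists_hasDerivAt_clm_apply hL α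
  have hanY : ∀ᶠ t in 𝓝 t₀, AnalyticAt ℂ Y t := by
    filter_upwards [hY.eventually_nhds] with t ht
    rw [Complex.analyticAt_iff_eventually_differentiableAt]
    exact ht.mono fun x hx => hx.differentiableAt
  have hcomp : ∀ᶠ t in 𝓝 t₀, ∀ k : Fin n, HasDerivAt (fun t => Y t k) (L t (Y t) k) t :=
    hY.mono fun t ht k => (hasDerivAt_pi.1 ht) k
  have hder : ∀ k (hk : k < n), iteratedDeriv k (fun t => Y t ⟨0, hn⟩) =ᶠ[𝓝 t₀]
      fun t => Y t ⟨k, hk⟩ := by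
    intro k
    induction k with
    | zero => intro hk; simp
    | succ k ih =>
      intro hk
      rw [iteratedDeriv_succ]
      refine (ih (by omega)).deriv.trans ?_
      filter_upwards [hcomp] with t ht
      rw [(ht ⟨k, by omega⟩).deriv]
      simp [L, L₀, L₁, P, hk]
  have hs : AnalyticAt ℂ (fun t => Y t ⟨0, hn⟩) t₀ :=
    ((ContinuousLinearMap.proj (R := ℂ) (φ := fun _ : Fin n => ℂ) ⟨0, hn⟩).analyticAt _).comp
      hanY.self_of_nhds
  refine ⟨fun t => Y t ⟨0, hn⟩, ⟨hs, ?_⟩, fun k => by rw [(hder k k.2).eq_of_nhds, hY0]⟩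
  have htop : iteratedDeriv n (fun t => Y t ⟨0, hn⟩) =ᶠ[𝓝 t₀]
      fun t => ∑ i : Fin n, -a i t * Y t i := by
    obtain ⟨m, rfl⟩ := Nat.exists_eq_succ_of_ne_zero hn.ne'
    have h := (hder m (by omega)).deriv
    rw [← iteratedDeriv_succ] at h
    refine h.trans ?_
    filter_upwards [hcomp] with t ht
    rw [(ht ⟨m, by omega⟩).deriv]
    simp [L, L₀, L₁, P]
  filter_upwards [htop, eventually_all.2 fun k : Fin n => hder k k.2] with t h1 h2
  simp only [linOp, h1, h2]
  simp

end IsSol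

end ODESymm
end
noncomputable section

open Filter Topology Polynomial VectorField
open scoped ContDiff

namespace ODESymm

namespace Jet

variable {n : ℕ}

/-! Prolongation of point transformations -/

/-- The prolongation of a point transformation to the jet space. -/
def pointMap (Φ : ℂ × ℂ → ℂ × ℂ) (j : Jet n) : Jet n :=
  Fin.cons (Φ j.base).1 (fun k : Fin (n + 1) => pointMapCoord Φ k.val j)

/-- The unit vector in the direction of the coordinate `y^(k)`. -/
def dirVec (k : ℕ) : Jet n := fun i => if i.val = k + 1 then 1 else 0

variable {Φ Ψ : ℂ × ℂ → ℂ × ℂ} {j : Jet n}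

theorem dcoord_of_le {k : ℕ} (hk : k ≤ n) (j : Jet n) :
    dcoord k j = j (Fin.succ ⟨k, by omega⟩) := by
  unfold dcoord
  rw [dif_pos (by omega)]
  rfl

theorem dcoord_cons {k : ℕ} (hk : k ≤ n) (x : ℂ) (f : Fin (n + 1) → ℂ) :
    dcoord k (Fin.cons x f : Jet n) = f ⟨k, by omega⟩ := by
  rw [dcoord_of_le hk]; rfl

theorem dcoord_dirVec {k m : ℕ} (hk : k ≤ n) :
    dcoord k (dirVec m : Jet n) = if k = m then 1 else 0 := by
  simp [dcoord_of_le hk, dirVec]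

theorem dcoord_pointMap {k : ℕ} (hk : k ≤ n) (Φ : ℂ × ℂ → ℂ × ℂ) (j : Jet n) :
    dcoord k (pointMap Φ j) = pointMapCoord Φ k j :=
  dcoord_cons hk _ _

theorem base_cons (x : ℂ) (f : Fin (n + 1) → ℂ) : base (Fin.cons x f : Jet n) = (x, f 0) := rfl

theorem base_pointMap (Φ : ℂ × ℂ → ℂ × ℂ) (j : Jet n) : base (pointMap Φ j) = Φ j.base := by
  simp [pointMap, base_cons, pointMapCoord]

theorem contDiffAt_totalDeriv_fst (h : AnalyticAt ℂ Φ j.base) :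
    ContDiffAt ℂ ω (totalDeriv fun j : Jet n => (Φ j.base).1) j :=
  contDiffAt_totalDeriv (contDiffAt_fst h)

theorem contDiffAt_pointMapCoord (h : AnalyticAt ℂ Φ j.base)
    (hD : totalDeriv (fun j : Jet n => (Φ j.base).1) j ≠ 0) (k : ℕ) :
    ContDiffAt ℂ ω (pointMapCoord Φ k) j := by
  induction k with
  | zero => exact (h.contDiffAt.comp j contDiff_base.contDiffAt).snd
  | succ k ih => exact (contDiffAt_totalDeriv ih).div (contDiffAt_totalDeriv_fst h) hD

theorem contDiffAt_pointMap (h : AnalyticAt ℂ Φ j.base)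
    (hD : totalDeriv (fun j : Jet n => (Φ j.base).1) j ≠ 0) :
    ContDiffAt ℂ ω (pointMap Φ : Jet n → Jet n) j := by
  rw [contDiffAt_pi]
  intro i
  refine Fin.cases ?_ (fun k => ?_) i
  · simpa [pointMap] using contDiffAt_fst h
  · simpa [pointMap] using contDiffAt_pointMapCoord h hD _

theorem eventually_totalDeriv_fst_ne_zero (h : AnalyticAt ℂ Φ j.base)
    (hD : totalDeriv (fun j : Jet n => (Φ j.base).1) j ≠ 0) :
    ∀ᶠ j' in 𝓝 j, totalDeriv (fun j : Jet n => (Φ j.base).1) j' ≠ 0 :=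
  (contDiffAt_totalDeriv_fst h).continuousAt.eventually_ne hD

theorem indep_totalDeriv_fst :
    Indep (totalDeriv fun j : Jet n => (Φ j.base).1) 2 :=
  (indep_base (G := fun z => (Φ z).1)).totalDeriv

theorem indep_pointMapCoord (Φ : ℂ × ℂ → ℂ × ℂ) (k : ℕ) :
    Indep (pointMapCoord Φ k : Jet n → ℂ) (k + 1) := by
  induction k with
  | zero => exact indep_base (G := fun z => (Φ z).2)
  | succ k ih =>
    intro j e he
    have h2 := (indep_totalDeriv_fst (Φ := Φ).mono (by omega : 2 ≤ k + 1 + 1)) j e he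
    simp only [pointMapCoord, ih.totalDeriv j e he, h2]

theorem fderiv_pointMap_zero (h : AnalyticAt ℂ Φ j.base)
    (hD : totalDeriv (fun j : Jet n => (Φ j.base).1) j ≠ 0) (e : Jet n) :
    fderiv ℂ (pointMap Φ) j e 0 = fderiv ℂ (fun j : Jet n => (Φ j.base).1) j e := by
  rw [show (fun j : Jet n => (Φ j.base).1) = fun j => pointMap Φ j 0 from rfl,
    fderiv_apply ((contDiffAt_pointMap h hD).differentiableAt (by simp))]
  rfl

theorem fderiv_pointMap_succ (h : AnalyticAt ℂ Φ j.base)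
    (hD : totalDeriv (fun j : Jet n => (Φ j.base).1) j ≠ 0) (e : Jet n) (k : Fin (n + 1)) :
    fderiv ℂ (pointMap Φ) j e k.succ = fderiv ℂ (pointMapCoord Φ k) j e := by
  rw [show (pointMapCoord Φ k : Jet n → ℂ) = fun j => pointMap Φ j k.succ from rfl,
    fderiv_apply ((contDiffAt_pointMap h hD).differentiableAt (by simp))]
  rfl

/-- The total derivative transforms by the factor `D_x φ`. -/
theorem totalDeriv_comp_pointMap (h : AnalyticAt ℂ Φ j.base)
    (hD : totalDeriv (fun j : Jet n => (Φ j.base).1) j ≠ 0) {G : Jet n → ℂ}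
    (hG : DifferentiableAt ℂ G (pointMap Φ j)) (hi : Indep G n) :
    totalDeriv (fun j => G (pointMap Φ j)) j =
      totalDeriv (fun j : Jet n => (Φ j.base).1) j * totalDeriv G (pointMap Φ j) := by
  have hP := (contDiffAt_pointMap h hD).differentiableAt (by simp)
  have h1 : totalDeriv (fun j => G (pointMap Φ j)) j
      = fderiv ℂ G (pointMap Φ j) (fderiv ℂ (pointMap Φ) j (totalField j)) := by
    have := (hG.hasFDerivAt.comp j hP.hasFDerivAt).fderiv
    simp only [totalDeriv]
    rw [show (fun j => G (pointMap Φ j)) = G ∘ pointMap Φ from rfl, this]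
    rfl
  -- The image of `D_x` and `D_x φ` times the total field at the image agree in the coordinates `0,
  -- …, n` by the recursion for `u^(k+1)`. They may differ in the last coordinate, where the total
  -- field is truncated, but `G` does not depend on it.
  have h0 : fderiv ℂ G (pointMap Φ j) (fderiv ℂ (pointMap Φ) j (totalField j)
      - totalDeriv (fun j : Jet n => (Φ j.base).1) j • totalField (pointMap Φ j)) = 0 := by
    refine hi.fderiv_zero _ _ fun i hi => ?_
    rw [Pi.sub_apply, Pi.smul_apply]
    refine Fin.cases (fun _ => ?_) (fun k hk => ?_) i hi
    · rw [fderiv_pointMap_zero h hD]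
      simp [totalField, totalDeriv]
    · have hk' : k.val + 1 ≤ n := by simpa using hk
      rw [fderiv_pointMap_succ h hD]
      simp only [totalField, Fin.cons_succ, smul_eq_mul, dcoord_pointMap hk', pointMapCoord]
      rw [mul_div_cancel₀ _ hD]
      exact sub_self _
  rw [map_sub, map_smul, sub_eq_zero] at h0
  rw [h1, h0]
  rfl

/-- Prolongation commutes with point transformations. -/
theorem fderiv_pointMapCoord_prolong {v w : ℂ × ℂ → ℂ × ℂ} {k : ℕ} (hk : k ≤ n)
    (h : AnalyticAt ℂ Φ j.base) (hv : AnalyticAt ℂ v j.base) (hw : AnalyticAt ℂ w (Φ j.base))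
    (hvw : ∀ᶠ z in 𝓝 j.base, fderiv ℂ Φ z (v z) = w (Φ z))
    (hD : totalDeriv (fun j : Jet n => (Φ j.base).1) j ≠ 0) :
    fderiv ℂ (pointMapCoord Φ k) j (prolong v j) = prolongCoeff w k (pointMap Φ j) := by
  induction k generalizing j with
  | zero =>
    have hd := h.differentiableAt
    have h1 := fderiv_comp_base (G := fun z => (Φ z).2) hd.snd (prolong v j)
    rw [fderiv.snd hd, base_prolong] at h1
    refine h1.trans ?_
    simp [hvw.self_of_nhds, prolongCoeff, base_pointMap]
  | succ k ih =>
    have hev : ∀ᶠ j' in 𝓝 j, AnalyticAt ℂ Φ (base j') ∧ AnalyticAt ℂ v (base j') ∧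
        AnalyticAt ℂ w (Φ (base j')) ∧ (∀ᶠ z in 𝓝 (base j'), fderiv ℂ Φ z (v z) = w (Φ z)) :=
      eventually_base (h.eventually_analyticAt.and (hv.eventually_analyticAt.and
        ((h.continuousAt.eventually hw.eventually_analyticAt).and hvw.eventually_nhds)))
    have hevD := eventually_totalDeriv_fst_ne_zero h hD
    have h1 : (fun j => fderiv ℂ (pointMapCoord Φ k) j (prolong v j)) =ᶠ[𝓝 j]
        fun j => prolongCoeff w k (pointMap Φ j) := by
      filter_upwards [hev, hevD] with j' h1 h2
      exact ih (by omega) h1.1 h1.2.1 h1.2.2.1 h1.2.2.2 h2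
    have h2 : (fun j => fderiv ℂ (fun j : Jet n => (Φ j.base).1) j (prolong v j)) =ᶠ[𝓝 j]
        fun j => (w (pointMap Φ j).base).1 := by
      filter_upwards [hev] with j' h1
      have hd := h1.1.differentiableAt
      have h3 := fderiv_comp_base (G := fun z => (Φ z).1) hd.fst (prolong v j')
      rw [fderiv.fst hd, base_prolong] at h3
      refine h3.trans ?_
      simp [h1.2.2.2.self_of_nhds, base_pointMap]
    have hF := contDiffAt_pointMapCoord h hD k
    have hφ := contDiffAt_fst h
    -- The commutation rule `[pr v, D_x] = -(D_x ξ) D_x` is applied to the numerator's `u^(k)` and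
    -- to `φ`. The terms with `D_x ξ` cancel in the quotient `u^(k+1) = D_x u^(k) / D_x φ`.
    have c1 := commutator hv hF ((indep_pointMapCoord Φ k).mono (by omega))
    have c2 := commutator hv hφ ((indep_base (G := fun z => (Φ z).1)).mono (by omega))
    have hw' : AnalyticAt ℂ w (pointMap Φ j).base := by rwa [base_pointMap]
    rw [totalDeriv_congr h1, totalDeriv_comp_pointMap h hD
      ((contDiffAt_prolongCoeff hw' k).differentiableAt (by simp))
      ((indep_prolongCoeff w k).mono (by omega))] at c1
    rw [totalDeriv_congr h2, totalDeriv_comp_pointMap (G := fun j => (w j.base).1) h hD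
      ((contDiffAt_fst hw').differentiableAt (by simp))
      ((indep_base (G := fun z => (w z).1)).mono (by omega))] at c2
    have d1 := (contDiffAt_totalDeriv hF).differentiableAt (by simp)
    have d2 := (contDiffAt_totalDeriv hφ).differentiableAt (by simp)
    have hdiv : fderiv ℂ (pointMapCoord Φ (k + 1)) j (prolong v j) *
        totalDeriv (fun j : Jet n => (Φ j.base).1) j
        + pointMapCoord Φ (k + 1) j *
          fderiv ℂ (totalDeriv (fun j : Jet n => (Φ j.base).1)) j (prolong v j)
        = fderiv ℂ (totalDeriv (pointMapCoord Φ k)) j (prolong v j) := by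
      have e : totalDeriv (pointMapCoord Φ k) =ᶠ[𝓝 j] fun j => pointMapCoord Φ (k + 1) j *
          totalDeriv (fun j : Jet n => (Φ j.base).1) j := by
        filter_upwards [hevD] with j' hj'
        simp only [pointMapCoord]
        rw [div_mul_cancel₀ _ hj']
      rw [e.fderiv_eq, fderiv_fun_mul
        ((contDiffAt_pointMapCoord h hD (k + 1)).differentiableAt (by simp)) d2]
      simp only [add_apply, smul_apply, smul_eq_mul]
      ring
    rw [c1, c2] at hdiv
    have hT : totalDeriv (pointMapCoord Φ k) j = pointMapCoord Φ (k + 1) j *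
        totalDeriv (fun j : Jet n => (Φ j.base).1) j := by
      simp only [pointMapCoord]
      rw [div_mul_cancel₀ _ hD]
    simp only [prolongCoeff, dcoord_pointMap hk]
    refine mul_right_cancel₀ hD ?_
    rw [hT] at hdiv
    linear_combination hdiv

theorem fderiv_pointMap_prolong {v w : ℂ × ℂ → ℂ × ℂ}
    (h : AnalyticAt ℂ Φ j.base) (hv : AnalyticAt ℂ v j.base) (hw : AnalyticAt ℂ w (Φ j.base))
    (hvw : ∀ᶠ z in 𝓝 j.base, fderiv ℂ Φ z (v z) = w (Φ z))
    (hD : totalDeriv (fun j : Jet n => (Φ j.base).1) j ≠ 0) :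
    fderiv ℂ (pointMap Φ) j (prolong v j) = prolong w (pointMap Φ j) := by
  ext i
  refine Fin.cases ?_ (fun k => ?_) i
  · have hd := h.differentiableAt
    have h3 := fderiv_comp_base (G := fun z => (Φ z).1) hd.fst (prolong v j)
    rw [fderiv.fst hd, base_prolong] at h3
    rw [fderiv_pointMap_zero h hD, h3]
    simp [hvw.self_of_nhds, base_pointMap, prolong]
  · rw [fderiv_pointMap_succ h hD, fderiv_pointMapCoord_prolong (by omega) h hv hw hvw hD]
    simp [prolong]

theorem pointMapCoord_comp {k : ℕ} (hk : k ≤ n) (h : AnalyticAt ℂ Φ j.base)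
    (h' : AnalyticAt ℂ Ψ (Φ j.base))
    (hD : totalDeriv (fun j : Jet n => (Φ j.base).1) j ≠ 0)
    (hD' : totalDeriv (fun j : Jet n => (Ψ j.base).1) (pointMap Φ j) ≠ 0) :
    pointMapCoord (Ψ ∘ Φ) k j = pointMapCoord Ψ k (pointMap Φ j) := by
  induction k generalizing j with
  | zero => simp [pointMapCoord, base_pointMap]
  | succ k ih =>
    have hΨ : AnalyticAt ℂ Ψ (pointMap Φ j).base := by rwa [base_pointMap]
    have hev : ∀ᶠ j' in 𝓝 j, AnalyticAt ℂ Φ (base j') ∧ AnalyticAt ℂ Ψ (Φ (base j')) :=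
      eventually_base (h.eventually_analyticAt.and
        (h.continuousAt.eventually h'.eventually_analyticAt))
    have h1 : pointMapCoord (Ψ ∘ Φ) k =ᶠ[𝓝 j] fun j => pointMapCoord Ψ k (pointMap Φ j) := by
      filter_upwards [hev, eventually_totalDeriv_fst_ne_zero h hD,
        (contDiffAt_pointMap h hD).continuousAt.eventually
          (eventually_totalDeriv_fst_ne_zero hΨ hD')] with j' h1 h2 h3
      exact ih (by omega) h1.1 h1.2 h2 h3
    have h2 : (fun j : Jet n => ((Ψ ∘ Φ) j.base).1) = fun j => (Ψ (pointMap Φ j).base).1 := by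
      simp [base_pointMap]
    simp only [pointMapCoord]
    rw [totalDeriv_congr h1, h2, totalDeriv_comp_pointMap h hD
      ((contDiffAt_pointMapCoord hΨ hD' k).differentiableAt (by simp))
      ((indep_pointMapCoord Ψ k).mono (by omega)),
      totalDeriv_comp_pointMap (G := fun j => (Ψ j.base).1) h hD
      ((contDiffAt_fst hΨ).differentiableAt (by simp))
      ((indep_base (G := fun z => (Ψ z).1)).mono (by omega)), mul_div_mul_left _ _ hD]

/-! Dependence on the highest derivative -/

/-- The function `F` has order at most `k`, so `y^(k+1)` enters `D_x F` only through the single term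
`y^(k+1) ∂F/∂y^(k)`. -/
theorem totalDeriv_add_dirVec {F : Jet n → ℂ} {k : ℕ} (hk : k + 1 ≤ n) (hi : Indep F (k + 1))
    (j : Jet n) (c : ℂ) :
    totalDeriv F (j + c • dirVec (k + 1)) = totalDeriv F j + c * fderiv ℂ F j (dirVec k) := by
  have h1 : fderiv ℂ F (j + c • dirVec (k + 1)) = fderiv ℂ F j := by
    rw [← fderiv_comp_add_right]
    congr 1
    ext x
    refine hi x _ fun i hi => ?_
    have : i.val ≠ k + 1 + 1 := by omega
    simp [dirVec, this]
  unfold totalDeriv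
  rw [h1, ← smul_eq_mul, ← map_smul, ← map_add]
  congr 1
  ext i
  refine Fin.cases ?_ (fun m => ?_) i
  · simp [totalField, dirVec]
  · simp only [totalField, Fin.cons_succ, dcoord_add, dcoord_smul, Pi.add_apply, Pi.smul_apply,
      smul_eq_mul]
    congr 2
    rcases Nat.lt_or_ge m n with hm | hm
    · rw [dcoord_dirVec (by omega)]
      simp [dirVec]
    · have h2 : m.val ≠ k := by omega
      unfold dcoord
      rw [dif_neg (by omega)]
      simp [dirVec, h2]

/-- From order two on, the denominator `D_x φ` does not contain the highest derivative, which leaves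
an affine dependence. Order one is excluded because `u'` is a fractional linear function of `y'`. -/
theorem pointMapCoord_add_dirVec {k : ℕ} (hk : k + 2 ≤ n) (j : Jet n) (c : ℂ) :
    pointMapCoord Φ (k + 2) (j + c • dirVec (k + 2)) = pointMapCoord Φ (k + 2) j
      + c * (fderiv ℂ (pointMapCoord Φ (k + 1)) j (dirVec (k + 1))
        / totalDeriv (fun j : Jet n => (Φ j.base).1) j) := by
  have h2 : totalDeriv (fun j : Jet n => (Φ j.base).1) (j + c • dirVec (k + 2))
      = totalDeriv (fun j : Jet n => (Φ j.base).1) j := by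
    refine indep_totalDeriv_fst _ _ fun i hi => ?_
    have : i.val ≠ k + 2 + 1 := by omega
    simp [dirVec, this]
  rw [pointMapCoord]
  simp only
  rw [h2, totalDeriv_add_dirVec (by omega) (indep_pointMapCoord Φ _)]
  simp only [pointMapCoord]
  ring

theorem base_dirVec_zero : base (dirVec 0 : Jet n) = (0, 1) := by
  unfold base dirVec
  simp

theorem base_totalField (j : Jet n) : base (totalField j) = (1, dcoord 1 j) := by
  rfl

theorem totalDeriv_comp_base {G : ℂ × ℂ → ℂ} (h : DifferentiableAt ℂ G j.base) :
    totalDeriv (fun j : Jet n => G j.base) j = fderiv ℂ G j.base (1, dcoord 1 j) := by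
  rw [totalDeriv, fderiv_comp_base h, base_totalField]

/-- In order one this derivative is the Jacobian of `Φ` divided by `(D_x φ)^2`; each further order
divides it once more by `D_x φ`. -/
theorem fderiv_pointMapCoord_dirVec_ne_zero {k : ℕ} (hk : k + 1 ≤ n) (h : AnalyticAt ℂ Φ j.base)
    (hinj : Function.Injective (fderiv ℂ Φ j.base))
    (hD : totalDeriv (fun j : Jet n => (Φ j.base).1) j ≠ 0) :
    fderiv ℂ (pointMapCoord Φ (k + 1)) j (dirVec (k + 1)) ≠ 0 := by
  have hline (k : ℕ) : HasLineDerivAt ℂ (pointMapCoord Φ (k + 1))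
      (fderiv ℂ (pointMapCoord Φ (k + 1)) j (dirVec (k + 1))) j (dirVec (k + 1)) :=
    ((contDiffAt_pointMapCoord h hD (k + 1)).differentiableAt
      (by simp)).hasFDerivAt.hasLineDerivAt _
  induction k with
  | zero =>
    have hd := h.differentiableAt
    set A := fderiv ℂ Φ j.base with hA
    have hφ1 := totalDeriv_comp_base hd.fst
    have hψ1 := totalDeriv_comp_base hd.snd
    have hφ2 := fderiv_comp_base (n := n) (G := fun z => (Φ z).1) hd.fst (dirVec 0)
    have hψ2 := fderiv_comp_base (n := n) (G := fun z => (Φ z).2) hd.snd (dirVec 0)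
    rw [fderiv.fst hd] at hφ1 hφ2
    rw [fderiv.snd hd] at hψ1 hψ2
    rw [base_dirVec_zero] at hφ2 hψ2
    set φ1 := totalDeriv (fun j : Jet n => (Φ j.base).1) j with eφ1
    set ψ1 := totalDeriv (fun j : Jet n => (Φ j.base).2) j with eψ1
    set φ2 := fderiv ℂ (fun j : Jet n => (Φ j.base).1) j (dirVec 0) with eφ2
    set ψ2 := fderiv ℂ (fun j : Jet n => (Φ j.base).2) j (dirVec 0) with eψ2
    have hval : HasLineDerivAt ℂ (pointMapCoord Φ (0 + 1)) ((ψ2 * φ1 - ψ1 * φ2) / φ1 ^ 2) j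
        (dirVec (0 + 1)) := by
      unfold HasLineDerivAt
      have e : (fun t : ℂ => pointMapCoord Φ (0 + 1) (j + t • dirVec (0 + 1)))
          = fun t => (ψ1 + t * ψ2) / (φ1 + t * φ2) := by
        ext t
        simp only [pointMapCoord]
        rw [totalDeriv_add_dirVec (by omega) (indep_base (G := fun z => (Φ z).1)),
          totalDeriv_add_dirVec (by omega) (indep_base (G := fun z => (Φ z).2))]
      rw [e]
      have d1 : HasDerivAt (fun t : ℂ => ψ1 + t * ψ2) ψ2 0 := by
        simpa using ((hasDerivAt_id (0 : ℂ)).mul_const ψ2).const_add ψ1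
      have d2 : HasDerivAt (fun t : ℂ => φ1 + t * φ2) φ2 0 := by
        simpa using ((hasDerivAt_id (0 : ℂ)).mul_const φ2).const_add φ1
      have d3 := d1.fun_div d2 (by simpa using hD)
      simp only [zero_mul, add_zero] at d3
      exact d3
    rw [(hline 0).unique hval]
    refine div_ne_zero (fun h0 => ?_) (pow_ne_zero _ hD)
    -- If the Jacobian numerator vanished, this combination would lie in the kernel of the
    -- derivative of `Φ`. Its coordinates then give `φ2 = 0` and `φ1 = 0`, against `hD`.
    have hz : A (φ1 • ((0 : ℂ), (1 : ℂ)) - φ2 • ((1 : ℂ), dcoord 1 j)) = 0 := by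
      have p1 : A (0, 1) = (φ2, ψ2) := by ext <;> simp [hφ2, hψ2, hA]
      have p2 : A (1, dcoord 1 j) = (φ1, ψ1) := by ext <;> simp [hφ1, hψ1, hA]
      rw [map_sub, map_smul, map_smul, p1, p2]
      ext
      · simp; ring
      · simp; linear_combination h0
    have hz' := hinj (hz.trans (map_zero A).symm)
    have e1 := congrArg Prod.fst hz'
    have e2 := congrArg Prod.snd hz'
    simp at e1 e2
    rw [e1] at e2
    exact hD (by simpa using e2)
  | succ k ih =>
    have hval : HasLineDerivAt ℂ (pointMapCoord Φ (k + 1 + 1))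
        (fderiv ℂ (pointMapCoord Φ (k + 1)) j (dirVec (k + 1))
        / totalDeriv (fun j : Jet n => (Φ j.base).1) j) j (dirVec (k + 1 + 1)) := by
      unfold HasLineDerivAt
      simp only [pointMapCoord_add_dirVec hk]
      simpa using ((hasDerivAt_id (0 : ℂ)).mul_const _).const_add (pointMapCoord Φ (k + 2) j)
    rw [(hline (k + 1)).unique hval]
    exact div_ne_zero (ih (by omega)) hD

/-- The derivative is block triangular: the derivative of `Φ` on `(x, y)`, followed by the nonzero
diagonal entries `∂u^(k)/∂y^(k)`. The kernel is therefore zero coordinate by coordinate. -/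
theorem injective_fderiv_pointMap (h : AnalyticAt ℂ Φ j.base)
    (hinj : Function.Injective (fderiv ℂ Φ j.base))
    (hD : totalDeriv (fun j : Jet n => (Φ j.base).1) j ≠ 0) :
    Function.Injective (fderiv ℂ (pointMap Φ) j) := by
  rw [injective_iff_map_eq_zero]
  intro e he
  have hd := h.differentiableAt
  have h1 := fderiv_pointMap_zero h hD e
  have h2 (k : Fin (n + 1)) := fderiv_pointMap_succ h hD e k
  simp only [he, Pi.zero_apply] at h1 h2
  have hb : e.base = 0 := by
    refine hinj ?_
    rw [map_zero]
    have a1 := fderiv_comp_base (G := fun z => (Φ z).1) hd.fst e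
    have a2 := fderiv_comp_base (G := fun z => (Φ z).2) hd.snd e
    rw [fderiv.fst hd, ← h1] at a1
    have h20 := h2 0
    rw [show (pointMapCoord Φ (0 : Fin (n + 1)) : Jet n → ℂ) = fun j => (Φ j.base).2 from rfl]
      at h20
    rw [fderiv.snd hd, ← h20] at a2
    ext
    · simpa using a1.symm
    · simpa using a2.symm
  have hle : ∀ m : ℕ, ∀ i : Fin (n + 2), i.val ≤ m → e i = 0 := by
    intro m
    induction m with
    | zero =>
      intro i hi
      obtain rfl : i = 0 := by ext; simpa using hi
      exact congrArg Prod.fst hb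
    | succ m ih =>
      intro i hi
      rcases Nat.lt_or_ge i (m + 1) with hi' | hi'
      · exact ih i (by omega)
      have him : i.val = m + 1 := by omega
      rcases Nat.eq_zero_or_pos m with rfl | hm
      · obtain rfl : i = 1 := by ext; simpa using him
        exact congrArg Prod.snd hb
      obtain ⟨k, rfl⟩ := Nat.exists_eq_succ_of_ne_zero hm.ne'
      have hkn : k + 1 ≤ n := by omega
      have h3 := h2 ⟨k + 1, by omega⟩
      have h4 : fderiv ℂ (pointMapCoord Φ (k + 1)) j (e - e i • dirVec (k + 1)) = 0 := by
        refine (indep_pointMapCoord Φ (k + 1)).fderiv_zero _ _ fun i' hi'' => ?_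
        rcases Nat.lt_or_ge i' (k + 1 + 1) with h5 | h5
        · have : i'.val ≠ k + 1 + 1 := by omega
          simp [dirVec, this, ih i' (by simp; omega)]
        · obtain rfl : i' = i := by ext; simp at him; omega
          simp at him
          simp [dirVec, him]
      rw [map_sub, map_smul, sub_eq_zero, smul_eq_mul] at h4
      have h5 : e i * fderiv ℂ (pointMapCoord Φ (k + 1)) j (dirVec (k + 1)) = 0 := by
        rw [← h4]; exact h3.symm
      exact (mul_eq_zero.1 h5).resolve_right
        (fderiv_pointMapCoord_dirVec_ne_zero hkn h hinj hD)
  ext i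
  exact hle _ i le_rfl

/-- The inverse function theorem, used to know that the images of jets near a regular jet fill a
whole neighbourhood of its image. -/
theorem map_nhds_pointMap (h : AnalyticAt ℂ Φ j.base)
    (hinj : Function.Injective (fderiv ℂ Φ j.base))
    (hD : totalDeriv (fun j : Jet n => (Φ j.base).1) j ≠ 0) :
    map (pointMap Φ) (𝓝 j) = 𝓝 (pointMap Φ j) := by
  have hs : HasStrictFDerivAt (pointMap Φ) (fderiv ℂ (pointMap Φ) j) j :=
    (contDiffAt_pointMap h hD).hasStrictFDerivAt (by simp)
  refine hs.map_nhds_eq_of_surj ?_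
  rw [LinearMap.range_eq_top]
  exact LinearMap.injective_iff_surjective.1 (injective_fderiv_pointMap h hinj hD)

/-! Jets of curves -/

/-- The jet at `t` of the function `s`. -/
def ofFun (s : ℂ → ℂ) (t : ℂ) : Jet n :=
  Fin.cons t (fun k : Fin (n + 1) => iteratedDeriv k s t)

theorem base_ofFun (s : ℂ → ℂ) (t : ℂ) : base (ofFun s t : Jet n) = (t, s t) := by
  simp [ofFun, base_cons]

theorem dcoord_ofFun {k : ℕ} (hk : k ≤ n) (s : ℂ → ℂ) (t : ℂ) :
    dcoord k (ofFun s t : Jet n) = iteratedDeriv k s t :=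
  dcoord_cons hk _ _

theorem hasDerivAt_ofFun {s : ℂ → ℂ} {t : ℂ} (hs : AnalyticAt ℂ s t) :
    HasDerivAt (ofFun s : ℂ → Jet n)
      (Fin.cons 1 (fun k : Fin (n + 1) => iteratedDeriv (k + 1) s t)) t := by
  rw [hasDerivAt_pi]
  intro i
  refine Fin.cases ?_ (fun k => ?_) i
  · simpa [ofFun] using hasDerivAt_id' t
  · simp only [ofFun, Fin.cons_succ, iteratedDeriv_succ]
    exact (analyticAt_iteratedDeriv hs k).differentiableAt.hasDerivAt

/-- The chain rule that characterizes the total derivative. Independence of the top coordinate is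
needed because the truncated total field has no component there. -/
theorem hasDerivAt_comp_ofFun {s : ℂ → ℂ} {t : ℂ} (hs : AnalyticAt ℂ s t) {G : Jet n → ℂ}
    (hG : DifferentiableAt ℂ G (ofFun s t)) (hi : Indep G n) :
    HasDerivAt (fun t => G (ofFun s t)) (totalDeriv G (ofFun s t)) t := by
  have h := hG.hasFDerivAt.comp_hasDerivAt t (hasDerivAt_ofFun hs)
  refine h.congr_deriv ?_
  unfold totalDeriv
  symm
  rw [← sub_eq_zero, ← map_sub]
  refine hi.fderiv_zero _ _ fun i hi => ?_
  rw [Pi.sub_apply]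
  refine Fin.cases (fun _ => ?_) (fun k hk => ?_) i hi
  · simp [totalField]
  · simp only [totalField, Fin.cons_succ]
    rw [dcoord_ofFun (by simpa using hk), sub_self]

/-- The characteristic of a vector field along a curve. -/
def characteristic (w : ℂ × ℂ → ℂ × ℂ) (s : ℂ → ℂ) (t : ℂ) : ℂ :=
  (w (t, s t)).2 - deriv s t * (w (t, s t)).1

theorem analyticAt_characteristic {w : ℂ × ℂ → ℂ × ℂ} {s : ℂ → ℂ} {t : ℂ} (hs : AnalyticAt ℂ s t)
    (hw : AnalyticAt ℂ w (t, s t)) : AnalyticAt ℂ (characteristic w s) t := by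
  have h : AnalyticAt ℂ (fun t => w (t, s t)) t :=
    AnalyticAt.comp (f := fun t => (t, s t)) hw (analyticAt_id.prod hs)
  exact (analyticAt_snd.comp h).sub (hs.deriv.mul (analyticAt_fst.comp h))

/-- Along a curve the recursion `η^(k+1) = D_x η^(k) - y^(k+1) D_x ξ` loses its `D_x ξ` terms once
`ξ y^(k+1)` is split off, and what remains is a derivative of the characteristic. -/
theorem prolongCoeff_ofFun {w : ℂ × ℂ → ℂ × ℂ} {s : ℂ → ℂ} {t : ℂ} {k : ℕ} (hk : k ≤ n)
    (hs : AnalyticAt ℂ s t) (hw : AnalyticAt ℂ w (t, s t)) :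
    prolongCoeff w k (ofFun s t : Jet n) =
      iteratedDeriv k (characteristic w s) t + (w (t, s t)).1 * iteratedDeriv (k + 1) s t := by
  induction k generalizing t with
  | zero =>
    simp only [prolongCoeff, base_ofFun, characteristic, iteratedDeriv_zero, zero_add,
      iteratedDeriv_one]
    ring
  | succ k ih =>
    have hb : AnalyticAt ℂ w (ofFun s t : Jet n).base := by rwa [base_ofFun]
    have hcont : ContinuousAt (fun t => (t, s t)) t := continuousAt_id.prodMk hs.continuousAt
    have h1 := hasDerivAt_comp_ofFun hs
      ((contDiffAt_prolongCoeff hb k).differentiableAt (by simp))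
      ((indep_prolongCoeff w k).mono (by omega))
    have h2 := hasDerivAt_comp_ofFun hs
      ((contDiffAt_fst hb).differentiableAt (by simp))
      ((indep_base (G := fun z => (w z).1)).mono (by omega))
    simp only [base_ofFun] at h2
    have e : (fun t => prolongCoeff w k (ofFun s t : Jet n)) =ᶠ[𝓝 t] fun t =>
        iteratedDeriv k (characteristic w s) t + (w (t, s t)).1 * iteratedDeriv (k + 1) s t := by
      filter_upwards [hs.eventually_analyticAt, hcont.eventually hw.eventually_analyticAt]
        with t' h1 h2
      exact ih (by omega) h1 h2
    have h3 := (analyticAt_iteratedDeriv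
      (analyticAt_characteristic hs hw) k).differentiableAt.hasDerivAt
    have h4 := (analyticAt_iteratedDeriv hs (k + 1)).differentiableAt.hasDerivAt
    rw [← iteratedDeriv_succ] at h3 h4
    have h5 := (h1.congr_of_eventuallyEq e.symm).unique (h3.add (h2.mul h4))
    simp only [prolongCoeff]
    rw [h5, dcoord_ofFun hk]
    ring

end Jet

end ODESymm
end
-- The linear equation on jets and linearizing transformations
noncomputable section

open Filter Topology Polynomial VectorField
open scoped ContDiff

namespace ODESymm

variable {n : ℕ}

/-- The left-hand side of the linear equation as a function of the jet. -/
def linLhs (a : Fin n → ℂ → ℂ) (J : Jet n) : ℂ :=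
  Jet.dcoord n J + ∑ k : Fin n, a k (J 0) * Jet.dcoord k J

theorem linLhs_add_dirVec (a : Fin n → ℂ → ℂ) (J : Jet n) (c : ℂ) :
    linLhs a (J + c • Jet.dirVec n) = linLhs a J + c := by
  have h0 : (J + c • Jet.dirVec n : Jet n) 0 = J 0 := by simp [Jet.dirVec]
  simp only [linLhs, Jet.dcoord_add, Jet.dcoord_smul, h0]
  rw [Jet.dcoord_dirVec le_rfl]
  have h1 : ∀ k : Fin n, Jet.dcoord k (Jet.dirVec n : Jet n) = 0 := fun k => by
    rw [Jet.dcoord_dirVec k.2.le, if_neg k.2.ne]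
  simp only [h1]
  simp
  ring

theorem hasFDerivAt_dcoord (k : ℕ) (J : Jet n) :
    HasFDerivAt (Jet.dcoord k : Jet n → ℂ) (fderiv ℂ (Jet.dcoord k) J) J :=
  ((Jet.contDiff_dcoord k).contDiffAt.differentiableAt (by simp)).hasFDerivAt

theorem contDiffAt_linLhs {a : Fin n → ℂ → ℂ} {J : Jet n} (ha : ∀ k, AnalyticAt ℂ (a k) (J 0)) :
    ContDiffAt ℂ ω (linLhs a) J := by
  refine (Jet.contDiff_dcoord n).contDiffAt.add (ContDiffAt.sum fun k _ => ?_)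
  refine ContDiffAt.mul ?_ (Jet.contDiff_dcoord _).contDiffAt
  exact ContDiffAt.comp J (f := fun J : Jet n => J 0) (ha k).contDiffAt
    (contDiff_apply _ _ _).contDiffAt

theorem fderiv_linLhs {a : Fin n → ℂ → ℂ} {J : Jet n} (ha : ∀ k, AnalyticAt ℂ (a k) (J 0))
    (W : Jet n) :
    fderiv ℂ (linLhs a) J W = Jet.dcoord n W + ∑ k : Fin n,
      (deriv (a k) (J 0) * W 0 * Jet.dcoord k J + a k (J 0) * Jet.dcoord k W) := by
  have h0 : HasFDerivAt (fun J : Jet n => J 0) (ContinuousLinearMap.proj 0 : Jet n →L[ℂ] ℂ) J :=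
    (ContinuousLinearMap.proj 0 : Jet n →L[ℂ] ℂ).hasFDerivAt
  have h1 (k : Fin n) : HasFDerivAt (fun J : Jet n => a k (J 0) * Jet.dcoord k J) _ J :=
    HasFDerivAt.mul ((ha k).differentiableAt.hasDerivAt.comp_hasFDerivAt J h0)
      (hasFDerivAt_dcoord k J)
  have h2 := (hasFDerivAt_dcoord n J).fun_add
    (HasFDerivAt.fun_sum fun k (_ : k ∈ Finset.univ) => h1 k)
  rw [show linLhs a = fun J : Jet n =>
    Jet.dcoord n J + ∑ k : Fin n, a k (J 0) * Jet.dcoord k J from rfl, h2.fderiv]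
  simp only [add_apply, sum_apply, smul_apply, Jet.fderiv_dcoord, smul_eq_mul]
  congr 1
  refine Finset.sum_congr rfl fun k _ => ?_
  simp
  ring

/-- A point transformation that linearizes the equation `q` near `z₀`. -/
structure IsLinearization (q : RationalODE n) (z₀ : ℂ × ℂ) (a : Fin n → ℂ → ℂ)
    (Φ : ℂ × ℂ → ℂ × ℂ) : Prop where
  analyticAt : AnalyticAt ℂ Φ z₀
  det_ne_zero : (fderiv ℂ Φ z₀).det ≠ 0
  coeff : ∀ k, AnalyticAt ℂ (a k) (Φ z₀).1
  lhs_iff : ∀ᶠ z in 𝓝 z₀, ∀ j : Jet n, j.base = z → q.denAt j ≠ 0 →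
    Jet.totalDeriv (fun j => (Φ j.base).1) j ≠ 0 →
      (q.lhs j = 0 ↔ linLhs a (j.pointMap Φ) = 0)

theorem equivToLinearAt_iff {q : RationalODE n} {z₀ : ℂ × ℂ} {a : Fin n → ℂ → ℂ} :
    q.EquivToLinearAt z₀ a ↔ ∃ Φ, IsLinearization q z₀ a Φ := by
  have key : ∀ (Φ : ℂ × ℂ → ℂ × ℂ) (j : Jet n), linLhs a (j.pointMap Φ) =
      j.pointMapCoord Φ n + ∑ k : Fin n, a k (Φ j.base).1 * j.pointMapCoord Φ k := by
    intro Φ j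
    have h1 : ∀ k : Fin n, Jet.dcoord k (j.pointMap Φ) = j.pointMapCoord Φ k := fun k =>
      Jet.dcoord_pointMap k.2.le Φ j
    simp only [linLhs, Jet.dcoord_pointMap le_rfl, h1]
    rfl
  constructor
  · rintro ⟨Φ, h1, h2, h3, h4⟩
    exact ⟨Φ, h1, h2, h3, by simpa only [key] using h4⟩
  · rintro ⟨Φ, h1, h2, h3, h4⟩
    exact ⟨Φ, h1, h2, h3, by simpa only [key] using h4⟩

theorem injective_of_det_ne_zero {A : ℂ × ℂ →L[ℂ] ℂ × ℂ} (h : A.det ≠ 0) :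
    Function.Injective A := by
  have : IsUnit (A : ℂ × ℂ →ₗ[ℂ] ℂ × ℂ) := (LinearMap.isUnit_iff_isUnit_det _).2 h.isUnit
  exact ((Module.End.isUnit_iff _).1 this).1

theorem exists_fst_apply_ne_zero {A : ℂ × ℂ →L[ℂ] ℂ × ℂ} (h : Function.Injective A) :
    (A (1, 0)).1 ≠ 0 ∨ (A (0, 1)).1 ≠ 0 := by
  by_contra! hc
  have h0 : A ((A (0, 1)).2 • ((1 : ℂ), (0 : ℂ)) - (A (1, 0)).2 • ((0 : ℂ), (1 : ℂ))) = 0 := by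
    rw [map_sub, map_smul, map_smul]
    ext
    · simp [hc.1, hc.2]
    · simp; ring
  have h1 := h (h0.trans (map_zero A).symm)
  have e1 := congrArg Prod.fst h1
  have e2 := congrArg Prod.snd h1
  simp at e1 e2
  have h2 : A (1, 0) = A 0 := by
    rw [map_zero]; exact Prod.ext hc.1 e2
  simpa using congrArg Prod.fst (h h2)

/-- Two functions with the same zero set near a common zero, both with nonzero derivative in the
direction `e`, have the same tangent vectors. -/
theorem fderiv_eq_zero_iff_of_zero_imp {E : Type*} [NormedAddCommGroup E] [NormedSpace ℂ E]
    {f g : E → ℂ} {x e : E} (hf : DifferentiableAt ℂ f x) (hg : DifferentiableAt ℂ g x)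
    (hfx : f x = 0) (hfe : ∀ᶠ y in 𝓝 x, f (y - f y • e) = 0)
    (hfg : ∀ᶠ y in 𝓝 x, f y = 0 → g y = 0) (hge : fderiv ℂ g x e ≠ 0) (w : E) :
    fderiv ℂ f x w = 0 ↔ fderiv ℂ g x w = 0 := by
  -- The map `γ` moves points along `e` onto the zero set of `f`, so `g ∘ γ = 0`. Differentiation
  -- gives `dg(w) = df(w) dg(e)`, and `dg(e) ≠ 0`.
  set γ : E → E := fun y => y - f y • e with hγ
  have hγx : γ x = x := by simp [hγ, hfx]
  have hγd : HasFDerivAt γ (ContinuousLinearMap.id ℂ E - (fderiv ℂ f x).smulRight e) x :=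
    (hasFDerivAt_id x).sub (hf.hasFDerivAt.smul_const e)
  have hcont : Tendsto γ (𝓝 x) (𝓝 x) := by
    have := hγd.continuousAt
    rwa [ContinuousAt, hγx] at this
  have hz : g ∘ γ =ᶠ[𝓝 x] fun _ => 0 := by
    filter_upwards [hfe, hcont.eventually hfg] with y h1 h2
    exact h2 h1
  have hg' : DifferentiableAt ℂ g (γ x) := by rwa [hγx]
  have h := (hg'.hasFDerivAt.comp x hγd).fderiv
  rw [hz.fderiv_eq, hγx] at h
  have h' := congrArg (fun L => L w) h
  simp at h'
  constructor
  · intro h0; rw [h0] at h'; simpa using h'.symm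
  · intro h0
    rw [h0] at h'
    simpa [hge] using h'

namespace RationalODE

variable (q : RationalODE n)

theorem numAt_add_dirVec (j : Jet n) (c : ℂ) : q.numAt (j + c • Jet.dirVec n) = q.numAt j := by
  have h : ∀ i : Fin (n + 1), (j + c • Jet.dirVec n : Jet n) i.castSucc = j i.castSucc :=
    fun i => by
    have : (i : ℕ) ≠ n + 1 := by omega
    simp [Jet.dirVec, this]
  simp only [numAt, h]

theorem denAt_add_dirVec (j : Jet n) (c : ℂ) : q.denAt (j + c • Jet.dirVec n) = q.denAt j := by
  have h : ∀ i : Fin (n + 1), (j + c • Jet.dirVec n : Jet n) i.castSucc = j i.castSucc :=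
    fun i => by
    have : (i : ℕ) ≠ n + 1 := by omega
    simp [Jet.dirVec, this]
  simp only [denAt, h]

theorem lhs_add_dirVec (j : Jet n) (c : ℂ) : q.lhs (j + c • Jet.dirVec n) = q.lhs j + c := by
  simp only [lhs, numAt_add_dirVec, denAt_add_dirVec]
  simp [Jet.dirVec]
  ring

/-- The equation is solved for its highest derivative, so any jet can be moved onto it without
touching the other coordinates. -/
theorem lhs_sub_dirVec (j : Jet n) : q.lhs (j - q.lhs j • Jet.dirVec n) = 0 := by
  rw [sub_eq_add_neg, ← neg_smul, lhs_add_dirVec, add_neg_cancel]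

theorem dense_denAt_ne_zero : Dense {j : Jet n | q.denAt j ≠ 0} := by
  intro j
  rw [mem_closure_iff_frequently]
  intro hj
  have h0 : q.denAt =ᶠ[𝓝 j] 0 := hj.mono fun x hx => by simpa using hx
  have han : AnalyticOnNhd ℂ q.denAt Set.univ := fun x _ =>
    ((contDiff_eval q.den).contDiffAt (x := x)).analyticAt
  have hz : q.denAt = 0 := han.eq_of_eventuallyEq (fun x _ => analyticAt_const) h0
  refine q.den_ne_zero (MvPolynomial.funext fun x => ?_)
  have := congrFun hz (Fin.snoc x 0 : Jet n)
  simpa [denAt] using this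

end RationalODE

namespace IsLinearization

variable {q : RationalODE n} {z₀ : ℂ × ℂ} {a : Fin n → ℂ → ℂ} {Φ : ℂ × ℂ → ℂ × ℂ}

theorem eventually (h : IsLinearization q z₀ a Φ) : ∀ᶠ z in 𝓝 z₀, IsLinearization q z a Φ := by
  have hc : ContinuousAt (fun z => (fderiv ℂ Φ z).det) z₀ :=
    ContinuousLinearMap.continuous_det.continuousAt.comp h.analyticAt.fderiv.continuousAt
  have h1 : ∀ᶠ t in 𝓝 (Φ z₀).1, ∀ k, AnalyticAt ℂ (a k) t :=
    eventually_all.2 fun k => (h.coeff k).eventually_analyticAt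
  have h2 : ContinuousAt (fun z => (Φ z).1) z₀ := h.analyticAt.continuousAt.fst
  filter_upwards [h.analyticAt.eventually_analyticAt, hc.eventually_ne h.det_ne_zero,
    h2.eventually h1, h.lhs_iff.eventually_nhds] with z h1 h2 h3 h4
  exact ⟨h1, h2, h3, h4⟩

theorem injective (h : IsLinearization q z₀ a Φ) : Function.Injective (fderiv ℂ Φ z₀) :=
  injective_of_det_ne_zero h.det_ne_zero

/-- Near a regular jet the equation and the pulled-back linear equation cut out the same
hypersurface, and the prolonged transformation carries the prolongation of `v` to that of `w`.
Tangency is thus the same condition on both sides. -/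
theorem fderiv_lhs_eq_zero_iff (hn : 0 < n) {v w : ℂ × ℂ → ℂ × ℂ} {j : Jet n}
    (h : IsLinearization q j.base a Φ) (hv : AnalyticAt ℂ v j.base)
    (hw : AnalyticAt ℂ w (Φ j.base)) (hvw : ∀ᶠ z in 𝓝 j.base, fderiv ℂ Φ z (v z) = w (Φ z))
    (hden : q.denAt j ≠ 0) (hj : q.lhs j = 0)
    (hD : Jet.totalDeriv (fun j : Jet n => (Φ j.base).1) j ≠ 0) :
    fderiv ℂ q.lhs j (j.prolong v) = 0 ↔
      fderiv ℂ (linLhs a) (j.pointMap Φ) ((j.pointMap Φ).prolong w) = 0 := by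
  have hP := (Jet.contDiffAt_pointMap h.analyticAt hD).differentiableAt (by simp)
  have h0 : (j.pointMap Φ) 0 = (Φ j.base).1 := rfl
  have hlin := (contDiffAt_linLhs (a := a) (J := j.pointMap Φ)
    (by rw [h0]; exact h.coeff)).differentiableAt (by simp)
  have hcomp : ∀ e, fderiv ℂ (fun j => linLhs a (j.pointMap Φ)) j e =
      fderiv ℂ (linLhs a) (j.pointMap Φ) (fderiv ℂ (Jet.pointMap Φ) j e) := fun e => by
    have := (hlin.hasFDerivAt.comp j hP.hasFDerivAt).fderiv
    rw [show (fun j => linLhs a (j.pointMap Φ)) = linLhs a ∘ Jet.pointMap Φ from rfl, this]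
    rfl
  rw [← Jet.fderiv_pointMap_prolong h.analyticAt hv hw hvw hD, ← hcomp]
  obtain ⟨m, rfl⟩ := Nat.exists_eq_succ_of_ne_zero hn.ne'
  refine fderiv_eq_zero_iff_of_zero_imp (e := Jet.dirVec (m + 1))
    ((q.contDiffAt_lhs hden).differentiableAt (by simp)) (hlin.comp j hP) hj
    (Eventually.of_forall q.lhs_sub_dirVec) ?_ ?_ _
  · have hden' : ∀ᶠ j' in 𝓝 j, q.denAt j' ≠ 0 :=
      (RationalODE.contDiff_eval q.den).continuous.continuousAt.eventually_ne hden
    filter_upwards [hden', Jet.eventually_base h.lhs_iff,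
      Jet.eventually_totalDeriv_fst_ne_zero h.analyticAt hD] with j' h1 h2 h3
    exact (h2 j' rfl h1 h3).1
  · refine ne_of_eq_of_ne (hcomp _) ?_
    -- Only the top coordinate of the prolonged map depends on the top derivative, so this direction
    -- is mapped to `σ` times itself, with `σ ≠ 0`.
    set σ := fderiv ℂ (Jet.pointMapCoord Φ (m + 1)) j (Jet.dirVec (m + 1)) with hσ
    have e : fderiv ℂ (Jet.pointMap Φ) j (Jet.dirVec (m + 1)) = σ • Jet.dirVec (m + 1) := by
      ext i
      refine Fin.cases ?_ (fun k => ?_) i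
      · rw [Jet.fderiv_pointMap_zero h.analyticAt hD,
          (Jet.indep_base (G := fun z => (Φ z).1)).fderiv_zero]
        · simp [Jet.dirVec]
        · intro i hi
          have : i.val ≠ m + 1 + 1 := by omega
          simp [Jet.dirVec, this]
      · rw [Jet.fderiv_pointMap_succ h.analyticAt hD]
        rcases Nat.lt_or_ge k (m + 1) with hk | hk
        · rw [(Jet.indep_pointMapCoord Φ k).fderiv_zero]
          · have : k.val ≠ m + 1 := by omega
            simp [Jet.dirVec, this]
          · intro i hi
            have : i.val ≠ m + 1 + 1 := by omega
            simp [Jet.dirVec, this]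
        · have : k.val = m + 1 := by omega
          simp [Jet.dirVec, this, hσ]
    have hlin1 : fderiv ℂ (linLhs a) (j.pointMap Φ) (Jet.dirVec (m + 1)) = 1 := by
      have l1 : HasLineDerivAt ℂ (linLhs a) _ (j.pointMap Φ) (Jet.dirVec (m + 1)) :=
        hlin.hasFDerivAt.hasLineDerivAt _
      refine l1.unique ?_
      unfold HasLineDerivAt
      simp only [Nat.succ_eq_add_one, linLhs_add_dirVec]
      simpa using (hasDerivAt_id' (0 : ℂ)).const_add (linLhs a (j.pointMap Φ))
    rw [e, map_smul, hlin1, smul_eq_mul, mul_one]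
    exact Jet.fderiv_pointMapCoord_dirVec_ne_zero (by omega) h.analyticAt h.injective hD

/-- Near `z₀` there are jets at which the equation and the transformation are regular. -/
theorem exists_regular_jet (hn : 2 ≤ n) (h : IsLinearization q z₀ a Φ) {P : ℂ × ℂ → Prop}
    (hP : ∀ᶠ z in 𝓝 z₀, P z) : ∃ j : Jet n, P j.base ∧ q.denAt j ≠ 0 ∧
      Jet.totalDeriv (fun j => (Φ j.base).1) j ≠ 0 ∧ q.lhs j = 0 := by
  -- This is `D_x φ = φ_x + y' φ_y`. The choice `y' = 0` works unless `φ_x = 0`, and then `φ_y ≠ 0`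
  -- makes `y' = 1` work.
  obtain ⟨y, hy⟩ : ∃ y : ℂ, (fderiv ℂ Φ z₀ (1, y)).1 ≠ 0 := by
    by_cases h1 : (fderiv ℂ Φ z₀ (1, 0)).1 = 0
    · refine ⟨1, ?_⟩
      have h2 := (exists_fst_apply_ne_zero h.injective).resolve_left (by simpa using h1)
      have h3 : ((1 : ℂ), (1 : ℂ)) = (1, 0) + (0, 1) := by simp
      rw [h3, map_add, Prod.fst_add, h1, zero_add]
      exact h2
    · exact ⟨0, h1⟩
  let j₁ : Jet n := fun i => if i.val = 0 then z₀.1 else if i.val = 1 then z₀.2 else y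
  have hb : j₁.base = z₀ := by simp [j₁, Jet.base]
  have hd1 : Jet.dcoord 1 j₁ = y := by
    rw [Jet.dcoord_of_le (by omega)]; simp [j₁]
  have hΦ : AnalyticAt ℂ Φ j₁.base := by rw [hb]; exact h.analyticAt
  have hD : Jet.totalDeriv (fun j => (Φ j.base).1) j₁ ≠ 0 := by
    rw [Jet.totalDeriv_comp_base (G := fun z => (Φ z).1) hΦ.differentiableAt.fst,
      fderiv.fst hΦ.differentiableAt, hd1, hb]
    exact hy
  have hev := (Jet.eventually_base (j := j₁) (by rwa [hb])).and
    (Jet.eventually_totalDeriv_fst_ne_zero hΦ hD)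
  obtain ⟨j₂, hden, hP2, hD2⟩ :=
    ((mem_closure_iff_frequently.1 (q.dense_denAt_ne_zero j₁)).and_eventually hev).exists
  -- Correcting the top derivative puts the jet on the equation. Since `n ≥ 2`, this changes neither
  -- the base point nor the denominator nor `D_x φ`, which has order one.
  refine ⟨j₂ + (-q.lhs j₂) • Jet.dirVec n, ?_, ?_, ?_, ?_⟩
  · have : Jet.base (j₂ + (-q.lhs j₂) • Jet.dirVec n) = j₂.base := by
      have h1 : 1 ≠ n + 1 := by omega
      have h2 : (1 : Fin (n + 2)).val ≠ n + 1 := by rw [Fin.val_one]; omega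
      simp only [Jet.base, Jet.dirVec, Pi.add_apply, Pi.smul_apply, if_neg h2]
      simp
    rwa [this]
  · rw [q.denAt_add_dirVec]; exact hden
  · rw [Jet.indep_totalDeriv_fst]
    · exact hD2
    · intro i hi
      have : i.val ≠ n + 1 := by omega
      simp [Jet.dirVec, this]
  · rw [q.lhs_add_dirVec, add_neg_cancel]

end IsLinearization

end ODESymm
end
-- Transfer of symmetries between the equation and its linear form
noncomputable section

open Filter Topology Polynomial VectorField
open scoped ContDiff

namespace ODESymm

variable {n : ℕ}

/-- Infinitesimal invariance near `p₀` of the linear equation. -/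
def IsLinSymmetryNear (a : Fin n → ℂ → ℂ) (p₀ : ℂ × ℂ) (w : ℂ × ℂ → ℂ × ℂ) : Prop :=
  ∀ᶠ p in 𝓝 p₀, ∀ J : Jet n, J.base = p → linLhs a J = 0 →
    fderiv ℂ (linLhs a) J (J.prolong w) = 0

theorem Jet.base_add_dirVec {k : ℕ} (hk : 0 < k) (j : Jet n) (c : ℂ) :
    (j + c • Jet.dirVec k : Jet n).base = j.base := by
  have h1 : k ≠ 0 := hk.ne'
  simp [Jet.base, Jet.dirVec, h1]

namespace IsLinearization

variable {q : RationalODE n} {z₀ : ℂ × ℂ} {a : Fin n → ℂ → ℂ} {Φ : ℂ × ℂ → ℂ × ℂ}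
  {v w : ℂ × ℂ → ℂ × ℂ}

/-- The hypothesis speaks only about images of regular jets. These contain an open piece of the
linear equation, and the tangency condition is analytic on the connected tube of all jets over a
ball, so the identity theorem extends it to the tube. -/
theorem isLinSymmetryNear (hn : 2 ≤ n) (h : IsLinearization q z₀ a Φ) (hv : AnalyticAt ℂ v z₀)
    (hw : AnalyticAt ℂ w (Φ z₀)) (hvw : ∀ᶠ z in 𝓝 z₀, fderiv ℂ Φ z (v z) = w (Φ z))
    (hs : q.IsSymmetryNear z₀ v) : IsLinSymmetryNear a (Φ z₀) w := by
  have ha : ∀ᶠ p in 𝓝 (Φ z₀), ∀ k, AnalyticAt ℂ (a k) p.1 :=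
    eventually_all.2 fun k => continuousAt_fst.eventually (h.coeff k).eventually_analyticAt
  obtain ⟨ε, hε, hball⟩ := Metric.eventually_nhds_iff_ball.1 (ha.and hw.eventually_analyticAt)
  set U : Set (Jet n) := {J | J.base ∈ Metric.ball (Φ z₀) ε} with hU
  have hUc : IsPreconnected U := by
    have : Convex ℝ U := by
      have hc := convex_ball (Φ z₀) ε
      intro x hx y hy s t hs ht hst
      exact hc hx hy hs ht hst
    exact this.isPreconnected
  set e : Jet n := Jet.dirVec n with he
  -- Projecting onto the linear equation along the top derivative turns a condition on a
  -- hypersurface into the vanishing of the analytic function `F ∘ π` on the open set `U`.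
  set π : Jet n → Jet n := fun J => J + (-linLhs a J) • e with hπ
  have hπb : ∀ J, (π J).base = J.base := fun J => Jet.base_add_dirVec (by omega) _ _
  have hπ0 : ∀ J, linLhs a (π J) = 0 := fun J => by
    rw [hπ, he]; simp only [linLhs_add_dirVec]; ring
  set F : Jet n → ℂ := fun J => fderiv ℂ (linLhs a) J (J.prolong w) with hF
  have hFan : ∀ J : Jet n, J ∈ U → AnalyticAt ℂ F J := fun J hJ =>
    (((contDiffAt_linLhs (hball _ hJ).1).fderiv_right (m := ω) (by simp)).clm_apply
      (Jet.contDiffAt_prolong (hball _ hJ).2)).analyticAt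
  have hHan : AnalyticOnNhd ℂ (fun J => F (π J)) U := by
    intro J hJ
    have h1 : AnalyticAt ℂ π J :=
      (contDiffAt_id.add ((contDiffAt_linLhs (hball _ hJ).1).neg.smul contDiffAt_const)).analyticAt
    exact AnalyticAt.comp (f := π) (hFan (π J) (by rw [hU, Set.mem_ofPred_eq, hπb]; exact hJ)) h1
  have hev : ∀ᶠ z in 𝓝 z₀, Φ z ∈ Metric.ball (Φ z₀) ε ∧ AnalyticAt ℂ v z ∧
      IsLinearization q z a Φ ∧ (∀ᶠ z' in 𝓝 z, fderiv ℂ Φ z' (v z') = w (Φ z')) ∧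
      (∀ᶠ z' in 𝓝 z, ∀ j : Jet n, j.base = z' → q.denAt j ≠ 0 → q.lhs j = 0 →
        fderiv ℂ q.lhs j (j.prolong v) = 0) :=
    (h.analyticAt.continuousAt.eventually (Metric.ball_mem_nhds _ hε)).and
      (hv.eventually_analyticAt.and (h.eventually.and
        (hvw.eventually_nhds.and (Eventually.eventually_nhds hs))))
  obtain ⟨j₀, hj₀, hden, hD, hlhs⟩ := h.exists_regular_jet hn (hev.and hev.eventually_nhds)
  have hJ₀ : linLhs a (j₀.pointMap Φ) = 0 :=
    (hj₀.1.2.2.1.lhs_iff.self_of_nhds j₀ rfl hden hD).1 hlhs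
  have hJ₀U : j₀.pointMap Φ ∈ U := by rw [hU, Set.mem_ofPred_eq, Jet.base_pointMap]; exact hj₀.1.1
  have hloc : ∀ᶠ J in 𝓝 (j₀.pointMap Φ), linLhs a J = 0 → F J = 0 := by
    rw [← Jet.map_nhds_pointMap hj₀.1.2.2.1.analyticAt hj₀.1.2.2.1.injective hD,
      eventually_map]
    have hden' : ∀ᶠ j in 𝓝 j₀, q.denAt j ≠ 0 :=
      (RationalODE.contDiff_eval q.den).continuous.continuousAt.eventually_ne hden
    filter_upwards [hden', Jet.eventually_totalDeriv_fst_ne_zero hj₀.1.2.2.1.analyticAt hD,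
      Jet.eventually_base hj₀.2] with j h1 h2 h3 h4
    have h5 := (h3.2.2.1.lhs_iff.self_of_nhds j rfl h1 h2).2 h4
    refine (h3.2.2.1.fderiv_lhs_eq_zero_iff (by omega) h3.2.1 (hball _ h3.1).2 h3.2.2.2.1 h1 h5
      h2).1 ?_
    exact h3.2.2.2.2.self_of_nhds j rfl h1 h5
  have hπJ₀ : π (j₀.pointMap Φ) = j₀.pointMap Φ := by simp [hπ, hJ₀]
  have hπc : Tendsto π (𝓝 (j₀.pointMap Φ)) (𝓝 (j₀.pointMap Φ)) := by
    have : ContinuousAt π (j₀.pointMap Φ) := continuousAt_id.add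
      ((contDiffAt_linLhs (hball _ hJ₀U).1).continuousAt.neg.smul continuousAt_const)
    rwa [ContinuousAt, hπJ₀] at this
  have hz : (fun J => F (π J)) =ᶠ[𝓝 (j₀.pointMap Φ)] 0 :=
    (hπc.eventually hloc).mono fun J hJ => hJ (hπ0 J)
  have hzero := hHan.eqOn_zero_of_preconnected_of_eventuallyEq_zero hUc hJ₀U hz
  filter_upwards [Metric.ball_mem_nhds (Φ z₀) hε] with p hp J hJp hJ
  subst hJp
  have h1 := hzero (show J ∈ U from hp)
  have h2 : π J = J := by simp [hπ, hJ]
  simpa [h2] using h1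

/-- Where `D_x φ ≠ 0` the condition is transported directly. A jet on the equation with `D_x φ = 0`
is a limit of jets on the equation with `D_x φ ≠ 0`, and the condition is continuous. -/
theorem isSymmetryNear (hn : 2 ≤ n) (h : IsLinearization q z₀ a Φ) (hv : AnalyticAt ℂ v z₀)
    (hw : AnalyticAt ℂ w (Φ z₀)) (hvw : ∀ᶠ z in 𝓝 z₀, fderiv ℂ Φ z (v z) = w (Φ z))
    (hs : IsLinSymmetryNear a (Φ z₀) w) : q.IsSymmetryNear z₀ v := by
  have hc := h.analyticAt.continuousAt
  filter_upwards [hv.eventually_analyticAt, hc.eventually hw.eventually_analyticAt,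
    h.eventually, hvw.eventually_nhds, hc.eventually hs] with z hv hw h hvw hs j hjz hden hj
  subst hjz
  have main : ∀ j' : Jet n, j'.base = j.base → q.denAt j' ≠ 0 → q.lhs j' = 0 →
      Jet.totalDeriv (fun j : Jet n => (Φ j.base).1) j' ≠ 0 →
      fderiv ℂ q.lhs j' (j'.prolong v) = 0 := by
    intro j' hb hden hj hD
    refine (IsLinearization.fderiv_lhs_eq_zero_iff (w := w) (by omega) (by rwa [hb])
      (by rwa [hb]) (by rwa [hb]) (by rwa [hb]) hden hj hD).2 ?_
    refine hs _ (by rw [Jet.base_pointMap, hb]) ?_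
    rw [← hb] at h
    exact (h.lhs_iff.self_of_nhds j' rfl hden hD).1 hj
  by_cases hD : Jet.totalDeriv (fun j : Jet n => (Φ j.base).1) j = 0
  swap
  · exact main j rfl hden hj hD
  set φ₂ : ℂ := fderiv ℂ (fun j : Jet n => (Φ j.base).1) j (Jet.dirVec 0) with hφ₂
  have hd := h.analyticAt.differentiableAt
  have hφ₂0 : φ₂ ≠ 0 := by
    intro h0
    have e1 := Jet.totalDeriv_comp_base (G := fun z => (Φ z).1) hd.fst
    have e2 := Jet.fderiv_comp_base (n := n) (G := fun z => (Φ z).1) hd.fst (Jet.dirVec 0)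
    rw [hD, fderiv.fst hd] at e1
    rw [← hφ₂, h0, fderiv.fst hd, Jet.base_dirVec_zero] at e2
    have e3 : ((1 : ℂ), Jet.dcoord 1 j) = (1, 0) + Jet.dcoord 1 j • ((0 : ℂ), (1 : ℂ)) := by simp
    rw [e3, map_add, map_smul, ← e2] at e1
    rcases exists_fst_apply_ne_zero h.injective with h1 | h1
    · exact h1 (by simpa using e1.symm)
    · exact h1 (by simpa using e2.symm)
  -- Moving `y'` by `ε` changes `D_x φ` from `0` to `ε φ₂`; the curve `c` then restores the equation
  -- through the top derivative.
  let δ : ℂ → Jet n := fun ε => j + ε • Jet.dirVec 1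
  let c : ℂ → Jet n := fun ε => δ ε + (-q.lhs (δ ε)) • Jet.dirVec n
  have hδ0 : δ 0 = j := by simp [δ]
  have hc0 : c 0 = j := by simp [c, hδ0, hj]
  have hδc : Continuous δ := by fun_prop
  have hlhsc : ContinuousAt q.lhs (δ 0) := by
    rw [hδ0]; exact (q.contDiffAt_lhs hden).continuousAt
  have hcc : ContinuousAt c 0 := hδc.continuousAt.add
    ((hlhsc.comp hδc.continuousAt).neg.smul continuousAt_const)
  have hG : ContinuousAt (fun j => fderiv ℂ q.lhs j (j.prolong v)) (c 0) := by
    rw [hc0]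
    exact (((q.contDiffAt_lhs hden).fderiv_right (m := ω) (by simp)).clm_apply
      (Jet.contDiffAt_prolong hv)).continuousAt
  have hdenc : ∀ᶠ ε in 𝓝 (0 : ℂ), q.denAt (c ε) ≠ 0 :=
    ((RationalODE.contDiff_eval q.den).continuous.continuousAt.comp hcc).eventually_ne
      (by simp only [Function.comp, hc0]; exact hden)
  have hz : ∀ᶠ ε in 𝓝[≠] (0 : ℂ), fderiv ℂ q.lhs (c ε) ((c ε).prolong v) = 0 := by
    filter_upwards [hdenc.filter_mono nhdsWithin_le_nhds, self_mem_nhdsWithin] with ε h1 h2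
    refine main (c ε) ?_ h1 ?_ ?_
    · rw [Jet.base_add_dirVec (by omega), Jet.base_add_dirVec (by omega)]
    · rw [q.lhs_add_dirVec, add_neg_cancel]
    · rw [Jet.indep_totalDeriv_fst, Jet.totalDeriv_add_dirVec (by omega)
        (Jet.indep_base (G := fun z => (Φ z).1)), hD, zero_add]
      · exact mul_ne_zero h2 hφ₂0
      · intro i hi
        have : i.val ≠ n + 1 := by omega
        simp [Jet.dirVec, this]
  have hlim := (hG.comp hcc).tendsto.mono_left (nhdsWithin_le_nhds (s := {0}ᶜ))
  have := tendsto_nhds_unique (hlim.congr' hz) tendsto_const_nhds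
  simpa [hc0] using this

end IsLinearization

/-! Symmetries of the linear equation in terms of its solutions -/

theorem dcoord_linLhs_ofFun (a : Fin n → ℂ → ℂ) (s : ℂ → ℂ) (t : ℂ) :
    linLhs a (Jet.ofFun s t) = linOp a s t := by
  have h1 : ∀ k : Fin n, Jet.dcoord k (Jet.ofFun s t : Jet n) = iteratedDeriv k s t := fun k =>
    Jet.dcoord_ofFun k.2.le s t
  simp only [linLhs, linOp, Jet.dcoord_ofFun le_rfl, h1]
  rfl

theorem deriv_linOp {a : Fin n → ℂ → ℂ} {s : ℂ → ℂ} {t : ℂ} (ha : ∀ k, AnalyticAt ℂ (a k) t)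
    (hs : AnalyticAt ℂ s t) :
    deriv (linOp a s) t = iteratedDeriv (n + 1) s t + ∑ k : Fin n,
      (deriv (a k) t * iteratedDeriv k s t + a k t * iteratedDeriv (k + 1) s t) := by
  have h (k : ℕ) : HasDerivAt (iteratedDeriv k s) (iteratedDeriv (k + 1) s t) t := by
    rw [iteratedDeriv_succ]
    exact (analyticAt_iteratedDeriv hs k).differentiableAt.hasDerivAt
  exact ((h n).fun_add (HasDerivAt.fun_sum fun k (_ : k ∈ Finset.univ) =>
    (ha k).differentiableAt.hasDerivAt.fun_mul (h k))).deriv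

/-- The characteristic form of the prolongation separates off `ξ` times the derivative of the
equation along the curve. On solutions that term vanishes, so invariance means that the
characteristic is a solution. -/
theorem fderiv_linLhs_ofFun {a : Fin n → ℂ → ℂ} {w : ℂ × ℂ → ℂ × ℂ} {s : ℂ → ℂ} {t : ℂ}
    (ha : ∀ k, AnalyticAt ℂ (a k) t) (hs : AnalyticAt ℂ s t) (hw : AnalyticAt ℂ w (t, s t)) :
    fderiv ℂ (linLhs a) (Jet.ofFun s t) ((Jet.ofFun s t).prolong w) =
      linOp a (Jet.characteristic w s) t + (w (t, s t)).1 * deriv (linOp a s) t := by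
  have h0 : (Jet.ofFun s t : Jet n) 0 = t := rfl
  have h1 : ((Jet.ofFun s t : Jet n).prolong w) 0 = (w (t, s t)).1 := by
    simp [Jet.prolong, Jet.base_ofFun]
  have h2 : ∀ k ≤ n, Jet.dcoord k ((Jet.ofFun s t : Jet n).prolong w) =
      iteratedDeriv k (Jet.characteristic w s) t + (w (t, s t)).1 * iteratedDeriv (k + 1) s t :=
    fun k hk => by
      rw [Jet.prolong, Jet.dcoord_cons hk, Jet.prolongCoeff_ofFun hk hs hw]
  have h3 : ∀ k : Fin n, Jet.dcoord k (Jet.ofFun s t : Jet n) = iteratedDeriv k s t := fun k =>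
    Jet.dcoord_ofFun k.2.le s t
  rw [fderiv_linLhs (by rwa [h0]), deriv_linOp ha hs, h2 n le_rfl]
  simp only [h0, h1, fun k : Fin n => h2 k k.2.le, h3, linOp, mul_add, Finset.mul_sum,
    Finset.sum_add_distrib]
  have e (k : Fin n) : deriv (a k) t * (w (t, s t)).1 * iteratedDeriv k s t =
    (w (t, s t)).1 * (deriv (a k) t * iteratedDeriv k s t) := by ring
  have e' (k : Fin n) : a k t * ((w (t, s t)).1 * iteratedDeriv (k + 1) s t) =
    (w (t, s t)).1 * (a k t * iteratedDeriv (k + 1) s t) := by ring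
  simp only [e, e']
  ring

/-- The characteristic of a symmetry along a solution is a solution. -/
theorem IsLinSymmetryNear.isSol_characteristic {a : Fin n → ℂ → ℂ} {p : ℂ × ℂ}
    {w : ℂ × ℂ → ℂ × ℂ} (h : IsLinSymmetryNear a p w) (hw : AnalyticAt ℂ w p)
    (ha : ∀ k, AnalyticAt ℂ (a k) p.1) {s : ℂ → ℂ} (hs : IsSol a p.1 s) (hp : s p.1 = p.2) :
    IsSol a p.1 (Jet.characteristic w s) := by
  have hp' : (p.1, s p.1) = p := by rw [hp]
  refine ⟨Jet.analyticAt_characteristic hs.analyticAt (by rwa [hp']), ?_⟩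
  have hc : ContinuousAt (fun t => (t, s t)) p.1 := continuousAt_id.prodMk hs.analyticAt.continuousAt
  have hc' : Tendsto (fun t => (t, s t)) (𝓝 p.1) (𝓝 p) := by rwa [ContinuousAt, hp'] at hc
  filter_upwards [hc'.eventually h, hc'.eventually hw.eventually_analyticAt,
    eventually_all.2 fun k => (ha k).eventually_analyticAt, hs.eq_zero.eventually_nhds,
    hs.analyticAt.eventually_analyticAt] with t h1 h2 h3 h4 h5
  have h6 := h1 (Jet.ofFun s t) (Jet.base_ofFun s t)
    (by rw [dcoord_linLhs_ofFun]; exact h4.self_of_nhds)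
  have h7 : linOp a s =ᶠ[𝓝 t] fun _ => 0 := h4
  rw [fderiv_linLhs_ofFun h3 h5 h2, h7.deriv_eq] at h6
  simpa using h6

end ODESymm
end
noncomputable section

open Filter Topology Polynomial VectorField
open scoped ContDiff

namespace ODESymm

variable {n : ℕ}

/-! Taylor estimates in the second variable -/

/-- The derivative with respect to the second variable. -/
def derivSnd (f : ℂ × ℂ → ℂ) (z : ℂ × ℂ) : ℂ := fderiv ℂ f z (0, 1)

theorem analyticAt_derivSnd {f : ℂ × ℂ → ℂ} {p : ℂ × ℂ} (h : AnalyticAt ℂ f p) :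
    AnalyticAt ℂ (derivSnd f) p :=
  (((h.contDiffAt (n := ω)).fderiv_right (m := ω) (by simp)).clm_apply contDiffAt_const).analyticAt

theorem hasDerivAt_snd {f : ℂ × ℂ → ℂ} {t u : ℂ} (h : AnalyticAt ℂ f (t, u)) :
    HasDerivAt (fun u => f (t, u)) (derivSnd f (t, u)) u := by
  have h1 : HasDerivAt (fun u : ℂ => (t, u)) ((0 : ℂ), (1 : ℂ)) u :=
    (hasDerivAt_const u t).prodMk (hasDerivAt_id u)
  exact h.differentiableAt.hasFDerivAt.comp_hasDerivAt u h1

theorem norm_sub_le_of_norm_deriv_le {f f' : ℂ → ℂ} {x : ℂ} {C : ℝ}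
    (hf : ∀ y, ‖y‖ ≤ ‖x‖ → HasDerivAt f (f' y) y) (hC : ∀ y, ‖y‖ ≤ ‖x‖ → ‖f' y‖ ≤ C) :
    ‖f x - f 0‖ ≤ C * ‖x‖ := by
  have h := (convex_closedBall (0 : ℂ) ‖x‖).norm_image_sub_le_of_norm_hasDerivWithin_le
    (f := f) (f' := f') (C := C) (x := 0) (y := x)
    (fun y hy => (hf y (by simpa using hy)).hasDerivWithinAt)
    (fun y hy => hC y (by simpa using hy)) (by simp) (by simp)
  simpa using h

theorem mem_ball_prod_add {p z : ℂ × ℂ} {δ : ℝ} {x : ℂ} (hz : z ∈ Metric.ball p δ)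
    (hx : ‖x‖ < δ) : ((z.1, z.2 + x) : ℂ × ℂ) ∈ Metric.ball p (2 * δ) := by
  rw [mem_ball_iff_norm, Prod.norm_def, max_lt_iff] at hz ⊢
  simp only [Prod.fst_sub, Prod.snd_sub] at hz ⊢
  have h0 : 0 ≤ ‖x‖ := norm_nonneg x
  refine ⟨by linarith [hz.1], ?_⟩
  calc ‖z.2 + x - p.2‖ = ‖(z.2 - p.2) + x‖ := by congr 1; ring
    _ ≤ ‖z.2 - p.2‖ + ‖x‖ := norm_add_le _ _
    _ < 2 * δ := by linarith [hz.2]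

theorem hasDerivAt_snd_add {f : ℂ × ℂ → ℂ} {z : ℂ × ℂ} {x : ℂ}
    (h : AnalyticAt ℂ f (z.1, z.2 + x)) :
    HasDerivAt (fun x => f (z.1, z.2 + x)) (derivSnd f (z.1, z.2 + x)) x := by
  simpa using (hasDerivAt_snd h).comp_const_add z.2 x

theorem hasDerivAt_snd_sub {f : ℂ × ℂ → ℂ} {z : ℂ × ℂ} {x : ℂ}
    (h : AnalyticAt ℂ f (z.1, z.2 - x)) :
    HasDerivAt (fun x => f (z.1, z.2 - x)) (-derivSnd f (z.1, z.2 - x)) x := by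
  simpa using (hasDerivAt_snd h).comp_const_sub z.2 x

theorem exists_ball_analyticAt {f : ℂ × ℂ → ℂ} {p : ℂ × ℂ} (h : AnalyticAt ℂ f p) :
    ∃ δ > 0, ∀ z ∈ Metric.ball p δ, ∀ x : ℂ, ‖x‖ < δ → AnalyticAt ℂ f (z.1, z.2 + x) := by
  obtain ⟨δ, hδ, hb⟩ := Metric.eventually_nhds_iff_ball.1 h.eventually_analyticAt
  refine ⟨δ / 2, by positivity, fun z hz x hx => hb _ ?_⟩
  have := mem_ball_prod_add hz hx
  rwa [mul_div_cancel₀ _ two_ne_zero] at this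

theorem exists_norm_sub_le {f : ℂ × ℂ → ℂ} {p : ℂ × ℂ} (h : AnalyticAt ℂ f p) :
    ∃ C ≥ 0, ∃ δ > 0, ∀ z ∈ Metric.ball p δ, ∀ x : ℂ, ‖x‖ < δ →
      ‖f (z.1, z.2 + x) - f z‖ ≤ C * ‖x‖ := by
  obtain ⟨δ, hδ, hb⟩ := exists_ball_analyticAt h
  obtain ⟨ε, hε, hb'⟩ := Metric.eventually_nhds_iff_ball.1
    ((analyticAt_derivSnd h).continuousAt.norm.eventually_le_const
      (lt_add_one ‖derivSnd f p‖))
  refine ⟨‖derivSnd f p‖ + 1, by positivity, min δ (ε / 2), by positivity, fun z hz x hx => ?_⟩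
  have hz1 := Metric.ball_subset_ball (min_le_left _ _) hz
  have hz2 := Metric.ball_subset_ball (min_le_right _ _) hz
  have := norm_sub_le_of_norm_deriv_le (f := fun x => f (z.1, z.2 + x)) (x := x)
    (fun y hy => hasDerivAt_snd_add (hb z hz1 y (hy.trans_lt (hx.trans_le (min_le_left _ _)))))
    (C := ‖derivSnd f p‖ + 1)
    (fun y hy => hb' _ (by
      have := mem_ball_prod_add hz2 (hy.trans_lt (hx.trans_le (min_le_right _ _)))
      rwa [mul_div_cancel₀ _ two_ne_zero] at this))
  simpa using this

/-- The derivative of the left side in `x` is a sum of two increments of `derivSnd f`, and the mean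
value inequality applies. Uniformity in `z` is what allows the bound to be used along a moving point
of a curve. -/
theorem exists_norm_sub_sub_le {f : ℂ × ℂ → ℂ} {p : ℂ × ℂ} (h : AnalyticAt ℂ f p) :
    ∃ C ≥ 0, ∃ δ > 0, ∀ z ∈ Metric.ball p δ, ∀ x : ℂ, ‖x‖ < δ →
      ‖f (z.1, z.2 + x) - f (z.1, z.2 - x) - 2 * derivSnd f z * x‖ ≤ C * ‖x‖ ^ 2 := by
  obtain ⟨δ, hδ, hb⟩ := exists_ball_analyticAt h
  obtain ⟨C, hC, ε, hε, hb'⟩ := exists_norm_sub_le (analyticAt_derivSnd h)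
  refine ⟨2 * C, by positivity, min δ ε, by positivity, fun z hz x hx => ?_⟩
  have hz1 := Metric.ball_subset_ball (min_le_left _ _) hz
  have hz2 := Metric.ball_subset_ball (min_le_right _ _) hz
  have hx1 := hx.trans_le (min_le_left _ _)
  have hx2 := hx.trans_le (min_le_right _ _)
  have key := norm_sub_le_of_norm_deriv_le
    (f := fun x => f (z.1, z.2 + x) - f (z.1, z.2 - x) - 2 * derivSnd f z * x) (x := x)
    (f' := fun y => derivSnd f (z.1, z.2 + y) - -derivSnd f (z.1, z.2 - y) - 2 * derivSnd f z)
    (C := 2 * C * ‖x‖)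
    (fun y hy => ((hasDerivAt_snd_add (hb z hz1 y (hy.trans_lt hx1))).sub
      (hasDerivAt_snd_sub (by
        rw [sub_eq_add_neg]
        exact hb z hz1 (-y) (by rw [norm_neg]; exact hy.trans_lt hx1)))).sub
        (by simpa using (hasDerivAt_id y).const_mul (2 * derivSnd f z)))
    (fun y hy => by
      have h1 := hb' z hz2 y (hy.trans_lt hx2)
      have h2 := hb' z hz2 (-y) (by rw [norm_neg]; exact hy.trans_lt hx2)
      rw [norm_neg, ← sub_eq_add_neg] at h2
      calc _ = ‖(derivSnd f (z.1, z.2 + y) - derivSnd f z)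
            + (derivSnd f (z.1, z.2 - y) - derivSnd f z)‖ := by congr 1; ring
        _ ≤ _ := norm_add_le _ _
        _ ≤ C * ‖x‖ + C * ‖x‖ := add_le_add (h1.trans (by gcongr)) (h2.trans (by gcongr))
        _ = _ := by ring)
  have e : f (z.1, z.2 + 0) - f (z.1, z.2 - 0) - 2 * derivSnd f z * 0 = 0 := by simp
  rw [e, sub_zero] at key
  calc _ ≤ _ := key
    _ = _ := by ring

/-- The derivative of the left side in `x` is exactly the quantity estimated by
`exists_norm_sub_sub_le` for `derivSnd f`. -/
theorem exists_norm_second_difference_sub_le {f : ℂ × ℂ → ℂ} {p : ℂ × ℂ} (h : AnalyticAt ℂ f p) :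
    ∃ C ≥ 0, ∃ δ > 0, ∀ z ∈ Metric.ball p δ, ∀ x : ℂ, ‖x‖ < δ →
      ‖f (z.1, z.2 + x) - 2 * f z + f (z.1, z.2 - x) - derivSnd (derivSnd f) z * x ^ 2‖
        ≤ C * ‖x‖ ^ 3 := by
  obtain ⟨δ, hδ, hb⟩ := exists_ball_analyticAt h
  obtain ⟨C, hC, ε, hε, hb'⟩ := exists_norm_sub_sub_le (analyticAt_derivSnd h)
  refine ⟨C, by positivity, min δ ε, by positivity, fun z hz x hx => ?_⟩
  have hz1 := Metric.ball_subset_ball (min_le_left _ _) hz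
  have hz2 := Metric.ball_subset_ball (min_le_right _ _) hz
  have hx1 := hx.trans_le (min_le_left _ _)
  have hx2 := hx.trans_le (min_le_right _ _)
  set D := derivSnd (derivSnd f) z
  have key := norm_sub_le_of_norm_deriv_le
    (f := fun x => f (z.1, z.2 + x) - 2 * f z + f (z.1, z.2 - x) - D * x ^ 2)
    (x := x)
    (f' := fun y => derivSnd f (z.1, z.2 + y) + -derivSnd f (z.1, z.2 - y) - 2 * D * y)
    (C := C * ‖x‖ ^ 2)
    (fun y hy => (((hasDerivAt_snd_add (hb z hz1 y (hy.trans_lt hx1))).sub_const (2 * f z)).add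
      (hasDerivAt_snd_sub (by
        rw [sub_eq_add_neg]
        exact hb z hz1 (-y) (by rw [norm_neg]; exact hy.trans_lt hx1)))).sub
        (((hasDerivAt_pow 2 y).const_mul D).congr_deriv (by simp; ring)))
    (fun y hy => by
      have h1 := hb' z hz2 y (hy.trans_lt hx2)
      rw [← sub_eq_add_neg]
      exact h1.trans (by gcongr))
  have e : f (z.1, z.2 + 0) - 2 * f z + f (z.1, z.2 - 0) - D * 0 ^ 2 = 0 := by simp; ring
  rw [e, sub_zero] at key
  calc _ ≤ _ := key
    _ = _ := by ring

theorem eventually_eq_of_derivSnd_eq_zero {f : ℂ × ℂ → ℂ} {p : ℂ × ℂ} (h : AnalyticAt ℂ f p)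
    (h0 : ∀ᶠ z in 𝓝 p, derivSnd f z = 0) : ∀ᶠ z in 𝓝 p, f z = f (z.1, p.2) := by
  obtain ⟨ε, hε, hb⟩ := Metric.eventually_nhds_iff_ball.1 (h.eventually_analyticAt.and h0)
  filter_upwards [Metric.ball_mem_nhds p hε] with z hz
  rw [← ball_prod_same (x := p.1) (y := p.2)] at hb
  have hz' : z ∈ Metric.ball p.1 ε ×ˢ Metric.ball p.2 ε := by rwa [ball_prod_same]
  have := (convex_ball p.2 ε).norm_image_sub_le_of_norm_hasDerivWithin_le
    (f := fun u => f (z.1, u)) (f' := fun u => derivSnd f (z.1, u)) (C := 0) (x := p.2) (y := z.2)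
    (fun u hu => (hasDerivAt_snd (hb (z.1, u) ⟨hz'.1, hu⟩).1).hasDerivWithinAt)
    (fun u hu => by rw [(hb (z.1, u) ⟨hz'.1, hu⟩).2]; simp) (Metric.mem_ball_self hε) hz'.2
  simpa [sub_eq_zero] using this

/-! Orders of vanishing -/

theorem le_analyticOrderAt_of_isBigO {f : ℂ → ℂ} {t₀ : ℂ} {m : ℕ} (hf : AnalyticAt ℂ f t₀)
    (h : f =O[𝓝 t₀] fun t => (t - t₀) ^ m) : (m : ℕ∞) ≤ analyticOrderAt f t₀ := by
  by_contra! hlt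
  obtain ⟨k, hk⟩ := ENat.ne_top_iff_exists.1 hlt.ne_top
  rw [← hk, Nat.cast_lt] at hlt
  obtain ⟨g, hg, hg0, hfg⟩ := (hf.analyticOrderAt_eq_natCast).1 hk.symm
  obtain ⟨l, rfl⟩ := Nat.exists_eq_add_of_lt hlt
  have h1 : (fun t => (t - t₀) ^ k * g t) =O[𝓝[≠] t₀] fun t => (t - t₀) ^ k * (t - t₀) ^ (l + 1) := by
    have h2 := (h.congr' hfg EventuallyEq.rfl).mono (nhdsWithin_le_nhds (s := {t₀}ᶜ))
    simpa [add_assoc, pow_add] using h2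
  have h2 : g =O[𝓝[≠] t₀] fun t => (t - t₀) ^ (l + 1) := by
    have h3 := (Asymptotics.isBigO_refl (fun t => ((t - t₀) ^ k)⁻¹) (𝓝[≠] t₀)).mul h1
    refine h3.congr' ?_ ?_ <;>
    · filter_upwards [self_mem_nhdsWithin] with t ht
      have : (t - t₀) ^ k ≠ 0 := pow_ne_zero _ (sub_ne_zero.2 ht)
      field_simp
  have h3 : Tendsto (fun t => (t - t₀) ^ (l + 1)) (𝓝[≠] t₀) (𝓝 0) := by
    have : Continuous fun t : ℂ => (t - t₀) ^ (l + 1) := by fun_prop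
    have := (this.tendsto t₀).mono_left (nhdsWithin_le_nhds (s := {t₀}ᶜ))
    simpa using this
  exact hg0 (tendsto_nhds_unique (hg.continuousAt.tendsto.mono_left nhdsWithin_le_nhds)
    (h2.trans_tendsto h3))

theorem isBigO_of_le_analyticOrderAt {f : ℂ → ℂ} {t₀ : ℂ} {m : ℕ} (hf : AnalyticAt ℂ f t₀)
    (h : (m : ℕ∞) ≤ analyticOrderAt f t₀) : f =O[𝓝 t₀] fun t => (t - t₀) ^ m := by
  obtain ⟨g, hg, hfg⟩ := (natCast_le_analyticOrderAt hf).1 h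
  have h1 : g =O[𝓝 t₀] fun _ => (1 : ℂ) := hg.continuousAt.isBigO_one ℂ
  have h2 := (Asymptotics.isBigO_refl (fun t => (t - t₀) ^ m) (𝓝 t₀)).mul h1
  exact (h2.congr' (hfg.mono fun t ht => by simp [ht]) (Eventually.of_forall fun t => by simp))

/-- There are solutions of every order `k < n` of vanishing. -/
theorem IsSol.exists_order_eq {a : Fin n → ℂ → ℂ} {t₀ : ℂ} (ha : ∀ k, AnalyticAt ℂ (a k) t₀)
    {k : ℕ} (hk : k < n) : ∃ s, IsSol a t₀ s ∧ analyticOrderAt s t₀ = k := by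
  obtain ⟨s, hs, hs'⟩ := IsSol.exists_iteratedDeriv_eq (by omega) ha (Pi.single ⟨k, hk⟩ 1)
  refine ⟨s, hs, ?_⟩
  refine le_antisymm ?_ ?_
  · by_contra! hlt
    have h1 : ((k + 1 : ℕ) : ℕ∞) ≤ analyticOrderAt s t₀ := by
      rw [Nat.cast_add, Nat.cast_one]; exact Order.add_one_le_of_lt hlt
    have h2 := (natCast_le_analyticOrderAt_iff_iteratedDeriv_eq_zero hs.analyticAt).1 h1 k
      (by omega)
    have h3 := hs' ⟨k, hk⟩
    simp [h2] at h3
  · rw [natCast_le_analyticOrderAt_iff_iteratedDeriv_eq_zero hs.analyticAt]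
    intro i hi
    have h3 := hs' ⟨i, by omega⟩
    rw [h3, Pi.single_eq_of_ne]
    intro h
    simp at h
    omega

theorem IsSol.exists_apply_eq (hn : 0 < n) {a : Fin n → ℂ → ℂ} {t₀ : ℂ}
    (ha : ∀ k, AnalyticAt ℂ (a k) t₀) (u : ℂ) : ∃ s, IsSol a t₀ s ∧ s t₀ = u := by
  obtain ⟨s, hs, hs'⟩ := IsSol.exists_iteratedDeriv_eq hn ha (Pi.single ⟨0, hn⟩ u)
  exact ⟨s, hs, by simpa using hs' ⟨0, hn⟩⟩

end ODESymm
end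
-- Symmetries of the linear equation are affine in the dependent variable
noncomputable section

open Filter Topology Polynomial VectorField
open scoped ContDiff

namespace ODESymm

variable {n : ℕ}

section Asymptotics

open Asymptotics

variable {f : ℂ × ℂ → ℂ} {p : ℂ × ℂ} {s r : ℂ → ℂ}

theorem eventually_curve_mem_ball (hs : ContinuousAt s p.1) (hr : ContinuousAt r p.1)
    (hsp : s p.1 = p.2) (hrp : r p.1 = 0) {δ : ℝ} (hδ : 0 < δ) :
    ∀ᶠ t in 𝓝 p.1, (t, s t) ∈ Metric.ball p δ ∧ ‖r t‖ < δ := by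
  have hc : Tendsto (fun t => (t, s t)) (𝓝 p.1) (𝓝 p) := by
    have : ContinuousAt (fun t => (t, s t)) p.1 := continuousAt_id.prodMk hs
    rwa [ContinuousAt, hsp] at this
  have hr' : Tendsto (fun t => ‖r t‖) (𝓝 p.1) (𝓝 0) := by
    have := hr.norm
    rwa [ContinuousAt, hrp, norm_zero] at this
  exact (hc.eventually (Metric.ball_mem_nhds p hδ)).and (hr'.eventually_lt_const hδ)

theorem isBigO_first_difference_sub (hf : AnalyticAt ℂ f p) (hs : ContinuousAt s p.1)
    (hr : ContinuousAt r p.1) (hsp : s p.1 = p.2) (hrp : r p.1 = 0) :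
    (fun t => f (t, s t + r t) - f (t, s t - r t) - 2 * derivSnd f (t, s t) * r t)
      =O[𝓝 p.1] fun t => r t ^ 2 := by
  obtain ⟨C, _, δ, hδ, h⟩ := exists_norm_sub_sub_le hf
  refine IsBigO.of_bound C ?_
  filter_upwards [eventually_curve_mem_ball hs hr hsp hrp hδ] with t ht
  simpa using h _ ht.1 _ ht.2

theorem isBigO_second_difference_sub (hf : AnalyticAt ℂ f p) (hs : ContinuousAt s p.1)
    (hr : ContinuousAt r p.1) (hsp : s p.1 = p.2) (hrp : r p.1 = 0) :
    (fun t => f (t, s t + r t) - 2 * f (t, s t) + f (t, s t - r t)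
      - derivSnd (derivSnd f) (t, s t) * r t ^ 2) =O[𝓝 p.1] fun t => r t ^ 3 := by
  obtain ⟨C, _, δ, hδ, h⟩ := exists_norm_second_difference_sub_le hf
  refine IsBigO.of_bound C ?_
  filter_upwards [eventually_curve_mem_ball hs hr hsp hrp hδ] with t ht
  simpa using h _ ht.1 _ ht.2

theorem analyticAt_comp_curve (hf : AnalyticAt ℂ f p) (hs : AnalyticAt ℂ s p.1)
    (hsp : s p.1 = p.2) : AnalyticAt ℂ (fun t => f (t, s t)) p.1 :=
  AnalyticAt.comp (f := fun t => (t, s t)) (by rwa [hsp]) (analyticAt_id.prod hs)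

theorem isBigO_first_difference (hf : AnalyticAt ℂ f p) (hs : AnalyticAt ℂ s p.1)
    (hr : ContinuousAt r p.1) (hsp : s p.1 = p.2) (hrp : r p.1 = 0) :
    (fun t => f (t, s t + r t) - f (t, s t - r t)) =O[𝓝 p.1] r := by
  have h1 := isBigO_first_difference_sub hf hs.continuousAt hr hsp hrp
  have hr1 : r =O[𝓝 p.1] fun _ => (1 : ℂ) := hr.isBigO_one ℂ
  have h2 : (fun t => r t ^ 2) =O[𝓝 p.1] r := by
    simpa [pow_two] using (isBigO_refl r (𝓝 p.1)).mul hr1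
  have h3 : (fun t => 2 * derivSnd f (t, s t) * r t) =O[𝓝 p.1] r := by
    have h4 : (fun t => 2 * derivSnd f (t, s t)) =O[𝓝 p.1] fun _ => (1 : ℂ) :=
      (continuousAt_const.mul
        (analyticAt_comp_curve (analyticAt_derivSnd hf) hs hsp).continuousAt).isBigO_one ℂ
    simpa using h4.mul (isBigO_refl r (𝓝 p.1))
  exact ((h1.trans h2).add h3).congr_left fun t => by ring

theorem isBigO_second_difference (hf : AnalyticAt ℂ f p) (hs : AnalyticAt ℂ s p.1)
    (hr : ContinuousAt r p.1) (hsp : s p.1 = p.2) (hrp : r p.1 = 0) :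
    (fun t => f (t, s t + r t) - 2 * f (t, s t) + f (t, s t - r t)) =O[𝓝 p.1]
      fun t => r t ^ 2 := by
  have h1 := isBigO_second_difference_sub hf hs.continuousAt hr hsp hrp
  have hr1 : r =O[𝓝 p.1] fun _ => (1 : ℂ) := hr.isBigO_one ℂ
  have h2 : (fun t => r t ^ 3) =O[𝓝 p.1] fun t => r t ^ 2 := by
    refine ((isBigO_refl (fun t => r t ^ 2) (𝓝 p.1)).mul hr1).congr (fun t => ?_) fun t => ?_ <;> ring
  have h3 : (fun t => derivSnd (derivSnd f) (t, s t) * r t ^ 2) =O[𝓝 p.1] fun t => r t ^ 2 := by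
    have h4 : (fun t => derivSnd (derivSnd f) (t, s t)) =O[𝓝 p.1] fun _ => (1 : ℂ) :=
      (analyticAt_comp_curve (analyticAt_derivSnd (analyticAt_derivSnd hf)) hs hsp
        ).continuousAt.isBigO_one ℂ
    simpa using h4.mul (isBigO_refl (fun t => r t ^ 2) (𝓝 p.1))
  exact ((h1.trans h2).add h3).congr_left fun t => by ring

end Asymptotics

namespace IsLinSymmetryNear

variable {a : Fin n → ℂ → ℂ} {p : ℂ × ℂ} {w : ℂ × ℂ → ℂ × ℂ}

/-- The second difference of the characteristic in the direction of a solution vanishing to order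
`n - 1` vanishes. -/
theorem second_difference_characteristic (hn : 3 ≤ n) (h : IsLinSymmetryNear a p w)
    (hw : AnalyticAt ℂ w p) (ha : ∀ k, AnalyticAt ℂ (a k) p.1) {s r : ℂ → ℂ}
    (hs : IsSol a p.1 s) (hr : IsSol a p.1 r) (hsp : s p.1 = p.2)
    (hord : analyticOrderAt r p.1 = (n - 1 : ℕ)) :
    ∀ᶠ t in 𝓝 p.1,
      ((w (t, s t + r t)).2 - 2 * (w (t, s t)).2 + (w (t, s t - r t)).2)
      - deriv s t * ((w (t, s t + r t)).1 - 2 * (w (t, s t)).1 + (w (t, s t - r t)).1)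
      - deriv r t * ((w (t, s t + r t)).1 - (w (t, s t - r t)).1) = 0 := by
  have hrp : r p.1 = 0 := by
    refine apply_eq_zero_of_analyticOrderAt_ne_zero ?_
    rw [hord]; exact_mod_cast (by omega : n - 1 ≠ 0)
  have h1 := h.isSol_characteristic hw ha (hs.add hr) (by simp [hsp, hrp])
  have h2 := h.isSol_characteristic hw ha hs hsp
  have h3 := h.isSol_characteristic hw ha (hs.sub hr) (by simp [hsp, hrp])
  have hR := (h1.sub (h2.const_mul 2)).add h3
  -- This is the characteristic along `s + r`, minus twice that along `s`, plus that along `s - r`,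
  -- hence a solution.
  set R := fun t =>
      ((w (t, s t + r t)).2 - 2 * (w (t, s t)).2 + (w (t, s t - r t)).2)
      - deriv s t * ((w (t, s t + r t)).1 - 2 * (w (t, s t)).1 + (w (t, s t - r t)).1)
      - deriv r t * ((w (t, s t + r t)).1 - (w (t, s t - r t)).1) with hRdef
  have hR' : IsSol a p.1 R := by
    refine hR.congr ?_
    filter_upwards [hs.analyticAt.eventually_analyticAt, hr.analyticAt.eventually_analyticAt]
      with t e1 e2
    simp only [Jet.characteristic, hRdef]
    rw [deriv_fun_add e1.differentiableAt e2.differentiableAt,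
      deriv_fun_sub e1.differentiableAt e2.differentiableAt]
    ring
  have hf : AnalyticAt ℂ (fun z => (w z).1) p := analyticAt_fst.comp hw
  have hg : AnalyticAt ℂ (fun z => (w z).2) p := analyticAt_snd.comp hw
  have hrc := hr.analyticAt.continuousAt
  have o1 := isBigO_second_difference hg hs.analyticAt hrc hsp hrp
  have o2 := isBigO_second_difference hf hs.analyticAt hrc hsp hrp
  have o3 := isBigO_first_difference hf hs.analyticAt hrc hsp hrp
  have os : deriv s =O[𝓝 p.1] fun _ => (1 : ℂ) := hs.analyticAt.deriv.continuousAt.isBigO_one ℂ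
  have or := isBigO_of_le_analyticOrderAt hr.analyticAt hord.ge
  have or' : deriv r =O[𝓝 p.1] fun t => (t - p.1) ^ (n - 2) := by
    refine isBigO_of_le_analyticOrderAt hr.analyticAt.deriv ?_
    rw [natCast_le_analyticOrderAt_iff_iteratedDeriv_eq_zero hr.analyticAt.deriv]
    intro i hi
    rw [← iteratedDeriv_succ']
    exact (natCast_le_analyticOrderAt_iff_iteratedDeriv_eq_zero hr.analyticAt).1 hord.ge _
      (by omega)
  have hle : ∀ m, n ≤ m → (fun t => (t - p.1) ^ m) =O[𝓝 p.1] fun t => (t - p.1) ^ n := by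
    intro m hm
    have hc : ContinuousAt (fun t => (t - p.1) ^ (m - n)) p.1 := by fun_prop
    have := (Asymptotics.isBigO_refl (fun t => (t - p.1) ^ n) (𝓝 p.1)).mul (hc.isBigO_one ℂ)
    simpa [← pow_add, Nat.add_sub_cancel' hm] using this
  have or2 : (fun t => r t ^ 2) =O[𝓝 p.1] fun t => (t - p.1) ^ n := by
    refine (or.pow 2).trans ?_
    simpa [← pow_mul] using hle ((n - 1) * 2) (by omega)
  -- The decisive use of `n ≥ 3`: the order `(n - 2) + (n - 1)` is at least `n`.
  have orr : (fun t => deriv r t * r t) =O[𝓝 p.1] fun t => (t - p.1) ^ n := by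
    refine (or'.mul or).trans ?_
    simpa [← pow_add] using hle (n - 2 + (n - 1)) (by omega)
  have oR : R =O[𝓝 p.1] fun t => (t - p.1) ^ n := by
    refine ((o1.trans or2).sub ?_).sub (((Asymptotics.isBigO_refl (deriv r) _).mul o3).trans orr)
    simpa using os.mul (o2.trans or2)
  exact hR'.eventually_eq_zero ha (le_analyticOrderAt_of_isBigO hR'.analyticAt oR)

/-- In the vanishing second difference, the term `2 r' r ξ_u` would have order exactly `2n - 3` if
`ξ_u ≠ 0` at `p`, while all other terms have order at least `2n - 2`. -/
theorem derivSnd_fst_eq_zero (hn : 3 ≤ n) (h : IsLinSymmetryNear a p w)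
    (hw : AnalyticAt ℂ w p) (ha : ∀ k, AnalyticAt ℂ (a k) p.1) :
    derivSnd (fun z => (w z).1) p = 0 := by
  obtain ⟨s, hs, hsp⟩ := IsSol.exists_apply_eq (by omega) ha p.2
  obtain ⟨r, hr, hord⟩ := IsSol.exists_order_eq ha (show n - 1 < n by omega)
  have hrp : r p.1 = 0 := by
    refine apply_eq_zero_of_analyticOrderAt_ne_zero ?_
    rw [hord]; exact_mod_cast (by omega : n - 1 ≠ 0)
  have hR := h.second_difference_characteristic hn hw ha hs hr hsp hord
  have hf : AnalyticAt ℂ (fun z => (w z).1) p := analyticAt_fst.comp hw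
  have hg : AnalyticAt ℂ (fun z => (w z).2) p := analyticAt_snd.comp hw
  have hrc := hr.analyticAt.continuousAt
  have o1 := isBigO_second_difference hg hs.analyticAt hrc hsp hrp
  have o2 := isBigO_second_difference hf hs.analyticAt hrc hsp hrp
  have o3 := isBigO_first_difference_sub hf hs.analyticAt.continuousAt hrc hsp hrp
  have os : deriv s =O[𝓝 p.1] fun _ => (1 : ℂ) := hs.analyticAt.deriv.continuousAt.isBigO_one ℂ
  have or' : deriv r =O[𝓝 p.1] fun _ => (1 : ℂ) := hr.analyticAt.deriv.continuousAt.isBigO_one ℂ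
  have or := isBigO_of_le_analyticOrderAt hr.analyticAt hord.ge
  have hd := analyticAt_comp_curve (analyticAt_derivSnd hf) hs.analyticAt hsp
  set d := fun t => derivSnd (fun z => (w z).1) (t, s t) with hddef
  have hT : (fun t => deriv r t * (r t * d t)) =O[𝓝 p.1] fun t => (t - p.1) ^ ((n - 1) * 2) := by
    have e1 : (fun t => deriv r t * ((w (t, s t + r t)).1 - (w (t, s t - r t)).1))
        =O[𝓝 p.1] fun t => r t ^ 2 := by
      have := o1.sub (by simpa using os.mul o2)
      refine this.congr' ?_ EventuallyEq.rfl
      filter_upwards [hR] with t ht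
      linear_combination ht
    have e2 : (fun t => deriv r t * ((w (t, s t + r t)).1 - (w (t, s t - r t)).1
        - 2 * d t * r t)) =O[𝓝 p.1] fun t => r t ^ 2 := by
      simpa using or'.mul o3
    have e3 := ((e1.sub e2).const_mul_left (1 / 2)).trans (or.pow 2)
    simp only [← pow_mul] at e3
    exact e3.congr_left fun t => by ring
  have han : AnalyticAt ℂ (fun t => deriv r t * (r t * d t)) p.1 :=
    hr.analyticAt.deriv.mul (hr.analyticAt.mul hd)
  have hle := le_analyticOrderAt_of_isBigO han hT
  have hd0 : d p.1 = derivSnd (fun z => (w z).1) p := by simp [hddef, hsp]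
  by_contra hne
  have hdo : analyticOrderAt d p.1 = 0 := hd.analyticOrderAt_eq_zero.2 (by rwa [hd0])
  have hr'o : analyticOrderAt (deriv r) p.1 = (n - 2 : ℕ) := by
    have := hr.analyticAt.analyticOrderAt_deriv_add_one
    simp only [hrp, sub_zero] at this
    rw [show (fun z => r z) = r from rfl, hord, show n - 1 = (n - 2) + 1 by omega,
      Nat.cast_add, Nat.cast_one] at this
    exact (ENat.add_left_injective_of_ne_top ENat.one_ne_top) this
  have e1 := analyticOrderAt_mul hr.analyticAt.deriv (hr.analyticAt.mul hd)
  have e2 := analyticOrderAt_mul hr.analyticAt hd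
  rw [e2, hdo, hord, hr'o, add_zero] at e1
  have e3 : analyticOrderAt (fun t => deriv r t * (r t * d t)) p.1
    = ((n - 2 + (n - 1) : ℕ) : ℕ∞) := by rw [Nat.cast_add]; exact e1
  rw [e3, Nat.cast_le] at hle
  omega

/-- Once `ξ` does not depend on `u`, only the second difference of `η` remains, and it vanishes. Its
leading term `η_uu r^2` would have order `2(n - 1)`, but it must be `O(r^3)`. -/
theorem derivSnd_derivSnd_snd_eq_zero (hn : 3 ≤ n) (h : IsLinSymmetryNear a p w)
    (hw : AnalyticAt ℂ w p) (ha : ∀ k, AnalyticAt ℂ (a k) p.1)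
    (hξ : ∀ᶠ z in 𝓝 p, (w z).1 = (w (z.1, p.2)).1) :
    derivSnd (derivSnd fun z => (w z).2) p = 0 := by
  obtain ⟨s, hs, hsp⟩ := IsSol.exists_apply_eq (by omega) ha p.2
  obtain ⟨r, hr, hord⟩ := IsSol.exists_order_eq ha (show n - 1 < n by omega)
  have hrp : r p.1 = 0 := by
    refine apply_eq_zero_of_analyticOrderAt_ne_zero ?_
    rw [hord]; exact_mod_cast (by omega : n - 1 ≠ 0)
  have hR := h.second_difference_characteristic hn hw ha hs hr hsp hord
  have hg : AnalyticAt ℂ (fun z => (w z).2) p := analyticAt_snd.comp hw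
  have o1 := isBigO_second_difference_sub hg hs.analyticAt.continuousAt
    hr.analyticAt.continuousAt hsp hrp
  have or := isBigO_of_le_analyticOrderAt hr.analyticAt hord.ge
  have hd := analyticAt_comp_curve (analyticAt_derivSnd (analyticAt_derivSnd hg)) hs.analyticAt hsp
  set d := fun t => derivSnd (derivSnd fun z => (w z).2) (t, s t) with hddef
  have hcurve : ∀ u : ℂ → ℂ, AnalyticAt ℂ u p.1 → u p.1 = p.2 →
      ∀ᶠ t in 𝓝 p.1, (w (t, u t)).1 = (w (t, p.2)).1 := by
    intro u hu hup
    have hc : Tendsto (fun t => (t, u t)) (𝓝 p.1) (𝓝 p) := by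
      have : ContinuousAt (fun t => (t, u t)) p.1 := continuousAt_id.prodMk hu.continuousAt
      rwa [ContinuousAt, hup] at this
    exact hc.eventually hξ
  have hT : (fun t => d t * r t ^ 2) =O[𝓝 p.1] fun t => (t - p.1) ^ ((n - 1) * 3) := by
    have e3 := o1.neg_left.trans (or.pow 3)
    simp only [← pow_mul] at e3
    refine e3.congr' ?_ EventuallyEq.rfl
    filter_upwards [hR, hcurve s hs.analyticAt hsp,
      hcurve (fun t => s t + r t) (hs.analyticAt.add hr.analyticAt) (by simp [hsp, hrp]),
      hcurve (fun t => s t - r t) (hs.analyticAt.sub hr.analyticAt) (by simp [hsp, hrp])]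
      with t e0 e1 e2 e3
    rw [e1, e2, e3] at e0
    linear_combination -e0
  have han : AnalyticAt ℂ (fun t => d t * r t ^ 2) p.1 := hd.mul (hr.analyticAt.pow 2)
  have hle := le_analyticOrderAt_of_isBigO han hT
  have hd0 : d p.1 = derivSnd (derivSnd fun z => (w z).2) p := by simp [hddef, hsp]
  by_contra hne
  have hdo : analyticOrderAt d p.1 = 0 := hd.analyticOrderAt_eq_zero.2 (by rwa [hd0])
  have e1 := analyticOrderAt_mul hd (hr.analyticAt.pow 2)
  have e2 := analyticOrderAt_pow hr.analyticAt 2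
  rw [hdo, e2, hord, zero_add] at e1
  have e3 : analyticOrderAt (fun t => d t * r t ^ 2) p.1 = ((2 * (n - 1) : ℕ) : ℕ∞) := by
    rw [Nat.cast_mul]
    refine Eq.trans e1 ?_
    simp
  rw [e3, Nat.cast_le] at hle
  omega

end IsLinSymmetryNear

/-- The vector field `ξ(t) ∂_t + (c(t) u + e(t)) ∂_u`. -/
def affineField (ξ c e : ℂ → ℂ) (z : ℂ × ℂ) : ℂ × ℂ := (ξ z.1, c z.1 * z.2 + e z.1)

/-- The conditions on germs at `t₀` for `ξ(t) ∂_t + (c(t) u + e(t)) ∂_u` to be a symmetry of the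
linear equation. -/
structure IsLinSym (a : Fin n → ℂ → ℂ) (t₀ : ℂ) (ξ c e : ℂ → ℂ) : Prop where
  analyticAt_fst : AnalyticAt ℂ ξ t₀
  analyticAt_coeff : AnalyticAt ℂ c t₀
  isSol : IsSol a t₀ e
  isSol_map : ∀ s, IsSol a t₀ s → IsSol a t₀ fun t => ξ t * deriv s t - c t * s t

theorem analyticAt_affineField {ξ c e : ℂ → ℂ} {p : ℂ × ℂ} (hξ : AnalyticAt ℂ ξ p.1)
    (hc : AnalyticAt ℂ c p.1) (he : AnalyticAt ℂ e p.1) : AnalyticAt ℂ (affineField ξ c e) p := by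
  have h (f : ℂ → ℂ) (hf : AnalyticAt ℂ f p.1) : AnalyticAt ℂ (fun z : ℂ × ℂ => f z.1) p :=
    hf.comp analyticAt_fst
  exact (h ξ hξ).prod (((h c hc).mul analyticAt_snd).add (h e he))

/-- The symmetry condition holds at all nearby points, so `ξ_u` and `η_uu` vanish on a
neighbourhood, and both components can be integrated in `u`. The conditions on `c` and `e` are then
read off from the characteristics. -/
theorem IsLinSymmetryNear.exists_isLinSym (hn : 3 ≤ n) {a : Fin n → ℂ → ℂ} {p : ℂ × ℂ}
    {w : ℂ × ℂ → ℂ × ℂ} (h : IsLinSymmetryNear a p w) (hw : AnalyticAt ℂ w p)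
    (ha : ∀ k, AnalyticAt ℂ (a k) p.1) :
    ∃ ξ c e, IsLinSym a p.1 ξ c e ∧ w =ᶠ[𝓝 p] affineField ξ c e := by
  have hev : ∀ᶠ z in 𝓝 p, IsLinSymmetryNear a z w ∧ AnalyticAt ℂ w z ∧
      ∀ k, AnalyticAt ℂ (a k) z.1 :=
    (Eventually.eventually_nhds h).and (hw.eventually_analyticAt.and
      (eventually_all.2 fun k => continuousAt_fst.eventually (ha k).eventually_analyticAt))
  have hf : AnalyticAt ℂ (fun z => (w z).1) p := analyticAt_fst.comp hw
  have hg : AnalyticAt ℂ (fun z => (w z).2) p := analyticAt_snd.comp hw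
  have hξ : ∀ᶠ z in 𝓝 p, (w z).1 = (w (z.1, p.2)).1 :=
    eventually_eq_of_derivSnd_eq_zero hf
      (hev.mono fun z hz => hz.1.derivSnd_fst_eq_zero hn hz.2.1 hz.2.2)
  have hξ' : ∀ᶠ z in 𝓝 p, ∀ᶠ z' in 𝓝 z, (w z').1 = (w (z'.1, z.2)).1 := by
    filter_upwards [hev.eventually_nhds] with z hz
    exact eventually_eq_of_derivSnd_eq_zero (analyticAt_fst.comp hz.self_of_nhds.2.1)
      (hz.mono fun z hz => hz.1.derivSnd_fst_eq_zero hn hz.2.1 hz.2.2)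
  have hc := eventually_eq_of_derivSnd_eq_zero (analyticAt_derivSnd hg)
    ((hev.and hξ').mono fun z hz =>
      hz.1.1.derivSnd_derivSnd_snd_eq_zero hn hz.1.2.1 hz.1.2.2 hz.2)
  have hline : AnalyticAt ℂ (fun t : ℂ => (t, p.2)) p.1 := analyticAt_id.prod analyticAt_const
  have hline0 : ∀ {f : ℂ × ℂ → ℂ}, AnalyticAt ℂ f p → AnalyticAt ℂ (fun t => f (t, p.2)) p.1 :=
    fun {f} hf => AnalyticAt.comp (f := fun t : ℂ => (t, p.2)) hf hline
  set c : ℂ → ℂ := fun t => derivSnd (fun z => (w z).2) (t, p.2) with hcdef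
  have hcan : AnalyticAt ℂ c p.1 := hline0 (analyticAt_derivSnd hg)
  have hc1 : AnalyticAt ℂ (fun z : ℂ × ℂ => c z.1 * z.2) p :=
    (AnalyticAt.comp (f := fun z : ℂ × ℂ => z.1) hcan analyticAt_fst).mul analyticAt_snd
  have hη : ∀ᶠ z in 𝓝 p, (w z).2 - c z.1 * z.2 = (w (z.1, p.2)).2 - c z.1 * p.2 := by
    refine eventually_eq_of_derivSnd_eq_zero (f := fun z => (w z).2 - c z.1 * z.2)
      (hg.sub hc1) ?_
    filter_upwards [hc, hg.eventually_analyticAt, hc1.eventually_analyticAt] with z h1 h2 h3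
    have e1 := hasDerivAt_snd (t := z.1) (u := z.2) (h2.sub h3)
    have e2 : HasDerivAt (fun u => (w (z.1, u)).2 - c z.1 * u) (derivSnd (fun z => (w z).2) z
        - c z.1) z.2 := by
      simpa using (hasDerivAt_snd (t := z.1) (u := z.2) h2).fun_sub
        ((hasDerivAt_id z.2).const_mul (c z.1))
    have e3 := e1.unique e2
    rw [h1, hcdef, sub_self] at e3
    exact e3
  set ξ : ℂ → ℂ := fun t => (w (t, p.2)).1 with hξdef
  set e : ℂ → ℂ := fun t => (w (t, p.2)).2 - c t * p.2 with hedef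
  have hwe : w =ᶠ[𝓝 p] affineField ξ c e := by
    filter_upwards [hξ, hη] with z h1 h2
    ext
    · exact h1
    · simp only [affineField, hedef]; linear_combination h2
  have hξan : AnalyticAt ℂ ξ p.1 := hline0 hf
  -- The field is defined only near `p`, so characteristics are available only for solutions with
  -- initial value close to `p.2`.
  have hchar : ∀ᶠ u in 𝓝 p.2, ∀ s, IsSol a p.1 s → s p.1 = u →
      IsSol a p.1 fun t => c t * s t + e t - ξ t * deriv s t := by
    have hcu : Tendsto (fun u : ℂ => (p.1, u)) (𝓝 p.2) (𝓝 p) := by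
      have : Continuous fun u : ℂ => (p.1, u) := by fun_prop
      exact this.tendsto p.2
    filter_upwards [hcu.eventually hev, hcu.eventually hwe.eventually_nhds] with u h1 h2 s hs hsu
    have h3 := h1.1.isSol_characteristic h1.2.1 h1.2.2 hs hsu
    refine h3.congr ?_
    have hct : Tendsto (fun t => (t, s t)) (𝓝 p.1) (𝓝 (p.1, u)) := by
      have : ContinuousAt (fun t => (t, s t)) p.1 :=
        continuousAt_id.prodMk hs.analyticAt.continuousAt
      rwa [ContinuousAt, hsu] at this
    filter_upwards [hct.eventually h2] with t ht
    simp only [Jet.characteristic, ht, affineField]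
    ring
  obtain ⟨s₀, hs₀, hs₀p⟩ := IsSol.exists_apply_eq (by omega) ha p.2
  have hN₀ := hchar.self_of_nhds s₀ hs₀ hs₀p
  -- An arbitrary solution enters as a small perturbation `s₀ + ε s`. The characteristic is affine
  -- in the solution, and the difference divided by `ε` is its linear part.
  have hmap : ∀ s, IsSol a p.1 s → IsSol a p.1 fun t => ξ t * deriv s t - c t * s t := by
    intro s hs
    have hcε : Tendsto (fun ε : ℂ => p.2 + ε * s p.1) (𝓝[≠] 0) (𝓝 p.2) := by
      have : Continuous fun ε : ℂ => p.2 + ε * s p.1 := by fun_prop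
      have := (this.tendsto 0).mono_left (nhdsWithin_le_nhds (s := {0}ᶜ))
      simpa using this
    obtain ⟨ε, h1, h2⟩ := ((hcε.eventually hchar).and self_mem_nhdsWithin).exists
    have hε : ε ≠ 0 := h2
    have h3 := h1 _ (hs₀.add (hs.const_mul ε)) (by simp [hs₀p])
    refine ((hN₀.sub h3).const_mul ε⁻¹).congr ?_
    filter_upwards [hs₀.analyticAt.eventually_analyticAt, hs.analyticAt.eventually_analyticAt]
      with t e1 e2
    rw [deriv_fun_add e1.differentiableAt (e2.differentiableAt.const_mul ε),
      deriv_const_mul _ e2.differentiableAt]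
    field_simp
    ring
  refine ⟨ξ, c, e, ⟨hξan, hcan, ?_, hmap⟩, hwe⟩
  exact (hN₀.add (hmap s₀ hs₀)).congr (Eventually.of_forall fun t => by ring)

/-- A fundamental system of solutions. -/
theorem exists_fundamental_system (hn : 0 < n) {a : Fin n → ℂ → ℂ} {t₀ : ℂ}
    (ha : ∀ k, AnalyticAt ℂ (a k) t₀) : ∃ S : Fin n → ℂ → ℂ, (∀ i, IsSol a t₀ (S i)) ∧
      ∀ i k : Fin n, iteratedDeriv k (S i) t₀ = if k = i then 1 else 0 := by
  choose S hS hS' using fun i : Fin n =>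
    IsSol.exists_iteratedDeriv_eq hn ha (fun k => if k = i then 1 else 0)
  exact ⟨S, hS, hS'⟩

/-- The Wronskian matrix of the fundamental system is the identity at `t₀`, hence invertible nearby.
This gives one neighbourhood that serves all jets, whose derivative coordinates are unbounded. -/
theorem eventually_exists_solution_of_jet {a : Fin n → ℂ → ℂ} {t₀ : ℂ}
    {S : Fin n → ℂ → ℂ} (hS : ∀ i, IsSol a t₀ (S i))
    (hS' : ∀ i k : Fin n, iteratedDeriv k (S i) t₀ = if k = i then 1 else 0) :
    ∀ᶠ t in 𝓝 t₀, ∀ J : Jet n, J 0 = t → linLhs a J = 0 →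
      ∃ α : Fin n → ℂ, J = Jet.ofFun (fun t => ∑ i, α i * S i t) t := by
  let W : ℂ → Matrix (Fin n) (Fin n) ℂ := fun t => Matrix.of fun k i => iteratedDeriv k (S i) t
  have hW : ContinuousAt W t₀ := continuousAt_pi.2 fun k => continuousAt_pi.2 fun i =>
    (analyticAt_iteratedDeriv (hS i).analyticAt k).continuousAt
  have hdet : ContinuousAt (fun t => (W t).det) t₀ :=
    (Continuous.matrix_det continuous_id).continuousAt.comp hW
  have hW1 : W t₀ = 1 := by
    ext k i; simp [W, hS', Matrix.one_apply]
  have hne : ∀ᶠ t in 𝓝 t₀, (W t).det ≠ 0 := hdet.eventually_ne (by rw [hW1]; simp)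
  filter_upwards [hne, eventually_all.2 fun i => (hS i).eventually] with t h1 h2 J hJt hJ
  set b : Fin n → ℂ := fun k => Jet.dcoord k J with hb
  set α : Fin n → ℂ := (W t)⁻¹.mulVec b with hα
  have hαW : (W t).mulVec α = b := by
    rw [hα, Matrix.mulVec_mulVec, Matrix.mul_nonsing_inv _ h1.isUnit, Matrix.one_mulVec]
  set s : ℂ → ℂ := fun t => ∑ i, α i * S i t with hs
  have hsol : IsSol a t s := IsSol.sum Finset.univ fun i _ => (h2 i).const_mul (α i)
  have hder : ∀ k : Fin n, iteratedDeriv k s t = Jet.dcoord k J := by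
    intro k
    rw [hs, iteratedDeriv_fun_sum fun i _ =>
      (((h2 i).const_mul (α i)).analyticAt.contDiffAt (n := k))]
    have : ∀ i, iteratedDeriv k (fun t => α i * S i t) t = α i * iteratedDeriv k (S i) t :=
      fun i => iteratedDeriv_const_mul _ (h2 i).analyticAt.contDiffAt
    simp only [this]
    have h3 := congrFun hαW k
    rw [show Jet.dcoord k J = b k from rfl, ← h3]
    simp [Matrix.mulVec, dotProduct, W, mul_comm]
  have htop : iteratedDeriv n s t = Jet.dcoord n J := by
    have h3 := hsol.eq_zero.self_of_nhds
    simp only [linOp, hder] at h3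
    simp only [linLhs, hJt] at hJ
    linear_combination h3 - hJ
  refine ⟨α, ?_⟩
  ext i
  refine Fin.cases hJt (fun k => ?_) i
  simp only [Jet.ofFun, Fin.cons_succ]
  rcases Nat.lt_or_ge k n with hk | hk
  · have := hder ⟨k, hk⟩
    rw [this, Jet.dcoord_of_le hk.le]
  · obtain rfl : k = Fin.last n := by ext; simp; omega
    rw [Fin.val_last, htop, Jet.dcoord_of_le le_rfl]
    rfl

/-- Every jet on the linear equation is the jet of a combination of finitely many fixed solutions,
and along it the characteristic is a solution. The finiteness gives a common neighbourhood. -/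
theorem IsLinSym.isLinSymmetryNear (hn : 0 < n) {a : Fin n → ℂ → ℂ} {p : ℂ × ℂ}
    {ξ c e : ℂ → ℂ} (h : IsLinSym a p.1 ξ c e) (ha : ∀ k, AnalyticAt ℂ (a k) p.1) :
    IsLinSymmetryNear a p (affineField ξ c e) := by
  obtain ⟨S, hS, hS'⟩ := exists_fundamental_system hn ha
  have hev : ∀ᶠ t in 𝓝 p.1, (∀ J : Jet n, J 0 = t → linLhs a J = 0 →
      ∃ α : Fin n → ℂ, J = Jet.ofFun (fun t => ∑ i, α i * S i t) t) ∧
      (∀ i, IsSol a t (S i)) ∧ (∀ i, IsSol a t fun t => ξ t * deriv (S i) t - c t * S i t) ∧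
      IsSol a t e ∧ AnalyticAt ℂ ξ t ∧ AnalyticAt ℂ c t ∧ ∀ k, AnalyticAt ℂ (a k) t :=
    (eventually_exists_solution_of_jet hS hS').and
      ((eventually_all.2 fun i => (hS i).eventually).and
      ((eventually_all.2 fun i => (h.isSol_map _ (hS i)).eventually).and
      (h.isSol.eventually.and (h.analyticAt_fst.eventually_analyticAt.and
      (h.analyticAt_coeff.eventually_analyticAt.and
        (eventually_all.2 fun k => (ha k).eventually_analyticAt))))))
  filter_upwards [continuousAt_fst.eventually hev] with p' h1 J hJp hJ
  obtain ⟨h1, h2, h3, h4, h5, h6, h7⟩ := h1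
  subst hJp
  obtain ⟨α, hα⟩ := h1 J rfl hJ
  set t := J.base.1
  set s : ℂ → ℂ := fun t => ∑ i, α i * S i t with hs
  have hsol : IsSol a t s := IsSol.sum Finset.univ fun i _ => (h2 i).const_mul (α i)
  have hchar : IsSol a t (Jet.characteristic (affineField ξ c e) s) := by
    refine ((IsSol.sum Finset.univ fun i _ => (h3 i).const_mul (-α i)).add h4).congr ?_
    filter_upwards [eventually_all.2 fun i => (h2 i).analyticAt.eventually_analyticAt] with t' ht'
    have hd : deriv s t' = ∑ i, α i * deriv (S i) t' :=
      (HasDerivAt.fun_sum fun i _ =>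
        ((ht' i).differentiableAt.hasDerivAt.const_mul (α i))).deriv
    simp only [Jet.characteristic, affineField, hd]
    simp only [hs, Finset.mul_sum, Finset.sum_mul]
    rw [add_sub_right_comm, ← Finset.sum_sub_distrib]
    congr 1
    exact Finset.sum_congr rfl fun i _ => by ring
  rw [hα, fderiv_linLhs_ofFun h7 hsol.analyticAt (analyticAt_affineField h5 h6 h4.analyticAt),
    hchar.eq_zero.self_of_nhds]
  have h8 : linOp a s =ᶠ[𝓝 t] fun _ => 0 := hsol.eq_zero
  rw [h8.deriv_eq]
  simp

end ODESymm
end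
noncomputable section

open Filter Topology Polynomial VectorField
open scoped ContDiff

namespace ODESymm

variable {n : ℕ}

/-! Symmetries that vanish at the base point -/

theorem eventually_eq_zero_of_punctured {f : ℂ → ℂ} {t₀ : ℂ} (hf : ContinuousAt f t₀)
    (h : ∀ᶠ t in 𝓝[≠] t₀, f t = 0) : ∀ᶠ t in 𝓝 t₀, f t = 0 := by
  have h0 : f t₀ = 0 :=
    tendsto_nhds_unique (hf.tendsto.mono_left nhdsWithin_le_nhds)
      (tendsto_const_nhds.congr' (h.mono fun t ht => ht.symm))
  filter_upwards [eventually_nhdsWithin_iff.1 h] with t ht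
  by_cases htt : t = t₀
  · rw [htt, h0]
  · exact ht htt

theorem eventually_eq_zero_of_pow_mul {f : ℂ → ℂ} {t₀ : ℂ} (m : ℕ) (hf : ContinuousAt f t₀)
    (h : ∀ᶠ t in 𝓝 t₀, (t - t₀) ^ m * f t = 0) : ∀ᶠ t in 𝓝 t₀, f t = 0 := by
  refine eventually_eq_zero_of_punctured hf ?_
  filter_upwards [h.filter_mono nhdsWithin_le_nhds, self_mem_nhdsWithin] with t h1 h2
  exact (mul_eq_zero.1 h1).resolve_left (pow_ne_zero _ (sub_ne_zero.2 h2))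

theorem sub_mul_deriv_of_eq_pow_mul {g w : ℂ → ℂ} {t₀ : ℂ} {m : ℕ} (hw : AnalyticAt ℂ w t₀)
    (h : ∀ᶠ t in 𝓝 t₀, g t = (t - t₀) ^ m * w t) :
    ∀ᶠ t in 𝓝 t₀, (t - t₀) * deriv g t = (t - t₀) ^ m * (m * w t + (t - t₀) * deriv w t) := by
  filter_upwards [h.eventually_nhds, hw.eventually_analyticAt] with t h1 h2
  have h3 : g =ᶠ[𝓝 t] fun t => (t - t₀) ^ m * w t := h1
  have h4 : HasDerivAt (fun t => (t - t₀) ^ m) (m * (t - t₀) ^ (m - 1)) t := by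
    simpa using ((hasDerivAt_id t).sub_const t₀).fun_pow m
  rw [h3.deriv_eq, (h4.fun_mul h2.differentiableAt.hasDerivAt).deriv]
  rcases m with _ | m
  · simp
  · simp only [Nat.add_sub_cancel, pow_succ]
    ring

theorem succ_le_analyticOrderAt {f w : ℂ → ℂ} {t₀ : ℂ} {m : ℕ} (hw : AnalyticAt ℂ w t₀)
    (h : ∀ᶠ t in 𝓝 t₀, f t = (t - t₀) ^ m * w t) (h0 : w t₀ = 0) :
    ((m + 1 : ℕ) : ℕ∞) ≤ analyticOrderAt f t₀ := by
  have h1 : (1 : ℕ∞) ≤ analyticOrderAt w t₀ := by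
    rw [Order.one_le_iff_ne_zero, hw.analyticOrderAt_ne_zero]; exact h0
  obtain ⟨v, hv, hwv⟩ := (natCast_le_analyticOrderAt (n := 1) hw).1 (by simpa using h1)
  have hp : AnalyticAt ℂ (fun t => (t - t₀) ^ m * w t) t₀ := by fun_prop
  rw [natCast_le_analyticOrderAt (hp.congr (h.mono fun t ht => ht.symm))]
  refine ⟨v, hv, ?_⟩
  filter_upwards [h, hwv] with t h1 h2
  rw [h1, h2]
  simp only [smul_eq_mul]
  ring

theorem exists_eq_pow_mul_of_order_eq {f : ℂ → ℂ} {t₀ : ℂ} {m : ℕ} (hf : AnalyticAt ℂ f t₀)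
    (h : analyticOrderAt f t₀ = m) :
    ∃ w, AnalyticAt ℂ w t₀ ∧ w t₀ ≠ 0 ∧ ∀ᶠ t in 𝓝 t₀, f t = (t - t₀) ^ m * w t :=
  (hf.analyticOrderAt_eq_natCast).1 h

theorem exists_eq_pow_mul_of_le_order {f : ℂ → ℂ} {t₀ : ℂ} {m : ℕ} (hf : AnalyticAt ℂ f t₀)
    (h : (m : ℕ∞) ≤ analyticOrderAt f t₀) :
    ∃ w, AnalyticAt ℂ w t₀ ∧ ∀ᶠ t in 𝓝 t₀, f t = (t - t₀) ^ m * w t :=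
  (natCast_le_analyticOrderAt hf).1 h

section Operator

variable {ξ e₁ b g : ℂ → ℂ} {t₀ : ℂ}

theorem operator_eq {w : ℂ → ℂ} {m : ℕ} (hξ : ∀ᶠ t in 𝓝 t₀, ξ t = (t - t₀) * e₁ t)
    (hw : AnalyticAt ℂ w t₀) (hg : ∀ᶠ t in 𝓝 t₀, g t = (t - t₀) ^ m * w t) :
    ∀ᶠ t in 𝓝 t₀, ξ t * deriv g t - b t * g t =
      (t - t₀) ^ m * (e₁ t * (m * w t + (t - t₀) * deriv w t) - b t * w t) := by
  filter_upwards [hξ, hg, sub_mul_deriv_of_eq_pow_mul hw hg] with t h1 h2 h3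
  rw [h1, h2]
  linear_combination e₁ t * h3

theorem analyticAt_operator {ξ b g : ℂ → ℂ} (hξ : AnalyticAt ℂ ξ t₀) (hb : AnalyticAt ℂ b t₀)
    (hg : AnalyticAt ℂ g t₀) : AnalyticAt ℂ (fun t => ξ t * deriv g t - b t * g t) t₀ :=
  (hξ.mul hg.deriv).sub (hb.mul hg)

theorem le_order_operator {m : ℕ} (hξ : ∀ᶠ t in 𝓝 t₀, ξ t = (t - t₀) * e₁ t)
    (he : AnalyticAt ℂ e₁ t₀) (hb : AnalyticAt ℂ b t₀) (hg : AnalyticAt ℂ g t₀)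
    (h : (m : ℕ∞) ≤ analyticOrderAt g t₀) :
    (m : ℕ∞) ≤ analyticOrderAt (fun t => ξ t * deriv g t - b t * g t) t₀ := by
  obtain ⟨w, hw, hgw⟩ := exists_eq_pow_mul_of_le_order hg h
  have hξan : AnalyticAt ℂ ξ t₀ :=
    AnalyticAt.congr (f := fun t => (t - t₀) * e₁ t) (by fun_prop) (hξ.mono fun t ht => ht.symm)
  rw [natCast_le_analyticOrderAt (analyticAt_operator hξan hb hg)]
  have := hw.deriv
  exact ⟨_, by fun_prop, operator_eq hξ hw hgw⟩

/-- The operator multiplies the coefficient of `(t - t₀)^m` by `m e₁(t₀) - b(t₀)`, which is zero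
here. -/
theorem succ_le_order_operator {m : ℕ} (hξ : ∀ᶠ t in 𝓝 t₀, ξ t = (t - t₀) * e₁ t)
    (he : AnalyticAt ℂ e₁ t₀) (hb : AnalyticAt ℂ b t₀) (hg : AnalyticAt ℂ g t₀)
    (hbm : b t₀ = m * e₁ t₀) (h : (m : ℕ∞) ≤ analyticOrderAt g t₀) :
    ((m + 1 : ℕ) : ℕ∞) ≤ analyticOrderAt (fun t => ξ t * deriv g t - b t * g t) t₀ := by
  obtain ⟨w, hw, hgw⟩ := exists_eq_pow_mul_of_le_order hg h
  have := hw.deriv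
  refine succ_le_analyticOrderAt (by fun_prop) (operator_eq hξ hw hgw) ?_
  rw [hbm]
  ring

/-- The operator `ξ d/dt - b` is injective on functions vanishing to order `n`. -/
theorem eventually_eq_zero_of_operator_eq_zero {r : ℂ → ℂ} {i m₁ : ℕ} {c₀ : ℂ → ℂ}
    (hξ : ∀ᶠ t in 𝓝 t₀, ξ t = (t - t₀) * e₁ t) (he : AnalyticAt ℂ e₁ t₀)
    (hne : ¬ ∀ᶠ t in 𝓝 t₀, ξ t = 0) (hc₀ : AnalyticAt ℂ c₀ t₀) (hc₀0 : c₀ t₀ = 0)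
    (hr : AnalyticAt ℂ r t₀) (hro : analyticOrderAt r t₀ = m₁)
    (hrT : ∀ᶠ t in 𝓝 t₀, ξ t * deriv r t - (c₀ t + m₁ * e₁ t₀) * r t = 0)
    (hi : i ≤ m₁) (hg : AnalyticAt ℂ g t₀) (hgo : ((m₁ + 1 : ℕ) : ℕ∞) ≤ analyticOrderAt g t₀)
    (hgT : ∀ᶠ t in 𝓝 t₀, ξ t * deriv g t - (c₀ t + i * e₁ t₀) * g t = 0) :
    ∀ᶠ t in 𝓝 t₀, g t = 0 := by
  rw [← analyticOrderAt_eq_top]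
  by_contra htop
  obtain ⟨m, hm⟩ := ENat.ne_top_iff_exists.1 htop
  rw [← hm, Nat.cast_le] at hgo
  obtain ⟨w, hw, hw0, hgw⟩ := exists_eq_pow_mul_of_order_eq hg hm.symm
  have hw' := hw.deriv
  -- If `e₁ t₀ ≠ 0`, the leading coefficient of `g` is multiplied by `e₁(t₀) (m - i) ≠ 0`. If `e₁ t₀
  -- = 0`, the same operator annihilates `g` and `r`, so their Wronskian vanishes where `ξ ≠ 0`;
  -- this is impossible for functions of different orders.
  by_cases hκ : e₁ t₀ = 0
  · obtain ⟨r₁, hr₁, hr₁0, hrr⟩ := exists_eq_pow_mul_of_order_eq hr hro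
    have hr₁' := hr₁.deriv
    have hξan : AnalyticAt ℂ ξ t₀ :=
      AnalyticAt.congr (f := fun t => (t - t₀) * e₁ t) (by fun_prop) (hξ.mono fun t ht => ht.symm)
    have hξne := hξan.eventually_eq_zero_or_eventually_ne_zero.resolve_left hne
    have key : ∀ᶠ t in 𝓝 t₀, (((m : ℂ) - m₁) * (w t * r₁ t)
        + (t - t₀) * (deriv w t * r₁ t - w t * deriv r₁ t)) = 0 := by
      refine eventually_eq_zero_of_punctured ?_ ?_
      · have : AnalyticAt ℂ (fun t => (((m : ℂ) - m₁) * (w t * r₁ t)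
          + (t - t₀) * (deriv w t * r₁ t - w t * deriv r₁ t))) t₀ := by fun_prop
        exact this.continuousAt
      · filter_upwards [hξne, self_mem_nhdsWithin, hrT.filter_mono nhdsWithin_le_nhds,
          hgT.filter_mono nhdsWithin_le_nhds, hgw.filter_mono nhdsWithin_le_nhds,
          hrr.filter_mono nhdsWithin_le_nhds,
          (sub_mul_deriv_of_eq_pow_mul hw hgw).filter_mono nhdsWithin_le_nhds,
          (sub_mul_deriv_of_eq_pow_mul hr₁ hrr).filter_mono nhdsWithin_le_nhds]
          with t h1 h2 h3 h4 h5 h6 h7 h8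
        have h2' : t - t₀ ≠ 0 := sub_ne_zero.2 h2
        rw [hκ] at h3 h4
        have h9 : ξ t * (deriv g t * r t - g t * deriv r t) = 0 := by
          linear_combination r t * h4 - g t * h3
        have h10 := (mul_eq_zero.1 h9).resolve_left h1
        have h11 : (t - t₀) ^ m * (t - t₀) ^ m₁ * (((m : ℂ) - m₁) * (w t * r₁ t)
            + (t - t₀) * (deriv w t * r₁ t - w t * deriv r₁ t)) = 0 := by
          have e1 : ((t - t₀) * deriv g t) * r t - g t * ((t - t₀) * deriv r t) = 0 := by
            linear_combination (t - t₀) * h10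
          rw [h7, h8, h5, h6] at e1
          linear_combination e1
        exact (mul_eq_zero.1 h11).resolve_left
          (mul_ne_zero (pow_ne_zero _ h2') (pow_ne_zero _ h2'))
    have h0 := key.self_of_nhds
    simp only [sub_self, zero_mul, add_zero] at h0
    refine mul_ne_zero ?_ (mul_ne_zero hw0 hr₁0) h0
    rw [sub_ne_zero]
    exact_mod_cast (by omega : m ≠ m₁)
  · have hb : AnalyticAt ℂ (fun t => c₀ t + i * e₁ t₀) t₀ := hc₀.add analyticAt_const
    have h1 := operator_eq (b := fun t => c₀ t + i * e₁ t₀) hξ hw hgw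
    have han : AnalyticAt ℂ (fun t => e₁ t * (m * w t + (t - t₀) * deriv w t)
        - (c₀ t + i * e₁ t₀) * w t) t₀ := by fun_prop
    have h2 := eventually_eq_zero_of_pow_mul m han.continuousAt (by
      filter_upwards [h1, hgT] with t h1 h2
      rw [← h1, h2])
    have h3 := h2.self_of_nhds
    rw [hc₀0] at h3
    have h4 : e₁ t₀ * ((m : ℂ) - i) * w t₀ = 0 := by linear_combination h3
    refine mul_ne_zero (mul_ne_zero hκ ?_) hw0 h4
    rw [sub_ne_zero]
    exact_mod_cast (by omega : m ≠ i)

end Operator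

/-! ### The polynomial model of the solution space -/

/-- The functions `s₀ F(h)`. -/
def polyFun (s₀ h : ℂ → ℂ) (F : ℂ[X]) (t : ℂ) : ℂ := s₀ t * F.eval (h t)

theorem analyticAt_polyFun {s₀ h : ℂ → ℂ} {t₀ : ℂ} (hs : AnalyticAt ℂ s₀ t₀)
    (hh : AnalyticAt ℂ h t₀) (F : ℂ[X]) : AnalyticAt ℂ (polyFun s₀ h F) t₀ := by
  refine hs.mul ?_
  have hF : AnalyticAt ℂ (fun x => F.eval x) (h t₀) := by
    have : Differentiable ℂ fun x => F.eval x := F.differentiable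
    exact this.analyticAt _
  exact AnalyticAt.comp hF hh

theorem hasDerivAt_polyFun {s₀ h : ℂ → ℂ} {t : ℂ} (hs : AnalyticAt ℂ s₀ t)
    (hh : AnalyticAt ℂ h t) (F : ℂ[X]) : HasDerivAt (polyFun s₀ h F)
      (deriv s₀ t * F.eval (h t) + s₀ t * ((derivative F).eval (h t) * deriv h t)) t :=
  hs.differentiableAt.hasDerivAt.fun_mul
    ((F.hasDerivAt (h t)).comp t hh.differentiableAt.hasDerivAt)

/-- Every function agrees with some `s₀ F(h)`, `deg F < k`, to order `k`. -/
theorem exists_polyFun {s₀ h h₁ f : ℂ → ℂ} {t₀ : ℂ} (hs : AnalyticAt ℂ s₀ t₀)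
    (hs0 : s₀ t₀ ≠ 0) (hh₁ : AnalyticAt ℂ h₁ t₀) (hh₁0 : h₁ t₀ ≠ 0)
    (hh : ∀ t, h t = (t - t₀) * h₁ t) (hf : AnalyticAt ℂ f t₀) (k : ℕ) :
    ∃ F : ℂ[X], (∀ m ≥ k, F.coeff m = 0) ∧
      (k : ℕ∞) ≤ analyticOrderAt (fun t => f t - polyFun s₀ h F t) t₀ := by
  have hhan : AnalyticAt ℂ h t₀ := by
    rw [funext hh]; fun_prop
  induction k with
  | zero => exact ⟨0, by simp, by simp⟩
  | succ k ih =>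
    obtain ⟨F, hF, hord⟩ := ih
    obtain ⟨g, hg, hfg⟩ :=
      exists_eq_pow_mul_of_le_order (hf.sub (analyticAt_polyFun hs hhan F)) hord
    -- The function `s₀ h^k` has leading coefficient `s₀(t₀) h₁(t₀)^k` in order `k`, so this
    -- multiple cancels the next Taylor coefficient.
    set β := g t₀ / (s₀ t₀ * h₁ t₀ ^ k) with hβ
    refine ⟨F + C β * X ^ k, ?_, ?_⟩
    · intro m hm
      rw [coeff_add, hF m (by omega), coeff_C_mul, coeff_X_pow, if_neg (by omega)]
      simp
    · refine succ_le_analyticOrderAt (w := fun t => g t - β * (s₀ t * h₁ t ^ k)) (by fun_prop)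
        ?_ ?_
      · filter_upwards [hfg] with t ht
        simp only [polyFun, eval_add, eval_mul, eval_C, eval_pow, eval_X, Pi.sub_apply] at ht ⊢
        rw [hh t] at ht ⊢
        rw [mul_pow]
        linear_combination ht
      · rw [hβ]
        field_simp
        ring

/-- If a symmetry `ξ ∂_t + …` of the linear equation vanishes at `t₀`, then there is another one
that does not. -/
theorem IsLinSym.exists_ne_zero_of_eq_zero (hn : 2 ≤ n) {a : Fin n → ℂ → ℂ} {t₀ : ℂ}
    {ξ c e : ℂ → ℂ} (h : IsLinSym a t₀ ξ c e) (ha : ∀ k, AnalyticAt ℂ (a k) t₀)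
    (hξ0 : ξ t₀ = 0) (hne : ¬ ∀ᶠ t in 𝓝 t₀, ξ t = 0) :
    ∃ ξ₁ c₁, IsLinSym a t₀ ξ₁ c₁ (fun _ => 0) ∧ ξ₁ t₀ ≠ 0 := by
  obtain ⟨m, rfl⟩ : ∃ m, n = m + 2 := ⟨n - 2, by omega⟩
  obtain ⟨e₁, he₁, hξ⟩ : ∃ e₁, AnalyticAt ℂ e₁ t₀ ∧ ∀ᶠ t in 𝓝 t₀, ξ t = (t - t₀) * e₁ t := by
    have h1 : ((1 : ℕ) : ℕ∞) ≤ analyticOrderAt ξ t₀ := by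
      rw [Nat.cast_one, Order.one_le_iff_ne_zero, h.analyticAt_fst.analyticOrderAt_ne_zero]
      exact hξ0
    simpa using exists_eq_pow_mul_of_le_order h.analyticAt_fst h1
  set κ := e₁ t₀ with hκ
  -- Shifting `c` by constants amounts to adding multiples of `u ∂_u`. The resulting operators `T_i
  -- = ξ d/dt - (c₀ + i κ)` preserve solutions and raise order at least `i` to order at least `i +
  -- 1`.
  set c₀ : ℂ → ℂ := fun t => c t - c t₀ with hc₀
  have hc₀an : AnalyticAt ℂ c₀ t₀ := h.analyticAt_coeff.sub analyticAt_const
  have hc₀0 : c₀ t₀ = 0 := sub_self _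
  have hban : ∀ i : ℕ, AnalyticAt ℂ (fun t => c₀ t + i * κ) t₀ := fun i =>
    hc₀an.add analyticAt_const
  have hTsol : ∀ (i : ℕ) (s : ℂ → ℂ), IsSol a t₀ s →
      IsSol a t₀ fun t => ξ t * deriv s t - (c₀ t + i * κ) * s t := by
    intro i s hs
    refine ((h.isSol_map s hs).add (hs.const_mul (c t₀ - i * κ))).congr
      (Eventually.of_forall fun t => ?_)
    simp only [hc₀]
    ring
  have hTord : ∀ (i : ℕ) (s : ℂ → ℂ), AnalyticAt ℂ s t₀ → (i : ℕ∞) ≤ analyticOrderAt s t₀ →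
      ((i + 1 : ℕ) : ℕ∞) ≤
        analyticOrderAt (fun t => ξ t * deriv s t - (c₀ t + i * κ) * s t) t₀ := by
    intro i s hs hord
    exact succ_le_order_operator hξ he₁ (hban i) hs (by simp [hc₀0, hκ]) hord
  obtain ⟨r, hr, hro⟩ := IsSol.exists_order_eq ha (show m + 1 < m + 2 by omega)
  obtain ⟨p, hp, hpo⟩ := IsSol.exists_order_eq ha (show m < m + 2 by omega)
  -- A solution of order at least `n = m + 2` is zero. For the same reason `T_m p`, of order at
  -- least `m + 1`, is a multiple of `r`.
  have hrT : ∀ᶠ t in 𝓝 t₀, ξ t * deriv r t - (c₀ t + (m + 1 : ℕ) * κ) * r t = 0 :=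
    (hTsol (m + 1) r hr).eventually_eq_zero ha (hTord (m + 1) r hr.analyticAt hro.ge)
  obtain ⟨r₁, hr₁, hr₁0, hrr⟩ := exists_eq_pow_mul_of_order_eq hr.analyticAt hro
  obtain ⟨p₁, hp₁, hp₁0, hpp⟩ := exists_eq_pow_mul_of_order_eq hp.analyticAt hpo
  obtain ⟨γ, hpT⟩ : ∃ γ : ℂ, ∀ᶠ t in 𝓝 t₀,
      ξ t * deriv p t - (c₀ t + m * κ) * p t = γ * r t := by
    have hq := hTsol m p hp
    obtain ⟨q₁, hq₁, hqq⟩ := exists_eq_pow_mul_of_le_order hq.analyticAt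
      (hTord m p hp.analyticAt hpo.ge)
    refine ⟨q₁ t₀ / r₁ t₀, ?_⟩
    have hz := (hq.sub (hr.const_mul (q₁ t₀ / r₁ t₀))).eventually_eq_zero ha
      (succ_le_analyticOrderAt (w := fun t => q₁ t - q₁ t₀ / r₁ t₀ * r₁ t) (by fun_prop) (by
        filter_upwards [hqq, hrr] with t h1 h2
        rw [h1, h2]; ring) (by field_simp; ring))
    filter_upwards [hz] with t ht
    simpa [sub_eq_zero] using ht
  have hr₁T : ∀ᶠ t in 𝓝 t₀, ξ t * deriv r₁ t =
      (c₀ t + (m + 1) * κ - (m + 1) * e₁ t) * r₁ t := by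
    have h1 := operator_eq (b := fun t => c₀ t + (m + 1 : ℕ) * κ) hξ hr₁ hrr
    have hr₁' := hr₁.deriv
    have han : AnalyticAt ℂ (fun t => e₁ t * ((m + 1 : ℕ) * r₁ t + (t - t₀) * deriv r₁ t)
        - (c₀ t + (m + 1 : ℕ) * κ) * r₁ t) t₀ := by fun_prop
    have h2 := eventually_eq_zero_of_pow_mul (m + 1) han.continuousAt (by
      filter_upwards [h1, hrT] with t h1 h2
      rw [← h1, h2])
    filter_upwards [h2, hξ] with t h3 h4
    rw [h4]
    push_cast at h3
    linear_combination h3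
  have hp₁T : ∀ᶠ t in 𝓝 t₀, ξ t * deriv p₁ t =
      (c₀ t + m * κ - m * e₁ t) * p₁ t + γ * ((t - t₀) * r₁ t) := by
    have h1 := operator_eq (b := fun t => c₀ t + m * κ) hξ hp₁ hpp
    have hp₁' := hp₁.deriv
    have han : AnalyticAt ℂ (fun t => e₁ t * (m * p₁ t + (t - t₀) * deriv p₁ t)
        - (c₀ t + m * κ) * p₁ t - γ * ((t - t₀) * r₁ t)) t₀ := by fun_prop
    have h2 := eventually_eq_zero_of_pow_mul m han.continuousAt (by
      filter_upwards [h1, hpT, hrr] with t h1 h2 h3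
      rw [h2, h3] at h1
      rw [mul_sub, ← h1]
      ring)
    filter_upwards [h2, hξ] with t h3 h4
    rw [h4]
    linear_combination h3
  -- The choice makes `p = s₀ H^m` and `r = s₀ H^(m+1)`, the two top monomials of the model. It has
  -- `H(t₀) = 0`, `H'(t₀) ≠ 0` and `s₀(t₀) ≠ 0`, and the equations for `p` and `r` determine `ξ H'`
  -- and `ξ s₀'`.
  set h₁ : ℂ → ℂ := fun t => r₁ t / p₁ t with hh₁
  set H : ℂ → ℂ := fun t => (t - t₀) * h₁ t with hH
  set s₀ : ℂ → ℂ := fun t => p₁ t ^ (m + 1) / r₁ t ^ m with hs₀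
  have hh₁an : AnalyticAt ℂ h₁ t₀ := hr₁.div hp₁ hp₁0
  have hh₁0 : h₁ t₀ ≠ 0 := div_ne_zero hr₁0 hp₁0
  have hHan : AnalyticAt ℂ H t₀ := by fun_prop
  have hs₀an : AnalyticAt ℂ s₀ t₀ := (hp₁.pow _).div (hr₁.pow _) (pow_ne_zero _ hr₁0)
  have hs₀0 : s₀ t₀ ≠ 0 := div_ne_zero (pow_ne_zero _ hp₁0) (pow_ne_zero _ hr₁0)
  have hne' : ∀ᶠ t in 𝓝 t₀, r₁ t ≠ 0 ∧ p₁ t ≠ 0 :=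
    (hr₁.continuousAt.eventually_ne hr₁0).and (hp₁.continuousAt.eventually_ne hp₁0)
  have han' : ∀ᶠ t in 𝓝 t₀, AnalyticAt ℂ r₁ t ∧ AnalyticAt ℂ p₁ t :=
    hr₁.eventually_analyticAt.and hp₁.eventually_analyticAt
  have hHT : ∀ᶠ t in 𝓝 t₀, ξ t * deriv H t = κ * H t - γ * H t ^ 2 := by
    filter_upwards [hne', han', hr₁T, hp₁T, hξ] with t h1 h2 h3 h4 h5
    have h6 := (((hasDerivAt_id t).sub_const t₀).fun_mul
      (h2.1.differentiableAt.hasDerivAt.fun_div h2.2.differentiableAt.hasDerivAt h1.2)).deriv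
    have h7 : deriv H t = _ := h6
    rw [h7]
    simp only [hH, hh₁, id]
    have hp := h1.2
    field_simp
    linear_combination (t - t₀) * p₁ t * h3 - (t - t₀) * r₁ t * h4 + r₁ t * p₁ t * h5
  have hs₀T : ∀ᶠ t in 𝓝 t₀, ξ t * deriv s₀ t = (c₀ t + (m + 1) * γ * H t) * s₀ t := by
    filter_upwards [hne', han', hr₁T, hp₁T, hξ] with t h1 h2 h3 h4 h5
    have h6 := ((h2.2.differentiableAt.hasDerivAt.fun_pow (m + 1)).fun_div
      (h2.1.differentiableAt.hasDerivAt.fun_pow m) (pow_ne_zero m h1.1)).deriv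
    have h7 : deriv s₀ t * (r₁ t * p₁ t)
        = s₀ t * ((m + 1) * deriv p₁ t * r₁ t - m * deriv r₁ t * p₁ t) := by
      rw [show deriv s₀ t = _ from h6]
      simp only [hs₀]
      have h8 := h1.1
      rcases m with _ | m
      · simp
        ring
      · field_simp
        push_cast
        ring
    refine mul_right_cancel₀ (mul_ne_zero h1.1 h1.2) ?_
    have h9 : H t * p₁ t = (t - t₀) * r₁ t := by
      simp only [hH, hh₁]
      have := h1.2
      field_simp
    linear_combination ξ t * h7 + s₀ t * (m + 1) * r₁ t * h4 - s₀ t * m * p₁ t * h3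
      - (m + 1) * γ * r₁ t * s₀ t * h9
  have hTpoly : ∀ (i : ℕ) (F : ℂ[X]), ∀ᶠ t in 𝓝 t₀,
      ξ t * deriv (polyFun s₀ H F) t - (c₀ t + i * κ) * polyFun s₀ H F t =
        polyFun s₀ H ((C κ * X - C γ * X ^ 2) * derivative F
          + (C ((m + 1) * γ) * X - C (i * κ)) * F) t := by
    intro i F
    filter_upwards [hHT, hs₀T, hs₀an.eventually_analyticAt, hHan.eventually_analyticAt]
      with t h1 h2 h3 h4
    rw [(hasDerivAt_polyFun h3 h4 F).deriv]
    simp only [polyFun, eval_add, eval_mul, eval_sub, eval_C, eval_pow, eval_X]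
    linear_combination F.eval (H t) * h2 + s₀ t * (derivative F).eval (H t) * h1
  -- Descending induction on `i`, with `d` the distance to `n`: `T_i` maps a difference of the given
  -- kind to one for `i + 1`, which vanishes. It is injective on functions of order at least `n`, so
  -- the original difference vanishes too.
  have hflag : ∀ d i : ℕ, i + d = m + 2 → ∀ (s : ℂ → ℂ) (F : ℂ[X]), IsSol a t₀ s →
      (i : ℕ∞) ≤ analyticOrderAt s t₀ → (∀ k, k < i ∨ m + 2 ≤ k → F.coeff k = 0) →
      ((m + 2 : ℕ) : ℕ∞) ≤ analyticOrderAt (fun t => s t - polyFun s₀ H F t) t₀ →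
      ∀ᶠ t in 𝓝 t₀, s t - polyFun s₀ H F t = 0 := by
    intro d
    induction d with
    | zero =>
      intro i hi s F hs hso hF _
      obtain rfl : i = m + 2 := hi
      have hF0 : F = 0 := by
        ext k
        exact hF k (by omega)
      filter_upwards [hs.eventually_eq_zero ha hso] with t ht
      simp [hF0, polyFun, ht]
    | succ d ih =>
      intro i hi s F hs hso hF hord
      have hPan := analyticAt_polyFun hs₀an hHan F
      have hdan : AnalyticAt ℂ (fun t => s t - polyFun s₀ H F t) t₀ := hs.analyticAt.sub hPan
      set G := (C κ * X - C γ * X ^ 2) * derivative F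
          + (C ((m + 1) * γ) * X - C (i * κ)) * F with hG
      -- The lowest coefficient is multiplied by `(i - i) κ`. The coefficient of `X^(m+2)` receives
      -- `(m + 1) γ - (m + 1) γ`, so degree less than `n` is preserved.
      have hGc : ∀ k, k < i + 1 ∨ m + 2 ≤ k → G.coeff k = 0 := by
        have e0 : G.coeff 0 = -(i * κ) * F.coeff 0 := by
          simp [hG, mul_coeff_zero]
        have e1 : ∀ k : ℕ, G.coeff (k + 1)
            = ((k + 1 : ℕ) - i) * κ * F.coeff (k + 1) + ((m + 1) - k) * γ * F.coeff k := by
          intro k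
          have c1 : ((C κ * X - C γ * X ^ 2) * derivative F).coeff (k + 1)
              = κ * ((k + 1) * F.coeff (k + 1)) - γ * (k * F.coeff k) := by
            rw [sub_mul, coeff_sub, mul_assoc, mul_assoc, coeff_C_mul, coeff_C_mul,
              coeff_X_mul, coeff_derivative]
            rcases k with _ | k
            · simp [pow_two, mul_assoc, mul_coeff_zero, mul_comm]
            · rw [coeff_X_pow_mul' , if_pos (by omega), show k + 1 + 1 - 2 = k by omega,
                coeff_derivative]
              push_cast
              ring
          have c2 : ((C ((m + 1) * γ) * X - C (i * κ)) * F).coeff (k + 1)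
              = (m + 1) * γ * F.coeff k - i * κ * F.coeff (k + 1) := by
            rw [sub_mul, coeff_sub, mul_assoc, coeff_C_mul, coeff_C_mul, coeff_X_mul]
          rw [hG, coeff_add, c1, c2]
          push_cast
          ring
        intro k hk
        rcases k with _ | k
        · rw [e0]
          rcases Nat.eq_zero_or_pos i with h0 | h0
          · simp [h0]
          · rw [hF 0 (by omega), mul_zero]
        · rw [e1]
          rcases hk with hk | hk
          · rw [hF k (by omega)]
            rcases Nat.lt_or_ge (k + 1) i with h1 | h1
            · rw [hF (k + 1) (by omega)]; simp
            · obtain rfl : i = k + 1 := by omega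
              simp
          · rw [hF (k + 1) (by omega)]
            rcases Nat.lt_or_ge k (m + 2) with h1 | h1
            · obtain rfl : k = m + 1 := by omega
              simp
            · rw [hF k (by omega)]; simp
      have hTd : ∀ᶠ t in 𝓝 t₀,
          ξ t * deriv (fun t => s t - polyFun s₀ H F t) t
            - (c₀ t + i * κ) * (s t - polyFun s₀ H F t)
          = (ξ t * deriv s t - (c₀ t + i * κ) * s t) - polyFun s₀ H G t := by
        filter_upwards [hTpoly i F, hs.analyticAt.eventually_analyticAt,
          hPan.eventually_analyticAt] with t h1 h2 h3
        rw [deriv_fun_sub h2.differentiableAt h3.differentiableAt, ← h1]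
        ring
      have hz := ih (i + 1) (by omega) _ G (hTsol i s hs) (hTord i s hs.analyticAt hso) hGc (by
        rw [← analyticOrderAt_congr hTd]
        exact le_order_operator hξ he₁ (hban i) hdan hord)
      refine eventually_eq_zero_of_operator_eq_zero (m₁ := m + 1) (i := i) hξ he₁ hne hc₀an hc₀0
        hr.analyticAt hro hrT (by omega) hdan hord ?_
      filter_upwards [hTd, hz] with t h1 h2
      rw [h1, h2]
  have hpoly_sol : ∀ F : ℂ[X], (∀ k ≥ m + 2, F.coeff k = 0) → IsSol a t₀ (polyFun s₀ H F) := by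
    intro F hF
    have hPan := analyticAt_polyFun hs₀an hHan F
    obtain ⟨s, hs, hs'⟩ := IsSol.exists_iteratedDeriv_eq (by omega) ha
      (fun k : Fin (m + 2) => iteratedDeriv k (polyFun s₀ H F) t₀)
    -- The solution with the same initial values as `s₀ F(H)` agrees with it to order `n`, hence
    -- equals it.
    have hz := hflag (m + 2) 0 (by omega) s F hs (by simp) (fun k hk => hF k (by omega)) (by
      rw [natCast_le_analyticOrderAt_iff_iteratedDeriv_eq_zero (hs.analyticAt.fun_sub hPan)]
      intro i hi
      have h1 := hs' ⟨i, hi⟩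
      rw [iteratedDeriv_fun_sub hs.analyticAt.contDiffAt hPan.contDiffAt, h1, sub_self])
    exact hs.congr (hz.mono fun t ht => sub_eq_zero.1 ht)
  have hsol_poly : ∀ s, IsSol a t₀ s → ∃ F : ℂ[X], (∀ k ≥ m + 2, F.coeff k = 0) ∧
      s =ᶠ[𝓝 t₀] polyFun s₀ H F := by
    intro s hs
    obtain ⟨F, hF, hord⟩ := exists_polyFun hs₀an hs₀0 hh₁an hh₁0 (fun _ => rfl) hs.analyticAt
      (m + 2)
    exact ⟨F, hF, (hflag (m + 2) 0 (by omega) s F hs (by simp) (fun k hk => hF k (by omega))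
      hord).mono fun t ht => sub_eq_zero.1 ht⟩
  have hH' : deriv H t₀ = h₁ t₀ := by
    have := (((hasDerivAt_id t₀).sub_const t₀).fun_mul
      hh₁an.differentiableAt.hasDerivAt).deriv
    simpa using this
  have hH'0 : deriv H t₀ ≠ 0 := by rwa [hH']
  -- This is `d/dH` conjugated by `s₀`; it sends `s₀ F(H)` to `s₀ F'(H)`, so it preserves the
  -- solutions.
  refine ⟨fun t => (deriv H t)⁻¹, fun t => (deriv H t)⁻¹ * deriv s₀ t / s₀ t, ⟨?_, ?_, IsSol.zero,
    ?_⟩, inv_ne_zero hH'0⟩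
  · exact hHan.deriv.inv hH'0
  · exact ((hHan.deriv.inv hH'0).mul hs₀an.deriv).div hs₀an hs₀0
  · intro s hs
    obtain ⟨F, hF, hsF⟩ := hsol_poly s hs
    refine (hpoly_sol (derivative F) ?_).congr ?_
    · intro k hk
      rw [coeff_derivative, hF (k + 1) (by omega), zero_mul]
    · filter_upwards [hsF.eventually_nhds, hs₀an.eventually_analyticAt,
        hHan.eventually_analyticAt, hs₀an.continuousAt.eventually_ne hs₀0,
        hHan.deriv.continuousAt.eventually_ne hH'0] with t h1 h2 h3 h4 h5
      have h1' : s =ᶠ[𝓝 t] polyFun s₀ H F := h1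
      rw [h1'.deriv_eq, h1'.eq_of_nhds, (hasDerivAt_polyFun h2 h3 F).deriv]
      simp only [polyFun]
      field_simp
      ring

end ODESymm
end
noncomputable section

open Filter Topology Polynomial VectorField
open scoped ContDiff

namespace ODESymm

variable {n : ℕ}

/-! Symmetries in the linearizing coordinates -/

theorem fderiv_affineField {ξ c e : ℂ → ℂ} {p : ℂ × ℂ} (hξ : AnalyticAt ℂ ξ p.1)
    (hc : AnalyticAt ℂ c p.1) (he : AnalyticAt ℂ e p.1) (x : ℂ × ℂ) :
    fderiv ℂ (affineField ξ c e) p x =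
      (deriv ξ p.1 * x.1, (deriv c p.1 * p.2 + deriv e p.1) * x.1 + c p.1 * x.2) := by
  have h1 : HasFDerivAt (fun z : ℂ × ℂ => ξ z.1) (deriv ξ p.1 • ContinuousLinearMap.fst ℂ ℂ ℂ) p :=
    HasDerivAt.comp_hasFDerivAt p (f := Prod.fst) hξ.differentiableAt.hasDerivAt hasFDerivAt_fst
  have h2 : HasFDerivAt (fun z : ℂ × ℂ => c z.1) (deriv c p.1 • ContinuousLinearMap.fst ℂ ℂ ℂ) p :=
    HasDerivAt.comp_hasFDerivAt p (f := Prod.fst) hc.differentiableAt.hasDerivAt hasFDerivAt_fst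
  have h3 : HasFDerivAt (fun z : ℂ × ℂ => e z.1) (deriv e p.1 • ContinuousLinearMap.fst ℂ ℂ ℂ) p :=
    HasDerivAt.comp_hasFDerivAt p (f := Prod.fst) he.differentiableAt.hasDerivAt hasFDerivAt_fst
  have h4 : HasFDerivAt (affineField ξ c e) _ p :=
    h1.prodMk ((h2.mul hasFDerivAt_snd).add h3)
  rw [h4.fderiv]
  simp only [ContinuousLinearMap.prod_apply, add_apply, smul_apply,
    ContinuousLinearMap.coe_fst', ContinuousLinearMap.coe_snd', smul_eq_mul, Prod.mk.injEq,
    true_and]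
  ring

theorem lieBracket_affineField {ξ₁ c₁ e₁ ξ₂ c₂ e₂ : ℂ → ℂ} {p : ℂ × ℂ}
    (hξ₁ : AnalyticAt ℂ ξ₁ p.1) (hc₁ : AnalyticAt ℂ c₁ p.1) (he₁ : AnalyticAt ℂ e₁ p.1)
    (hξ₂ : AnalyticAt ℂ ξ₂ p.1) (hc₂ : AnalyticAt ℂ c₂ p.1) (he₂ : AnalyticAt ℂ e₂ p.1) :
    lieBracket ℂ (affineField ξ₁ c₁ e₁) (affineField ξ₂ c₂ e₂) p =
      affineField (fun t => ξ₁ t * deriv ξ₂ t - ξ₂ t * deriv ξ₁ t)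
        (fun t => ξ₁ t * deriv c₂ t - ξ₂ t * deriv c₁ t)
        (fun t => ξ₁ t * deriv e₂ t - ξ₂ t * deriv e₁ t + c₂ t * e₁ t - c₁ t * e₂ t) p := by
  simp only [lieBracket_eq]
  rw [fderiv_affineField hξ₁ hc₁ he₁, fderiv_affineField hξ₂ hc₂ he₂]
  simp only [affineField, Prod.mk_sub_mk, Prod.mk.injEq]
  constructor <;> ring

theorem isInvertible_of_det_ne_zero {A : ℂ × ℂ →L[ℂ] ℂ × ℂ} (h : A.det ≠ 0) : A.IsInvertible :=
  ⟨A.toContinuousLinearEquivOfDetNeZero h, A.coe_toContinuousLinearEquivOfDetNeZero h⟩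

theorem analyticAt_pullback {Φ w : ℂ × ℂ → ℂ × ℂ} {z : ℂ × ℂ} (hΦ : AnalyticAt ℂ Φ z)
    (hdet : (fderiv ℂ Φ z).det ≠ 0) (hw : AnalyticAt ℂ w (Φ z)) :
    AnalyticAt ℂ (pullback ℂ Φ w) z := by
  have h1 : ContDiffAt ℂ ω (fun z => (fderiv ℂ Φ z).inverse) z := by
    have h2 := contDiffAt_map_inverse (n := ω) (𝕜 := ℂ)
      ((fderiv ℂ Φ z).toContinuousLinearEquivOfDetNeZero hdet)
    rw [ContinuousLinearMap.coe_toContinuousLinearEquivOfDetNeZero] at h2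
    exact h2.comp z hΦ.fderiv.contDiffAt
  exact (h1.clm_apply (hw.comp hΦ).contDiffAt).analyticAt

/-- The germ `V` is the vector field `ξ ∂_t + (c u + e) ∂_u` in the coordinates `(t, u) = Φ`. -/
def Represents (Φ : ℂ × ℂ → ℂ × ℂ) {z₀ : ℂ × ℂ} (V : VFGerm z₀) (ξ c e : ℂ → ℂ) : Prop :=
  ∃ hv : AnalyticAt ℂ (pullback ℂ Φ (affineField ξ c e)) z₀, V = VFGerm.mk _ hv

variable {q : RationalODE n} {z₀ : ℂ × ℂ} {a : Fin n → ℂ → ℂ} {Φ : ℂ × ℂ → ℂ × ℂ}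
  {V V' : VFGerm z₀} {ξ c e ξ' c' e' : ℂ → ℂ}

namespace Represents

theorem add (h : Represents Φ V ξ c e) (h' : Represents Φ V' ξ' c' e') :
    Represents Φ (V + V') (fun t => ξ t + ξ' t) (fun t => c t + c' t) (fun t => e t + e' t) := by
  obtain ⟨hv, rfl⟩ := h
  obtain ⟨hv', rfl⟩ := h'
  have h1 : pullback ℂ Φ (affineField ξ c e) + pullback ℂ Φ (affineField ξ' c' e') =
      pullback ℂ Φ (affineField (fun t => ξ t + ξ' t) (fun t => c t + c' t)
        (fun t => e t + e' t)) := by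
    ext1 z
    simp only [pullback, Pi.add_apply, ← map_add]
    congr 1
    simp only [affineField, Prod.mk_add_mk, Prod.mk.injEq, true_and]
    ring
  exact ⟨h1 ▸ hv.add hv', by rw [VFGerm.mk_add, VFGerm.mk_eq_mk, h1]⟩

theorem smul (k : ℂ) (h : Represents Φ V ξ c e) :
    Represents Φ (k • V) (fun t => k * ξ t) (fun t => k * c t) (fun t => k * e t) := by
  obtain ⟨hv, rfl⟩ := h
  have h1 : k • pullback ℂ Φ (affineField ξ c e) =
      pullback ℂ Φ (affineField (fun t => k * ξ t) (fun t => k * c t) (fun t => k * e t)) := by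
    ext1 z
    simp only [pullback, Pi.smul_apply, ← map_smul]
    congr 1
    simp only [affineField, Prod.smul_mk, Prod.mk.injEq, smul_eq_mul, true_and]
    ring
  exact ⟨h1 ▸ hv.const_smul, by rw [VFGerm.mk_smul, VFGerm.mk_eq_mk, h1]⟩

theorem sub (h : Represents Φ V ξ c e) (h' : Represents Φ V' ξ' c' e') :
    Represents Φ (V - V') (fun t => ξ t - ξ' t) (fun t => c t - c' t) (fun t => e t - e' t) := by
  have h1 := h.add (h'.smul (-1))
  simpa only [neg_smul, one_smul, neg_one_mul, ← sub_eq_add_neg] using h1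

theorem congr (hΦ : ContinuousAt Φ z₀) (h : Represents Φ V ξ c e)
    (hξ : ξ =ᶠ[𝓝 (Φ z₀).1] ξ') (hc : c =ᶠ[𝓝 (Φ z₀).1] c') (he : e =ᶠ[𝓝 (Φ z₀).1] e') :
    Represents Φ V ξ' c' e' := by
  obtain ⟨hv, rfl⟩ := h
  have h1 : pullback ℂ Φ (affineField ξ c e) =ᶠ[𝓝 z₀] pullback ℂ Φ (affineField ξ' c' e') := by
    filter_upwards [hΦ.fst.eventually (hξ.and (hc.and he))] with z hz
    simp only [pullback, affineField, hz.1, hz.2.1, hz.2.2]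
  exact ⟨hv.congr h1, VFGerm.mk_eq_mk.2 h1⟩

theorem unique (h : Represents Φ V ξ c e) (h' : Represents Φ V' ξ c e) : V = V' := by
  obtain ⟨hv, rfl⟩ := h
  obtain ⟨hv', rfl⟩ := h'
  rfl

end Represents

namespace IsLinearization

theorem pullback_eq_iff (h : IsLinearization q z₀ a Φ) (v w : ℂ × ℂ → ℂ × ℂ) :
    pullback ℂ Φ w z₀ = v z₀ ↔ fderiv ℂ Φ z₀ (v z₀) = w (Φ z₀) := by
  have h1 := fderiv_pullback (𝕜 := ℂ) Φ w z₀ (isInvertible_of_det_ne_zero h.det_ne_zero)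
  constructor
  · intro h2
    rw [← h2, h1]
  · intro h2
    exact h.injective (h1.trans h2.symm)

theorem map_nhds (h : IsLinearization q z₀ a Φ) : map Φ (𝓝 z₀) = 𝓝 (Φ z₀) := by
  have h1 : HasStrictFDerivAt Φ (((fderiv ℂ Φ z₀).toContinuousLinearEquivOfDetNeZero
      h.det_ne_zero : (ℂ × ℂ) ≃L[ℂ] ℂ × ℂ) : ℂ × ℂ →L[ℂ] ℂ × ℂ) z₀ := by
    rw [ContinuousLinearMap.coe_toContinuousLinearEquivOfDetNeZero]
    exact h.analyticAt.hasStrictFDerivAt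
  exact h1.map_nhds_eq_of_equiv

/-- The image of `Φ` contains a neighbourhood, so for fixed `t` the component `c u + e` vanishes at
two values of `u`, and both coefficients are zero. This makes the representing germs unique. -/
theorem eventually_eq_zero_of_represents (h : IsLinearization q z₀ a Φ)
    (hr : Represents Φ (0 : VFGerm z₀) ξ c e) :
    ∀ᶠ t in 𝓝 (Φ z₀).1, ξ t = 0 ∧ c t = 0 ∧ e t = 0 := by
  obtain ⟨hv, h1⟩ := hr
  rw [VFGerm.zero_eq, VFGerm.mk_eq_mk] at h1
  have h2 : ∀ᶠ z in 𝓝 z₀, affineField ξ c e (Φ z) = 0 := by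
    filter_upwards [h1, h.eventually] with z hz h
    rw [← (h.pullback_eq_iff 0 _).1 hz.symm, Pi.zero_apply, map_zero]
  rw [← eventually_map (P := fun p => affineField ξ c e p = 0), h.map_nhds] at h2
  have h3 : Tendsto (fun t => (t, (Φ z₀).2)) (𝓝 (Φ z₀).1) (𝓝 (Φ z₀)) :=
    (continuous_id.prodMk continuous_const).tendsto _
  filter_upwards [h3.eventually h2.eventually_nhds] with t ht
  have h4 := ht.self_of_nhds
  have h5 : Tendsto (fun u : ℂ => (t, u)) (𝓝 (Φ z₀).2) (𝓝 (t, (Φ z₀).2)) :=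
    (continuous_const.prodMk continuous_id).tendsto _
  have h6 := h5.eventually ht
  obtain ⟨u, hu, hu'⟩ := ((h6.filter_mono nhdsWithin_le_nhds).and
    (self_mem_nhdsWithin : {(Φ z₀).2}ᶜ ∈ 𝓝[≠] (Φ z₀).2)).exists
  simp only [affineField, Prod.mk_eq_zero] at h4 hu
  have h7 : c t * (u - (Φ z₀).2) = 0 := by linear_combination hu.2 - h4.2
  have h8 := (mul_eq_zero.1 h7).resolve_right (sub_ne_zero.2 hu')
  exact ⟨h4.1, h8, by simpa [h8] using h4.2⟩

theorem eventuallyEq_of_represents (h : IsLinearization q z₀ a Φ)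
    (hr : Represents Φ V ξ c e) (hr' : Represents Φ V ξ' c' e') :
    ξ =ᶠ[𝓝 (Φ z₀).1] ξ' ∧ c =ᶠ[𝓝 (Φ z₀).1] c' ∧ e =ᶠ[𝓝 (Φ z₀).1] e' := by
  have h1 := hr.sub hr'
  rw [sub_self] at h1
  have h2 := h.eventually_eq_zero_of_represents h1
  exact ⟨h2.mono fun t ht => sub_eq_zero.1 ht.1, h2.mono fun t ht => sub_eq_zero.1 ht.2.1,
    h2.mono fun t ht => sub_eq_zero.1 ht.2.2⟩

/-- The field is pushed forward by a local inverse of `Φ`, where the classification of symmetries of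
the linear equation applies. -/
theorem exists_represents (hn : 3 ≤ n) (h : IsLinearization q z₀ a Φ)
    (X : q.symmetryAlgebra z₀) :
    ∃ ξ c e, IsLinSym a (Φ z₀).1 ξ c e ∧ Represents Φ (X : VFGerm z₀) ξ c e := by
  obtain ⟨_, v, hv, rfl, hs⟩ := X
  have h1 : HasStrictFDerivAt Φ (((fderiv ℂ Φ z₀).toContinuousLinearEquivOfDetNeZero
      h.det_ne_zero : (ℂ × ℂ) ≃L[ℂ] ℂ × ℂ) : ℂ × ℂ →L[ℂ] ℂ × ℂ) z₀ := by
    rw [ContinuousLinearMap.coe_toContinuousLinearEquivOfDetNeZero]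
    exact h.analyticAt.hasStrictFDerivAt
  set Θ := ContDiffAt.localInverse h.analyticAt.contDiffAt h1.hasFDerivAt
    (by simp : (ω : WithTop ℕ∞) ≠ 0) with hΘdef
  have hΘ : AnalyticAt ℂ Θ (Φ z₀) :=
    (ContDiffAt.to_localInverse h.analyticAt.contDiffAt h1.hasFDerivAt (by simp)).analyticAt
  have hinv : ∀ᶠ z in 𝓝 z₀, Θ (Φ z) = z :=
    h1.eventually_left_inverse
  have hz : Θ (Φ z₀) = z₀ := hinv.self_of_nhds
  set w : ℂ × ℂ → ℂ × ℂ := fun p => fderiv ℂ Φ (Θ p) (v (Θ p)) with hw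
  have hwan : AnalyticAt ℂ w (Φ z₀) := by
    have h2 : AnalyticAt ℂ (fun z => fderiv ℂ Φ z (v z)) (Θ (Φ z₀)) := by
      rw [hz]
      exact (h.analyticAt.fderiv.contDiffAt.clm_apply hv.contDiffAt).analyticAt
    exact h2.comp hΘ
  have hvw : ∀ᶠ z in 𝓝 z₀, fderiv ℂ Φ z (v z) = w (Φ z) :=
    hinv.mono fun z hz => by simp only [hw, hz]
  obtain ⟨ξ, c, e, hsym, hwe⟩ :=
    (h.isLinSymmetryNear (by omega) hv hwan hvw hs).exists_isLinSym hn hwan h.coeff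
  have h3 : v =ᶠ[𝓝 z₀] pullback ℂ Φ (affineField ξ c e) := by
    filter_upwards [hvw, h.analyticAt.continuousAt.eventually hwe, h.eventually] with z h1 h2 h
    exact ((h.pullback_eq_iff v _).2 (h1.trans h2)).symm
  exact ⟨ξ, c, e, hsym, hv.congr h3, (VFGerm.mk_eq_mk (hv := hv)).2 h3⟩

theorem exists_mem_represents (hn : 3 ≤ n) (h : IsLinearization q z₀ a Φ)
    (hs : IsLinSym a (Φ z₀).1 ξ c e) :
    ∃ X : q.symmetryAlgebra z₀, Represents Φ (X : VFGerm z₀) ξ c e := by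
  have hw := analyticAt_affineField hs.analyticAt_fst hs.analyticAt_coeff hs.isSol.analyticAt
  have hv := analyticAt_pullback h.analyticAt h.det_ne_zero hw
  have hvw : ∀ᶠ z in 𝓝 z₀, fderiv ℂ Φ z (pullback ℂ Φ (affineField ξ c e) z) =
      affineField ξ c e (Φ z) :=
    h.eventually.mono fun z hz => (hz.pullback_eq_iff _ _).1 rfl
  exact ⟨⟨VFGerm.mk _ hv, _, hv, rfl, h.isSymmetryNear (by omega) hv hw hvw
    (hs.isLinSymmetryNear (by omega) h.coeff)⟩, hv, rfl⟩

theorem represents_lie (h : IsLinearization q z₀ a Φ)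
    (hr : Represents Φ V ξ c e) (hr' : Represents Φ V' ξ' c' e')
    (hξ : AnalyticAt ℂ ξ (Φ z₀).1) (hc : AnalyticAt ℂ c (Φ z₀).1) (he : AnalyticAt ℂ e (Φ z₀).1)
    (hξ' : AnalyticAt ℂ ξ' (Φ z₀).1) (hc' : AnalyticAt ℂ c' (Φ z₀).1)
    (he' : AnalyticAt ℂ e' (Φ z₀).1) :
    Represents Φ ⁅V, V'⁆ (fun t => ξ t * deriv ξ' t - ξ' t * deriv ξ t)
      (fun t => ξ t * deriv c' t - ξ' t * deriv c t)
      (fun t => ξ t * deriv e' t - ξ' t * deriv e t + c' t * e t - c t * e' t) := by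
  obtain ⟨hv, rfl⟩ := hr
  obtain ⟨hv', rfl⟩ := hr'
  have hd : ∀ᶠ t in 𝓝 (Φ z₀).1, (AnalyticAt ℂ ξ t ∧ AnalyticAt ℂ c t ∧ AnalyticAt ℂ e t) ∧
      AnalyticAt ℂ ξ' t ∧ AnalyticAt ℂ c' t ∧ AnalyticAt ℂ e' t :=
    (hξ.eventually_analyticAt.and (hc.eventually_analyticAt.and he.eventually_analyticAt)).and
      (hξ'.eventually_analyticAt.and (hc'.eventually_analyticAt.and he'.eventually_analyticAt))
  have h1 : lieBracket ℂ (pullback ℂ Φ (affineField ξ c e))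
      (pullback ℂ Φ (affineField ξ' c' e')) =ᶠ[𝓝 z₀]
      pullback ℂ Φ (affineField (fun t => ξ t * deriv ξ' t - ξ' t * deriv ξ t)
        (fun t => ξ t * deriv c' t - ξ' t * deriv c t)
        (fun t => ξ t * deriv e' t - ξ' t * deriv e t + c' t * e t - c t * e' t)) := by
    filter_upwards [h.analyticAt.eventually_analyticAt,
      h.analyticAt.continuousAt.fst.eventually hd] with z h1 h2
    obtain ⟨⟨a1, a2, a3⟩, b1, b2, b3⟩ := h2
    rw [← pullback_lieBracket (n := ω) (by simp) h1.contDiffAt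
      (analyticAt_affineField a1 a2 a3).differentiableAt
      (analyticAt_affineField b1 b2 b3).differentiableAt]
    simp only [pullback]
    rw [lieBracket_affineField a1 a2 a3 b1 b2 b3]
  exact ⟨(VFGerm.analyticAt_lieBracket hv hv').congr h1, by
    rw [VFGerm.mk_bracket, VFGerm.mk_eq_mk]; exact h1⟩

end IsLinearization
end ODESymm
end
noncomputable section

open Filter Topology Polynomial VectorField
open scoped ContDiff

namespace ODESymm

variable {n : ℕ} {q : RationalODE n} {z₀ : ℂ × ℂ} {a : Fin n → ℂ → ℂ} {Φ : ℂ × ℂ → ℂ × ℂ}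

/-! The structure of the symmetry algebra -/

/-- With `ξ = 0`, multiplication by `c` preserves solutions. Applied to `r` of order `n - 1`, the
product `(c(t₀) - c) r` is a solution of order at least `n`, hence zero. -/
theorem IsLinSym.eventually_coeff_eq (hn : 2 ≤ n) {t₀ : ℂ} {ξ c e : ℂ → ℂ}
    (h : IsLinSym a t₀ ξ c e) (ha : ∀ k, AnalyticAt ℂ (a k) t₀) (hξ : ∀ᶠ t in 𝓝 t₀, ξ t = 0) :
    ∀ᶠ t in 𝓝 t₀, c t = c t₀ := by
  obtain ⟨r, hr, hro⟩ := IsSol.exists_order_eq ha (show n - 1 < n by omega)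
  have hc := h.analyticAt_coeff
  have h1 : IsSol a t₀ fun t => (c t₀ - c t) * r t :=
    ((hr.const_mul (c t₀)).add (h.isSol_map r hr)).congr (hξ.mono fun t ht => by
      simp only [ht]; ring)
  have hd : AnalyticAt ℂ (fun t => c t₀ - c t) t₀ := analyticAt_const.fun_sub hc
  have h2 : (n : ℕ∞) ≤ analyticOrderAt (fun t => (c t₀ - c t) * r t) t₀ := by
    rw [show (fun t => (c t₀ - c t) * r t) = (fun t => c t₀ - c t) * r from rfl,
      analyticOrderAt_mul hd hr.analyticAt, hro]
    have h3 : (1 : ℕ∞) ≤ analyticOrderAt (fun t => c t₀ - c t) t₀ := by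
      rw [Order.one_le_iff_ne_zero, hd.analyticOrderAt_ne_zero, sub_self]
    calc (n : ℕ∞) = 1 + ((n - 1 : ℕ) : ℕ∞) := by
          rw [← Nat.cast_one, ← Nat.cast_add]; congr 1; omega
      _ ≤ _ := by gcongr
  have h3 := h1.eventually_eq_zero ha h2
  have h4 : ∀ᶠ t in 𝓝[≠] t₀, r t ≠ 0 := by
    refine hr.analyticAt.eventually_eq_zero_or_eventually_ne_zero.resolve_left fun h5 => ?_
    rw [← analyticOrderAt_eq_top, hro] at h5
    exact ENat.natCast_ne_top _ h5
  have h5 : ∀ᶠ t in 𝓝 t₀, c t₀ - c t = 0 := by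
    refine eventually_eq_zero_of_punctured hd.continuousAt ?_
    filter_upwards [h4, h3.filter_mono nhdsWithin_le_nhds] with t h6 h7
    exact (mul_eq_zero.1 h7).resolve_right h6
  exact h5.mono fun t ht => (sub_eq_zero.1 ht).symm

theorem IsLinSym.of_isSol {t₀ : ℂ} {s : ℂ → ℂ} (hs : IsSol a t₀ s) :
    IsLinSym a t₀ (fun _ => 0) (fun _ => 0) s :=
  ⟨analyticAt_const, analyticAt_const, hs, fun _ _ =>
    IsSol.zero.congr (Eventually.of_forall fun t => by simp)⟩

theorem IsLinSym.const_coeff (t₀ k : ℂ) :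
    IsLinSym a t₀ (fun _ => 0) (fun _ => k) fun _ => 0 :=
  ⟨analyticAt_const, analyticAt_const, IsSol.zero, fun _ hs =>
    (hs.const_mul (-k)).congr (Eventually.of_forall fun t => by simp)⟩

theorem Represents.zero (Φ : ℂ × ℂ → ℂ × ℂ) (z₀ : ℂ × ℂ) :
    Represents Φ (0 : VFGerm z₀) (fun _ => 0) (fun _ => 0) (fun _ => 0) := by
  have h1 : pullback ℂ Φ (affineField (fun _ => 0) (fun _ => 0) (fun _ => 0)) = 0 := by
    ext1 z
    have : affineField (fun _ => 0) (fun _ => 0) (fun _ => 0) (Φ z) = 0 := by simp [affineField]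
    simp only [pullback, this, map_zero, Pi.zero_apply]
  exact ⟨h1 ▸ analyticAt_const, by rw [VFGerm.zero_eq, VFGerm.mk_eq_mk, h1]⟩

/-- The symmetries `s(t) ∂_u` with a solution `s`. -/
def translations (q : RationalODE n) (z₀ : ℂ × ℂ) (a : Fin n → ℂ → ℂ) (Φ : ℂ × ℂ → ℂ × ℂ) :
    Submodule ℂ (q.symmetryAlgebra z₀) where
  carrier := {X | ∃ s, IsSol a (Φ z₀).1 s ∧
    Represents Φ (X : VFGerm z₀) (fun _ => 0) (fun _ => 0) s}
  zero_mem' := ⟨_, IsSol.zero, Represents.zero Φ z₀⟩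
  add_mem' := by
    rintro X Y ⟨s, hs, hX⟩ ⟨r, hr, hY⟩
    exact ⟨_, hs.add hr, by simpa using hX.add hY⟩
  smul_mem' := by
    rintro k X ⟨s, hs, hX⟩
    exact ⟨_, hs.const_mul k, by simpa using hX.smul k⟩

namespace IsLinearization

theorem exists_mem_translations (hn : 3 ≤ n) (h : IsLinearization q z₀ a Φ) {s : ℂ → ℂ}
    (hs : IsSol a (Φ z₀).1 s) : ∃ X : translations q z₀ a Φ,
      Represents Φ ((X : q.symmetryAlgebra z₀) : VFGerm z₀) (fun _ => 0) (fun _ => 0) s := by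
  obtain ⟨X, hX⟩ := h.exists_mem_represents hn (IsLinSym.of_isSol hs)
  exact ⟨⟨X, s, hs, hX⟩, hX⟩

theorem isLinSym_of_represents (hn : 3 ≤ n) (h : IsLinearization q z₀ a Φ)
    {X : q.symmetryAlgebra z₀} {ξ c e : ℂ → ℂ} (hX : Represents Φ (X : VFGerm z₀) ξ c e) :
    IsLinSym a (Φ z₀).1 ξ c e := by
  obtain ⟨ξ', c', e', hs, hX'⟩ := h.exists_represents hn X
  obtain ⟨h1, h2, h3⟩ := h.eventuallyEq_of_represents hX' hX
  refine ⟨hs.analyticAt_fst.congr h1, hs.analyticAt_coeff.congr h2, hs.isSol.congr h3,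
    fun s hs' => (hs.isSol_map s hs').congr ?_⟩
  filter_upwards [h1, h2] with t h1 h2
  rw [h1, h2]

theorem mem_translations (hn : 3 ≤ n) (h : IsLinearization q z₀ a Φ)
    {X : q.symmetryAlgebra z₀} {ξ c e : ℂ → ℂ} (hX : Represents Φ (X : VFGerm z₀) ξ c e)
    (hξ : ∀ᶠ t in 𝓝 (Φ z₀).1, ξ t = 0) (hc : ∀ᶠ t in 𝓝 (Φ z₀).1, c t = 0) :
    X ∈ translations q z₀ a Φ :=
  ⟨e, (h.isLinSym_of_represents hn hX).isSol,
    hX.congr h.analyticAt.continuousAt hξ hc EventuallyEq.rfl⟩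

theorem finrank_translations (hn : 3 ≤ n) (h : IsLinearization q z₀ a Φ) :
    Module.finrank ℂ (translations q z₀ a Φ) = n := by
  choose s hs hX using fun X : translations q z₀ a Φ => X.2
  have hadd : ∀ X Y : translations q z₀ a Φ,
      s (X + Y) =ᶠ[𝓝 (Φ z₀).1] fun t => s X t + s Y t := fun X Y =>
    (h.eventuallyEq_of_represents (hX (X + Y)) (by simpa using (hX X).add (hX Y))).2.2
  have hsmul : ∀ (k : ℂ) (X : translations q z₀ a Φ),
      s (k • X) =ᶠ[𝓝 (Φ z₀).1] fun t => k * s X t := fun k X =>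
    (h.eventuallyEq_of_represents (hX (k • X)) (by simpa using (hX X).smul k)).2.2
  -- Initial values identify the solution space with `ℂ^n`, by existence and uniqueness.
  let J : translations q z₀ a Φ →ₗ[ℂ] (Fin n → ℂ) :=
    { toFun := fun X k => iteratedDeriv k (s X) (Φ z₀).1
      map_add' := fun X Y => by
        ext1 k
        rw [(iteratedDeriv_eventuallyEq (hadd X Y) k).eq_of_nhds, Pi.add_apply,
          iteratedDeriv_fun_add (hs X).analyticAt.contDiffAt (hs Y).analyticAt.contDiffAt]
      map_smul' := fun c X => by
        ext1 k
        rw [(iteratedDeriv_eventuallyEq (hsmul c X) k).eq_of_nhds,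
          iteratedDeriv_const_mul_field]
        rfl }
  have hJ : ∀ X k, J X k = iteratedDeriv k (s X) (Φ z₀).1 := fun _ _ => rfl
  have hinj : Function.Injective J := by
    rw [injective_iff_map_eq_zero]
    intro X hX0
    have h1 : s X =ᶠ[𝓝 (Φ z₀).1] 0 := by
      refine (hs X).eventually_eq_zero h.coeff ?_
      rw [natCast_le_analyticOrderAt_iff_iteratedDeriv_eq_zero (hs X).analyticAt]
      intro i hi
      rw [← hJ X ⟨i, hi⟩, hX0, Pi.zero_apply]
    have h2 := ((hX X).congr h.analyticAt.continuousAt EventuallyEq.rfl EventuallyEq.rfl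
      h1).unique (Represents.zero Φ z₀)
    exact Subtype.ext (Subtype.ext h2)
  have hsurj : Function.Surjective J := by
    intro α
    obtain ⟨r, hr, hrα⟩ := IsSol.exists_iteratedDeriv_eq (by omega) h.coeff α
    obtain ⟨X, hXr⟩ := h.exists_mem_translations hn hr
    refine ⟨X, ?_⟩
    ext1 k
    rw [hJ, ← hrα k]
    exact (iteratedDeriv_eventuallyEq
      (h.eventuallyEq_of_represents (hX X) hXr).2.2 k).eq_of_nhds
  rw [(LinearEquiv.ofBijective J ⟨hinj, hsurj⟩).finrank_eq, Module.finrank_fin_fun]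

/-- If the symmetry algebra has dimension `n + 2`, then up to a multiple there is just one symmetry
besides `u ∂_u` and the translations by solutions. -/
theorem exists_generator (hn : 3 ≤ n) (h : IsLinearization q z₀ a Φ)
    (hdim : Module.finrank ℂ (q.symmetryAlgebra z₀) = n + 2) :
    ∃ (X₀ : q.symmetryAlgebra z₀) (ξ₀ c₀ e₀ : ℂ → ℂ),
      Represents Φ (X₀ : VFGerm z₀) ξ₀ c₀ e₀ ∧ (¬ ∀ᶠ t in 𝓝 (Φ z₀).1, ξ₀ t = 0) ∧
      ∀ (Y : q.symmetryAlgebra z₀) (ξ c e : ℂ → ℂ), Represents Φ (Y : VFGerm z₀) ξ c e →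
        ∃ α β : ℂ, ∀ᶠ t in 𝓝 (Φ z₀).1, ξ t = α * ξ₀ t ∧ c t = α * c₀ t + β := by
  have hfin : FiniteDimensional ℂ (q.symmetryAlgebra z₀) :=
    Module.finite_of_finrank_pos (by omega)
  choose ξ c e hs hX using fun X : q.symmetryAlgebra z₀ => h.exists_represents hn X
  -- Forgetting the component `e` has the translations as kernel, so the image has dimension two. It
  -- is spanned by the image of `u ∂_u` and one further vector.
  let F : q.symmetryAlgebra z₀ →ₗ[ℂ] Germ (𝓝 (Φ z₀).1) ℂ × Germ (𝓝 (Φ z₀).1) ℂ :=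
    { toFun := fun X => (↑(ξ X), ↑(c X))
      map_add' := fun X Y => by
        have h1 := h.eventuallyEq_of_represents (hX (X + Y)) ((hX X).add (hX Y))
        exact Prod.ext (Germ.coe_eq.2 h1.1) (Germ.coe_eq.2 h1.2.1)
      map_smul' := fun k X => by
        have h1 := h.eventuallyEq_of_represents (hX (k • X)) ((hX X).smul k)
        exact Prod.ext (Germ.coe_eq.2 h1.1) (Germ.coe_eq.2 h1.2.1) }
  have hF : ∀ (X : q.symmetryAlgebra z₀) (ξ' c' e' : ℂ → ℂ), Represents Φ (X : VFGerm z₀) ξ' c' e' →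
      F X = ((↑ξ' : Germ (𝓝 (Φ z₀).1) ℂ), (↑c' : Germ (𝓝 (Φ z₀).1) ℂ)) := fun X ξ' c' e' hr => by
    have h1 := h.eventuallyEq_of_represents (hX X) hr
    exact Prod.ext (Germ.coe_eq.2 h1.1) (Germ.coe_eq.2 h1.2.1)
  have hker : LinearMap.ker F = translations q z₀ a Φ := by
    ext X
    rw [LinearMap.mem_ker]
    constructor
    · intro hX0
      have h1 := Prod.ext_iff.1 hX0
      exact h.mem_translations hn (hX X) (Germ.coe_eq.1 h1.1) (Germ.coe_eq.1 h1.2)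
    · rintro ⟨s, -, hXs⟩
      rw [hF X _ _ _ hXs]
      rfl
  have hrange : Module.finrank ℂ (LinearMap.range F) = 2 := by
    have h1 := F.finrank_range_add_finrank_ker
    rw [hker, h.finrank_translations hn, hdim] at h1
    omega
  obtain ⟨U, hU⟩ := h.exists_mem_represents hn
    (IsLinSym.const_coeff (a := a) (Φ z₀).1 1)
  have hU0 : F U ≠ 0 := by
    rw [hF U _ _ _ hU]
    intro h1
    have h2 : (fun _ : ℂ => (1 : ℂ)) =ᶠ[𝓝 (Φ z₀).1] fun _ => 0 :=
      Germ.coe_eq.1 (Prod.ext_iff.1 h1).2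
    exact one_ne_zero h2.eq_of_nhds
  obtain ⟨X₀, hX₀⟩ : ∃ X₀, F X₀ ∉ Submodule.span ℂ {F U} := by
    by_contra! hall
    have h1 : LinearMap.range F ≤ Submodule.span ℂ {F U} := by
      rintro _ ⟨X, rfl⟩
      exact hall X
    have h2 := Submodule.finrank_mono h1
    rw [hrange, finrank_span_singleton hU0] at h2
    omega
  have hli : LinearIndependent ℂ ![F U, F X₀] := by
    rw [LinearIndependent.pair_iff' hU0]
    intro k hk
    exact hX₀ (Submodule.mem_span_singleton.2 ⟨k, hk⟩)
  have hspan : Submodule.span ℂ {F U, F X₀} = LinearMap.range F := by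
    refine Submodule.eq_of_le_of_finrank_eq ?_ ?_
    · rw [Submodule.span_le]
      rintro _ (rfl | rfl)
      · exact ⟨_, rfl⟩
      · exact ⟨_, rfl⟩
    · have h1 := finrank_span_eq_card hli
      rw [Matrix.range_cons, Matrix.range_cons, Matrix.range_empty, Set.union_empty,
        Set.singleton_union] at h1
      rw [h1, hrange]
      simp
  -- If `ξ` vanished for `X₀`, then `c` would be constant and `F X₀` a multiple of `F U`.
  refine ⟨X₀, ξ X₀, c X₀, e X₀, hX X₀, fun hξ => hX₀ ?_, fun Y ξ' c' e' hY => ?_⟩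
  · have h1 := (hs X₀).eventually_coeff_eq (by omega) h.coeff hξ
    refine Submodule.mem_span_singleton.2 ⟨c X₀ (Φ z₀).1, ?_⟩
    rw [← map_smul, hF _ _ _ _ (hU.smul _)]
    exact Prod.ext (Germ.coe_eq.2 (hξ.mono fun t ht => by simp [ht]))
      (Germ.coe_eq.2 (h1.mono fun t ht => by simp [ht]))
  · have h1 : F Y ∈ Submodule.span ℂ {F U, F X₀} := by
      rw [hspan]; exact ⟨Y, rfl⟩
    obtain ⟨β, α, hαβ⟩ := Submodule.mem_span_pair.1 h1
    have h2 := (hU.smul β).add ((hX X₀).smul α)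
    have h3 : F (β • U + α • X₀) = F Y := by rw [map_add, map_smul, map_smul, hαβ]
    rw [hF _ _ _ _ h2, hF _ _ _ _ hY] at h3
    refine ⟨α, β, ?_⟩
    have h4 := Germ.coe_eq.1 (Prod.ext_iff.1 h3).1
    have h5 := Germ.coe_eq.1 (Prod.ext_iff.1 h3).2
    filter_upwards [h4, h5] with t h4 h5
    exact ⟨by rw [← h4]; ring, by rw [← h5]; ring⟩

/-- A symmetry with `ξ(t₀) = 0` and `ξ` not identically zero would produce another with `ξ₁(t₀) ≠
0`. Both are multiples of the same `ξ₀`, which cannot be zero and nonzero at `t₀`. -/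
theorem apply_ne_zero_of_represents (hn : 3 ≤ n) (h : IsLinearization q z₀ a Φ)
    (hdim : Module.finrank ℂ (q.symmetryAlgebra z₀) = n + 2)
    {X : q.symmetryAlgebra z₀} {ξ c e : ℂ → ℂ} (hX : Represents Φ (X : VFGerm z₀) ξ c e)
    (hξ : ¬ ∀ᶠ t in 𝓝 (Φ z₀).1, ξ t = 0) : ξ (Φ z₀).1 ≠ 0 := by
  intro h0
  obtain ⟨ξ₁, c₁, hs₁, h1⟩ := (h.isLinSym_of_represents hn hX).exists_ne_zero_of_eq_zero
    (by omega) h.coeff h0 hξ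
  obtain ⟨X₁, hX₁⟩ := h.exists_mem_represents hn hs₁
  obtain ⟨X₀, ξ₀, c₀, e₀, -, -, hall⟩ := h.exists_generator hn hdim
  obtain ⟨α, β, hα⟩ := hall X ξ c e hX
  obtain ⟨α₁, β₁, hα₁⟩ := hall X₁ _ _ _ hX₁
  have h2 := hα.self_of_nhds.1
  have h3 := hα₁.self_of_nhds.1
  rw [h0] at h2
  rcases mul_eq_zero.1 h2.symm with h4 | h4
  · exact hξ (hα.mono fun t ht => by rw [ht.1, h4, zero_mul])
  · rw [h4, mul_zero] at h3
    exact h1 h3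

theorem represents_lie_translation (hn : 3 ≤ n) (h : IsLinearization q z₀ a Φ)
    {X Z : q.symmetryAlgebra z₀} {ξ c e s : ℂ → ℂ} (hX : Represents Φ (X : VFGerm z₀) ξ c e)
    (hZ : Represents Φ (Z : VFGerm z₀) (fun _ => 0) (fun _ => 0) s) :
    Represents Φ ((⁅X, Z⁆ : q.symmetryAlgebra z₀) : VFGerm z₀) (fun _ => 0) (fun _ => 0)
      fun t => ξ t * deriv s t - c t * s t := by
  have hs := h.isLinSym_of_represents hn hX
  have hs' := h.isLinSym_of_represents hn hZ
  have h1 := h.represents_lie hX hZ hs.analyticAt_fst hs.analyticAt_coeff hs.isSol.analyticAt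
    hs'.analyticAt_fst hs'.analyticAt_coeff hs'.isSol.analyticAt
  simpa using h1

/-- The pairs `(ξ, c)` lie in the span of `(ξ₀, c₀)` and `(0, 1)`, and these two have zero bracket
modulo translations. Conversely every translation is its own bracket with a multiple of `u ∂_u`. -/
theorem toSubmodule_derivedAlgebra (hn : 3 ≤ n) (h : IsLinearization q z₀ a Φ)
    (hdim : Module.finrank ℂ (q.symmetryAlgebra z₀) = n + 2) :
    (q.derivedAlgebra z₀).toSubmodule = translations q z₀ a Φ := by
  have h0 : (q.derivedAlgebra z₀).toSubmodule =
      Submodule.span ℂ {⁅x, y⁆ | (x : q.symmetryAlgebra z₀) (y : q.symmetryAlgebra z₀)} :=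
    LieAlgebra.coe_derivedSeries_one_eq ℂ (q.symmetryAlgebra z₀)
  rw [h0]
  refine le_antisymm (Submodule.span_le.2 ?_) fun Z hZ => Submodule.subset_span ?_
  · rintro _ ⟨X, Y, rfl⟩
    obtain ⟨X₀, ξ₀, c₀, e₀, hX₀, -, hall⟩ := h.exists_generator hn hdim
    obtain ⟨ξ, c, e, hs, hX⟩ := h.exists_represents hn X
    obtain ⟨ξ', c', e', hs', hY⟩ := h.exists_represents hn Y
    have hs₀ := h.isLinSym_of_represents hn hX₀
    obtain ⟨α, β, hα⟩ := hall X _ _ _ hX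
    obtain ⟨α', β', hα'⟩ := hall Y _ _ _ hY
    have h1 := h.represents_lie hX hY hs.analyticAt_fst hs.analyticAt_coeff hs.isSol.analyticAt
      hs'.analyticAt_fst hs'.analyticAt_coeff hs'.isSol.analyticAt
    have hd : ∀ {f f₀ : ℂ → ℂ} {k l t : ℂ}, (∀ᶠ x in 𝓝 t, f x = k * f₀ x + l) →
        AnalyticAt ℂ f₀ t → deriv f t = k * deriv f₀ t := fun {f f₀ k l t} hf hf₀ => by
      have h2 : f =ᶠ[𝓝 t] fun x => k * f₀ x + l := hf
      rw [h2.deriv_eq, deriv_add_const, deriv_const_mul _ hf₀.differentiableAt]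
    refine h.mem_translations hn (X := ⁅X, Y⁆) h1 ?_ ?_
    · filter_upwards [hα.eventually_nhds, hα'.eventually_nhds,
        hs₀.analyticAt_fst.eventually_analyticAt] with t h1 h2 h3
      rw [hd (f := ξ) (k := α) (l := 0) (h1.mono fun x hx => by rw [hx.1, add_zero]) h3,
        hd (f := ξ') (k := α') (l := 0) (h2.mono fun x hx => by rw [hx.1, add_zero]) h3,
        h1.self_of_nhds.1, h2.self_of_nhds.1]
      ring
    · filter_upwards [hα.eventually_nhds, hα'.eventually_nhds,
        hs₀.analyticAt_coeff.eventually_analyticAt] with t h1 h2 h3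
      rw [hd (h1.mono fun x hx => hx.2) h3, hd (h2.mono fun x hx => hx.2) h3,
        h1.self_of_nhds.1, h2.self_of_nhds.1]
      ring
  -- The coefficient is `-1` because a symmetry acts on translations as `ξ d/dt - c`.
  · obtain ⟨U, hU⟩ := h.exists_mem_represents hn (IsLinSym.const_coeff (a := a) (Φ z₀).1 (-1))
    obtain ⟨s, hs, hZs⟩ := hZ
    refine ⟨U, Z, Subtype.ext ?_⟩
    exact (h.represents_lie_translation hn hU hZs).unique (by simpa using hZs)

theorem exists_represents_derived (hn : 3 ≤ n) (h : IsLinearization q z₀ a Φ)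
    (hdim : Module.finrank ℂ (q.symmetryAlgebra z₀) = n + 2) (Z : q.derivedAlgebra z₀) :
    ∃ s, IsSol a (Φ z₀).1 s ∧ Represents Φ ((Z : q.symmetryAlgebra z₀) : VFGerm z₀)
      (fun _ => 0) (fun _ => 0) s := by
  have h1 : (Z : q.symmetryAlgebra z₀) ∈ (q.derivedAlgebra z₀).toSubmodule := Z.2
  rw [h.toSubmodule_derivedAlgebra hn hdim] at h1
  exact h1

theorem exists_derived_represents (hn : 3 ≤ n) (h : IsLinearization q z₀ a Φ)
    (hdim : Module.finrank ℂ (q.symmetryAlgebra z₀) = n + 2) {s : ℂ → ℂ}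
    (hs : IsSol a (Φ z₀).1 s) : ∃ Z : q.derivedAlgebra z₀,
      Represents Φ ((Z : q.symmetryAlgebra z₀) : VFGerm z₀) (fun _ => 0) (fun _ => 0) s := by
  obtain ⟨⟨X, hX⟩, hXs⟩ := h.exists_mem_translations hn hs
  rw [← h.toSubmodule_derivedAlgebra hn hdim] at hX
  exact ⟨⟨X, hX⟩, hXs⟩

theorem isLieAbelian_derivedAlgebra (hn : 3 ≤ n) (h : IsLinearization q z₀ a Φ)
    (hdim : Module.finrank ℂ (q.symmetryAlgebra z₀) = n + 2) :
    IsLieAbelian (q.derivedAlgebra z₀) := by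
  refine ⟨fun Y Z => ?_⟩
  obtain ⟨r, hr, hYr⟩ := h.exists_represents_derived hn hdim Y
  obtain ⟨s, hs, hZs⟩ := h.exists_represents_derived hn hdim Z
  refine Subtype.ext (Subtype.ext ?_)
  exact (h.represents_lie_translation hn hYr hZs).unique
    (by simpa using Represents.zero Φ z₀)

theorem finrank_derivedAlgebra (hn : 3 ≤ n) (h : IsLinearization q z₀ a Φ)
    (hdim : Module.finrank ℂ (q.symmetryAlgebra z₀) = n + 2) :
    Module.finrank ℂ (q.derivedAlgebra z₀) = n := by
  have h1 : Module.finrank ℂ (q.derivedAlgebra z₀).toSubmodule = n := by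
    rw [h.toSubmodule_derivedAlgebra hn hdim, h.finrank_translations hn]
  exact h1

/-- A scalar action tested on the solution with `s(t₀) = 0`, `s'(t₀) = 1` gives `ξ(t₀) = 0`, hence
`ξ = 0` identically. Conversely `ξ = 0` makes `c` constant. -/
theorem actsAsScalar_iff (hn : 3 ≤ n) (h : IsLinearization q z₀ a Φ)
    (hdim : Module.finrank ℂ (q.symmetryAlgebra z₀) = n + 2)
    {X : q.symmetryAlgebra z₀} {ξ c e : ℂ → ℂ} (hX : Represents Φ (X : VFGerm z₀) ξ c e) :
    q.ActsAsScalar z₀ X ↔ ∀ᶠ t in 𝓝 (Φ z₀).1, ξ t = 0 := by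
  constructor
  · rintro ⟨μ, hμ⟩
    by_contra hξ
    refine h.apply_ne_zero_of_represents hn hdim hX hξ ?_
    obtain ⟨s, hs, hs'⟩ := IsSol.exists_iteratedDeriv_eq (by omega) h.coeff
      (fun k : Fin n => if (k : ℕ) = 1 then (1 : ℂ) else 0)
    obtain ⟨Z, hZ⟩ := h.exists_derived_represents hn hdim hs
    have h1 := h.represents_lie_translation hn hX hZ
    have h2 : Represents Φ ((⁅X, (Z : q.symmetryAlgebra z₀)⁆ : q.symmetryAlgebra z₀) : VFGerm z₀)
        (fun _ => μ * 0) (fun _ => μ * 0) fun t => μ * s t := by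
      have h3 : ⁅X, (Z : q.symmetryAlgebra z₀)⁆ = μ • (Z : q.symmetryAlgebra z₀) :=
        congrArg Subtype.val (hμ Z)
      rw [h3]
      exact hZ.smul μ
    have h3 := (h.eventuallyEq_of_represents h1 h2).2.2.eq_of_nhds
    have h4 := hs' ⟨0, by omega⟩
    have h5 := hs' ⟨1, by omega⟩
    simp only [iteratedDeriv_zero, iteratedDeriv_one, zero_ne_one, if_false, if_true] at h4 h5
    simpa [h4, h5] using h3
  · intro hξ
    have hc := (h.isLinSym_of_represents hn hX).eventually_coeff_eq (by omega) h.coeff hξ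
    refine ⟨-c (Φ z₀).1, fun Z => Subtype.ext (Subtype.ext ?_)⟩
    obtain ⟨s, hs, hZ⟩ := h.exists_represents_derived hn hdim Z
    refine ((h.represents_lie_translation hn hX hZ).congr h.analyticAt.continuousAt
      EventuallyEq.rfl EventuallyEq.rfl (e' := fun t => -c (Φ z₀).1 * s t) ?_).unique
      (by simpa using hZ.smul (-c (Φ z₀).1))
    filter_upwards [hξ, hc] with t h1 h2
    rw [h1, h2]
    ring

/-- The abelian algebra `D` acts on itself by zero, so two scalar actions would make every symmetry
act as a scalar, including the generator with `ξ₀` not identically zero. -/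
theorem not_actsAsScalar_or (hn : 3 ≤ n) (h : IsLinearization q z₀ a Φ)
    (hdim : Module.finrank ℂ (q.symmetryAlgebra z₀) = n + 2) (e₁ e₂ : q.symmetryAlgebra z₀)
    (hspan : (q.derivedAlgebra z₀).toSubmodule ⊔ Submodule.span ℂ {e₁, e₂} = ⊤) :
    ¬ q.ActsAsScalar z₀ e₁ ∨ ¬ q.ActsAsScalar z₀ e₂ := by
  by_contra! hcon
  obtain ⟨⟨μ₁, h1⟩, μ₂, h2⟩ := hcon
  obtain ⟨X₀, ξ₀, c₀, e₀, hX₀, hξ₀, -⟩ := h.exists_generator hn hdim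
  refine hξ₀ ((h.actsAsScalar_iff hn hdim hX₀).1 ?_)
  obtain ⟨d, hd, y, hy, hX⟩ := Submodule.mem_sup.1 (hspan ▸ Submodule.mem_top : X₀ ∈ _)
  obtain ⟨α, β, rfl⟩ := Submodule.mem_span_pair.1 hy
  refine ⟨α * μ₁ + β * μ₂, fun Z => ?_⟩
  have h3 := (h.isLieAbelian_derivedAlgebra hn hdim).trivial ⟨d, hd⟩ Z
  have h4 : ⁅d, Z⁆ = 0 := h3
  rw [← hX, add_lie, add_lie, smul_lie, smul_lie, h4, h1, h2, zero_add, add_smul, mul_smul,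
    mul_smul]

end IsLinearization
end ODESymm
end
noncomputable section

open Filter Topology Polynomial VectorField
open scoped ContDiff

namespace ODESymm

variable {n : ℕ} {q : RationalODE n} {z₀ : ℂ × ℂ} {a : Fin n → ℂ → ℂ} {Φ : ℂ × ℂ → ℂ × ℂ}

/-! Equations with constant coefficients -/

theorem charPoly_monic (c : Fin n → ℂ) : (charPoly c).Monic :=
  monic_X_pow_add (degree_sum_fin_lt c)

theorem natDegree_charPoly (c : Fin n → ℂ) : (charPoly c).natDegree = n := by
  refine natDegree_eq_of_degree_eq_some ?_
  rw [charPoly, degree_add_eq_left_of_degree_lt, degree_X_pow]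
  rw [degree_X_pow]
  exact degree_sum_fin_lt c

theorem coeff_charPoly (c : Fin n → ℂ) (k : Fin n) : (charPoly c).coeff k = c k := by
  simp only [charPoly, coeff_add, coeff_X_pow, k.2.ne, if_false, zero_add, finsetSum_coeff,
    coeff_C_mul, Fin.val_inj]
  simp

theorem charpoly_smul_add_smul_one {ι : Type*} [Fintype ι] [DecidableEq ι] (M : Matrix ι ι ℂ)
    (k b : ℂ) : (k • M + b • 1).charpoly = affineRoots M.charpoly k b := by
  have hM : M.charpoly = (M.charpoly.roots.map fun r => X - C r).prod :=
    (IsAlgClosed.splits M.charpoly).eq_prod_roots_of_monic M.charpoly_monic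
  have hcard : M.charpoly.roots.card = Fintype.card ι := by
    rw [splits_iff_card_roots.1 (IsAlgClosed.splits M.charpoly), M.charpoly_natDegree_eq_dim]
  refine Polynomial.funext fun z => ?_
  rw [Matrix.eval_charpoly, affineRoots, eval_multiset_prod, Multiset.map_map]
  simp only [Function.comp_def, eval_sub, eval_X, eval_C]
  -- For `k = 0` the matrix can no longer be rescaled. The product is then a power of `z - b` whose
  -- exponent is the number of roots, equal to the matrix size over `ℂ`.
  rcases eq_or_ne k 0 with rfl | hk
  · have h1 : Matrix.scalar ι z - ((0 : ℂ) • M + b • 1) = (z - b) • (1 : Matrix ι ι ℂ) := by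
      rw [zero_smul, zero_add, sub_smul, Matrix.scalar_apply, ← Matrix.smul_one_eq_diagonal]
    rw [h1, Matrix.det_smul, Matrix.det_one, mul_one]
    simp [hcard]
  · have h1 : Matrix.scalar ι z - (k • M + b • 1) =
        k • (Matrix.scalar ι ((z - b) / k) - M) := by
      rw [smul_sub, Matrix.scalar_apply, Matrix.scalar_apply, ← Matrix.smul_one_eq_diagonal,
        ← Matrix.smul_one_eq_diagonal, smul_smul, mul_div_cancel₀ _ hk, sub_smul]
      abel
    have h2 : ∀ r : ℂ, z - (k * r + b) = k * ((z - b) / k - r) := fun r => by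
      field_simp
      ring
    simp only [h2]
    rw [h1, Matrix.det_smul, ← Matrix.eval_charpoly, Multiset.prod_map_mul, Multiset.map_const',
      Multiset.prod_replicate, hcard]
    congr 1
    conv_lhs => rw [hM]
    rw [eval_multiset_prod, Multiset.map_map]
    simp only [Function.comp_def, eval_sub, eval_X, eval_C]

theorem IsLinSym.translation_of_const_coeff {t₀ : ℂ} {c : Fin n → ℂ} :
    IsLinSym (fun k _ => c k) t₀ (fun _ => 1) (fun _ => 0) fun _ => 0 := by
  refine ⟨analyticAt_const, analyticAt_const, IsSol.zero, fun s hs => ?_⟩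
  refine IsSol.congr (s := deriv s) ⟨hs.analyticAt.deriv, ?_⟩
    (Eventually.of_forall fun t => by simp)
  filter_upwards [hs.eq_zero.eventually_nhds, hs.analyticAt.eventually_analyticAt] with t h1 h2
  have h3 : linOp (fun k _ => c k) s =ᶠ[𝓝 t] fun _ => 0 := h1
  have h4 := deriv_linOp (a := fun k _ => c k) (fun _ => analyticAt_const) h2
  rw [h3.deriv_eq, deriv_const] at h4
  simp only [deriv_const, zero_mul, zero_add, iteratedDeriv_succ'] at h4
  exact h4.symm

theorem Represents.sum {V : ℕ → VFGerm z₀} {s : ℕ → ℂ → ℂ} (N : ℕ)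
    (h : ∀ k < N, Represents Φ (V k) (fun _ => 0) (fun _ => 0) (s k)) :
    Represents Φ (∑ k ∈ Finset.range N, V k) (fun _ => 0) (fun _ => 0)
      fun t => ∑ k ∈ Finset.range N, s k t := by
  induction N with
  | zero => simpa using Represents.zero Φ z₀
  | succ N ih =>
    simp only [Finset.sum_range_succ]
    simpa using (ih fun k hk => h k (by omega)).add (h N (by omega))

namespace IsLinearization

theorem represents_pow_toEnd (hn : 3 ≤ n) (h : IsLinearization q z₀ a Φ)
    {X : q.symmetryAlgebra z₀} {ξ c e s : ℂ → ℂ} (hX : Represents Φ (X : VFGerm z₀) ξ c e)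
    {Z : q.derivedAlgebra z₀} (hZ : Represents Φ ((Z : q.symmetryAlgebra z₀) : VFGerm z₀)
      (fun _ => 0) (fun _ => 0) s) (k : ℕ) :
    Represents Φ (((((LieModule.toEnd ℂ (q.symmetryAlgebra z₀) (q.derivedAlgebra z₀) X) ^ k) Z :
      q.derivedAlgebra z₀) : q.symmetryAlgebra z₀) : VFGerm z₀) (fun _ => 0) (fun _ => 0)
      ((fun f t => ξ t * deriv f t - c t * f t)^[k] s) := by
  induction k with
  | zero => exact hZ
  | succ k ih =>
    rw [Function.iterate_succ_apply', pow_succ']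
    exact h.represents_lie_translation hn hX ih

theorem represents_aeval_toEnd (hn : 3 ≤ n) (h : IsLinearization q z₀ a Φ)
    {X : q.symmetryAlgebra z₀} {ξ c e s : ℂ → ℂ} (hX : Represents Φ (X : VFGerm z₀) ξ c e)
    {Z : q.derivedAlgebra z₀} (hZ : Represents Φ ((Z : q.symmetryAlgebra z₀) : VFGerm z₀)
      (fun _ => 0) (fun _ => 0) s) {p : ℂ[X]} {N : ℕ} (hp : p.natDegree < N) :
    Represents Φ ((((aeval (LieModule.toEnd ℂ (q.symmetryAlgebra z₀) (q.derivedAlgebra z₀) X) p) Z :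
      q.derivedAlgebra z₀) : q.symmetryAlgebra z₀) : VFGerm z₀) (fun _ => 0) (fun _ => 0)
      fun t => ∑ k ∈ Finset.range N, p.coeff k *
        (fun f t => ξ t * deriv f t - c t * f t)^[k] s t := by
  have h1 := Represents.sum N fun k _ => by
    simpa only [mul_zero] using (h.represents_pow_toEnd hn hX hZ k).smul (p.coeff k)
  convert h1 using 1
  rw [aeval_eq_sum_range' hp, LinearMap.sum_apply]
  rw [AddSubmonoidClass.coe_finsetSum, AddSubmonoidClass.coe_finsetSum]
  rfl

/-- The symmetry `∂_t` acts as `d/dt`, so the equation itself says that its characteristic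
polynomial annihilates the action. No nonzero polynomial of smaller degree does, as initial values
are arbitrary; hence minimal and characteristic polynomials coincide with it. -/
theorem charpoly_toEnd (hn : 3 ≤ n) {c : Fin n → ℂ}
    (h : IsLinearization q z₀ (fun k _ => c k) Φ)
    (hdim : Module.finrank ℂ (q.symmetryAlgebra z₀) = n + 2)
    [FiniteDimensional ℂ (q.derivedAlgebra z₀)]
    {P : q.symmetryAlgebra z₀}
    (hP : Represents Φ (P : VFGerm z₀) (fun _ => 1) (fun _ => 0) fun _ => 0) :
    (LieModule.toEnd ℂ (q.symmetryAlgebra z₀) (q.derivedAlgebra z₀) P).charpoly = charPoly c := by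
  set T := LieModule.toEnd ℂ (q.symmetryAlgebra z₀) (q.derivedAlgebra z₀) P with hT
  have hiter : ∀ (k : ℕ) (s : ℂ → ℂ),
      (fun (f : ℂ → ℂ) t => (1 : ℂ) * deriv f t - 0 * f t)^[k] s = iteratedDeriv k s := by
    intro k s
    simp only [one_mul, zero_mul, sub_zero, iteratedDeriv_eq_iterate]
  have h1 : aeval T (charPoly c) = 0 := by
    refine LinearMap.ext fun Z => Subtype.ext (Subtype.ext ?_)
    obtain ⟨s, hs, hZ⟩ := h.exists_represents_derived hn hdim Z
    refine ((h.represents_aeval_toEnd hn hP hZ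
      (by rw [natDegree_charPoly]; exact n.lt_succ_self)).congr h.analyticAt.continuousAt
      EventuallyEq.rfl EventuallyEq.rfl ?_).unique (Represents.zero Φ z₀)
    filter_upwards [hs.eq_zero] with t ht
    refine Eq.trans ?_ ht
    rw [Finset.sum_range_succ, Finset.sum_range, add_comm]
    simp only [hiter, coeff_charPoly, linOp]
    have h2 := (charPoly_monic c).coeff_natDegree
    rw [natDegree_charPoly] at h2
    rw [h2, one_mul]
  have h2 : n ≤ (minpoly ℂ T).natDegree := by
    by_contra! hlt
    -- On this solution the monic polynomial `minpoly ℂ T` in `d/dt` takes the value `1` at the base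
    -- point, since all lower derivatives vanish there.
    obtain ⟨s, hs, hs'⟩ := IsSol.exists_iteratedDeriv_eq (by omega) h.coeff
      (fun k : Fin n => if (k : ℕ) = (minpoly ℂ T).natDegree then (1 : ℂ) else 0)
    obtain ⟨Z, hZ⟩ := h.exists_derived_represents hn hdim hs
    have h3 := h.represents_aeval_toEnd hn hP hZ (Nat.lt_succ_self (minpoly ℂ T).natDegree)
    rw [← hT, minpoly.aeval] at h3
    have h4 := (h.eventually_eq_zero_of_represents h3).self_of_nhds.2.2
    simp only [hiter] at h4
    rw [Finset.sum_range_succ, Finset.sum_eq_zero, hs' ⟨_, hlt⟩] at h4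
    · simp only [if_true, zero_add, mul_one] at h4
      rw [(minpoly.monic (Algebra.IsIntegral.isIntegral T)).coeff_natDegree] at h4
      exact one_ne_zero h4
    · intro k hk
      rw [Finset.mem_range] at hk
      rw [hs' ⟨k, by omega⟩, if_neg hk.ne, mul_zero]
  have hm := minpoly.monic (Algebra.IsIntegral.isIntegral (R := ℂ) T)
  rw [eq_of_monic_of_dvd_of_natDegree_le hm (charPoly_monic c) (minpoly.dvd ℂ T h1)
      (by rwa [natDegree_charPoly]),
    eq_of_monic_of_dvd_of_natDegree_le hm T.charpoly_monic T.minpoly_dvd_charpoly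
      (by rwa [T.charpoly_natDegree, h.finrank_derivedAlgebra hn hdim])]

theorem exists_charpoly_adMatrix_eq (hn : 3 ≤ n) {c : Fin n → ℂ}
    (h : IsLinearization q z₀ (fun k _ => c k) Φ)
    (hdim : Module.finrank ℂ (q.symmetryAlgebra z₀) = n + 2) (X : q.symmetryAlgebra z₀)
    (B : Module.Basis (Fin n) ℂ (q.derivedAlgebra z₀)) :
    ∃ k b : ℂ, (k = 0 ↔ q.ActsAsScalar z₀ X) ∧
      (q.adMatrix z₀ X B).charpoly = affineRoots (charPoly c) k b := by
  have hfin : FiniteDimensional ℂ (q.derivedAlgebra z₀) := B.finiteDimensional_of_finite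
  obtain ⟨P, hP⟩ := h.exists_mem_represents hn IsLinSym.translation_of_const_coeff
  obtain ⟨X₀, ξ₀, c₀, e₀, -, -, hall⟩ := h.exists_generator hn hdim
  obtain ⟨ξ, d, e, hs, hX⟩ := h.exists_represents hn X
  obtain ⟨α, β, hα⟩ := hall X _ _ _ hX
  obtain ⟨α', β', hα'⟩ := hall P _ _ _ hP
  have hα0 : α' ≠ 0 := by
    rintro rfl
    simpa using hα'.self_of_nhds.1
  have hξ : ∀ᶠ t in 𝓝 (Φ z₀).1, ξ t = α / α' := by
    filter_upwards [hα, hα'] with t h1 h2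
    rw [eq_div_iff hα0]
    linear_combination α' * h1.1 - α * h2.1
  have hd : ∀ᶠ t in 𝓝 (Φ z₀).1, d t = β - α / α' * β' := by
    filter_upwards [hα, hα'] with t h1 h2
    field_simp
    linear_combination α' * h1.2 - α * h2.2
  -- Comparison with `∂_t` shows that `ξ` and the linear coefficient are constants. The number `k`
  -- is the value of `ξ`, and `b` is minus the coefficient because the action is `ξ d/dt - c`.
  refine ⟨α / α', -(β - α / α' * β'), ?_, ?_⟩
  · rw [h.actsAsScalar_iff hn hdim hX]
    exact ⟨fun h0 => hξ.mono fun t ht => by rw [ht, h0],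
      fun h0 => by rw [← hξ.self_of_nhds, h0.self_of_nhds]⟩
  · have hend : LieModule.toEnd ℂ (q.symmetryAlgebra z₀) (q.derivedAlgebra z₀) X =
        (α / α') • LieModule.toEnd ℂ (q.symmetryAlgebra z₀) (q.derivedAlgebra z₀) P +
          (-(β - α / α' * β')) • 1 := by
      refine LinearMap.ext fun Z => Subtype.ext (Subtype.ext ?_)
      obtain ⟨s, hs, hZ⟩ := h.exists_represents_derived hn hdim Z
      have h1 := (h.represents_lie_translation hn hX hZ).congr h.analyticAt.continuousAt
        EventuallyEq.rfl EventuallyEq.rfl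
        (e' := fun t => α / α' * (1 * deriv s t - 0 * s t) + (-(β - α / α' * β')) * s t) (by
          filter_upwards [hξ, hd] with t h1 h2
          rw [h1, h2]
          ring)
      have h2 := ((h.represents_lie_translation hn hP hZ).smul (α / α')).add
        (hZ.smul (-(β - α / α' * β')))
      simp only [mul_zero, add_zero] at h2
      exact h1.unique h2
    rw [RationalODE.adMatrix, hend, map_add, map_smul, map_smul, LinearMap.toMatrix_one,
      charpoly_smul_add_smul_one, LinearMap.charpoly_toMatrix, h.charpoly_toEnd hn hdim hP]

end IsLinearization
end ODESymm
end
noncomputable section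

open Filter Topology Polynomial VectorField
open scoped ContDiff

namespace ODESymm

variable {n : ℕ} {q : RationalODE n} {z₀ : ℂ × ℂ} {a : Fin n → ℂ → ℂ} {Φ : ℂ × ℂ → ℂ × ℂ}

/-! Straightening a symmetry -/

/-- The action of `ξ ∂_t + c u ∂_u` on functions of `t`. -/
def symOp (ξ c f : ℂ → ℂ) (t : ℂ) : ℂ := ξ t * deriv f t - c t * f t

theorem analyticAt_symOp_iterate {ξ c f : ℂ → ℂ} {t : ℂ} (hξ : AnalyticAt ℂ ξ t)
    (hc : AnalyticAt ℂ c t) (hf : AnalyticAt ℂ f t) (k : ℕ) :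
    AnalyticAt ℂ ((symOp ξ c)^[k] f) t := by
  induction k with
  | zero => exact hf
  | succ k ih =>
    rw [Function.iterate_succ_apply']
    exact (hξ.mul ih.deriv).sub (hc.mul ih)

theorem symOp_iterate_sum {ι : Type*} [Fintype ι] {ξ c : ℂ → ℂ} {S : ι → ℂ → ℂ} (α : ι → ℂ) {t : ℂ}
    (hξ : AnalyticAt ℂ ξ t) (hc : AnalyticAt ℂ c t) (hS : ∀ i, AnalyticAt ℂ (S i) t) (k : ℕ) :
    (symOp ξ c)^[k] (fun t => ∑ i, α i * S i t) =ᶠ[𝓝 t]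
      fun t => ∑ i, α i * (symOp ξ c)^[k] (S i) t := by
  induction k with
  | zero => exact EventuallyEq.rfl
  | succ k ih =>
    have h1 : ∀ᶠ x in 𝓝 t, ∀ i, AnalyticAt ℂ ((symOp ξ c)^[k] (S i)) x :=
      eventually_all.2 fun i => (analyticAt_symOp_iterate hξ hc (hS i) k).eventually_analyticAt
    filter_upwards [ih.eventually_nhds, h1] with x h2 h3
    have h2' : (symOp ξ c)^[k] (fun t => ∑ i, α i * S i t) =ᶠ[𝓝 x]
      fun t => ∑ i, α i * (symOp ξ c)^[k] (S i) t := h2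
    have h4 : HasDerivAt (fun t => ∑ i, α i * (symOp ξ c)^[k] (S i) t)
        (∑ i, α i * deriv ((symOp ξ c)^[k] (S i)) x) x :=
      HasDerivAt.fun_sum fun i _ => (h3 i).differentiableAt.hasDerivAt.const_mul (α i)
    simp only [Function.iterate_succ_apply', symOp]
    rw [h2'.deriv_eq, h4.deriv, h2'.eq_of_nhds, Finset.mul_sum, Finset.mul_sum,
      ← Finset.sum_sub_distrib]
    exact Finset.sum_congr rfl fun i _ => by ring

/-- At the point `t`, the transformation `(t, u) ↦ (τ(t), g(t) u)` maps `ξ ∂_t + c u ∂_u` to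
`∂_τ`. -/
structure StraightensAt (ξ c τ g : ℂ → ℂ) (t : ℂ) : Prop where
  analyticAt_fst : AnalyticAt ℂ ξ t
  analyticAt_coeff : AnalyticAt ℂ c t
  analyticAt_time : AnalyticAt ℂ τ t
  analyticAt_factor : AnalyticAt ℂ g t
  factor_ne_zero : g t ≠ 0
  deriv_time : ξ t * deriv τ t = 1
  deriv_factor : ξ t * deriv g t + c t * g t = 0

theorem exists_straightensAt {ξ c : ℂ → ℂ} {t₀ : ℂ} (hξ : AnalyticAt ℂ ξ t₀)
    (hc : AnalyticAt ℂ c t₀) (h0 : ξ t₀ ≠ 0) :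
    ∃ τ g, ∀ᶠ t in 𝓝 t₀, StraightensAt ξ c τ g t := by
  have hdiv : AnalyticAt ℂ (fun t => c t / ξ t) t₀ := hc.fun_div hξ h0
  have hinv : AnalyticAt ℂ (fun t => 1 / ξ t) t₀ := analyticAt_const.fun_div hξ h0
  -- The factor solves the first-order equation `g' + (c / ξ) g = 0` with `g(t₀) = 1`; the new time
  -- is a primitive of `1 / ξ`.
  obtain ⟨g, hg, hg0⟩ := IsSol.exists_iteratedDeriv_eq (n := 1) one_pos
    (a := fun _ t => c t / ξ t) (fun _ => hdiv) (fun _ => 1)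
  have hg1 := hg0 0
  simp only [Fin.val_zero, iteratedDeriv_zero] at hg1
  obtain ⟨ε, hε, hball⟩ := Metric.eventually_nhds_iff_ball.1 hinv.eventually_analyticAt
  obtain ⟨τ, hτ⟩ := DifferentiableOn.isExactOn_ball (f := fun t => 1 / ξ t) (c := t₀) (r := ε)
    fun z hz => (hball z hz).differentiableAt.differentiableWithinAt
  have hτ' : ∀ᶠ t in 𝓝 t₀, HasDerivAt τ (1 / ξ t) t :=
    Filter.mem_of_superset (Metric.ball_mem_nhds _ hε) hτ
  refine ⟨τ, g, ?_⟩
  filter_upwards [hξ.eventually_analyticAt, hc.eventually_analyticAt, hτ'.eventually_nhds,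
    hg.analyticAt.eventually_analyticAt, hg.eq_zero, hξ.continuousAt.eventually_ne h0,
    hg.analyticAt.continuousAt.eventually_ne (by rw [hg1]; exact one_ne_zero)]
    with t h1 h2 h3 h4 h5 h6 h7
  refine ⟨h1, h2, ?_, h4, h7, ?_, ?_⟩
  · rw [Complex.analyticAt_iff_eventually_differentiableAt]
    exact h3.mono fun x hx => hx.differentiableAt
  · rw [h3.self_of_nhds.deriv, mul_one_div_cancel h6]
  · simp only [linOp, iteratedDeriv_one, Finset.univ_unique, Fin.default_eq_zero, Fin.val_zero,
      iteratedDeriv_zero, Finset.sum_singleton] at h5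
    field_simp at h5
    linear_combination h5

namespace StraightensAt

variable {ξ c τ g : ℂ → ℂ} {t : ℂ}

theorem deriv_time_ne_zero (h : StraightensAt ξ c τ g t) : deriv τ t ≠ 0 := fun h0 => by
  have := h.deriv_time
  rw [h0, mul_zero] at this
  exact zero_ne_one this

theorem analyticAt_map {p : ℂ × ℂ} (h : StraightensAt ξ c τ g p.1) :
    AnalyticAt ℂ (affineField τ g fun _ => 0) p :=
  analyticAt_affineField h.analyticAt_time h.analyticAt_factor analyticAt_const

theorem injective_fderiv {p : ℂ × ℂ} (h : StraightensAt ξ c τ g p.1) :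
    Function.Injective (fderiv ℂ (affineField τ g fun _ => 0) p) := by
  rw [injective_iff_map_eq_zero]
  intro x hx
  rw [fderiv_affineField h.analyticAt_time h.analyticAt_factor analyticAt_const,
    Prod.mk_eq_zero] at hx
  have h1 := (mul_eq_zero.1 hx.1).resolve_left h.deriv_time_ne_zero
  have h2 := hx.2
  rw [h1, mul_zero, zero_add] at h2
  exact Prod.ext h1 ((mul_eq_zero.1 h2).resolve_left h.factor_ne_zero)

theorem totalDeriv_fst {J : Jet n} (h : StraightensAt ξ c τ g (J 0)) :
    Jet.totalDeriv (fun J : Jet n => (affineField τ g (fun _ => 0) J.base).1) J =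
      deriv τ (J 0) := by
  have h1 : HasFDerivAt (fun z : ℂ × ℂ => τ z.1)
      (deriv τ J.base.1 • ContinuousLinearMap.fst ℂ ℂ ℂ) J.base :=
    HasDerivAt.comp_hasFDerivAt J.base (f := Prod.fst)
      (h.analyticAt_time.differentiableAt.hasDerivAt : HasDerivAt τ _ J.base.1) hasFDerivAt_fst
  have h2 := Jet.totalDeriv_comp_base (j := J) h1.differentiableAt
  rw [h1.fderiv] at h2
  simpa [affineField, Jet.base] using h2

/-- Here `d/dτ = ξ d/dt` and `ξ (g f)' = g (ξ f' - c f)`, so every derivative in `τ` of `g s`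
produces one application of `symOp` to `s`. -/
theorem pointMapCoord_ofFun {k : ℕ} (hk : k ≤ n) {s : ℂ → ℂ}
    (h : ∀ᶠ x in 𝓝 t, StraightensAt ξ c τ g x) (hs : AnalyticAt ℂ s t) :
    Jet.pointMapCoord (affineField τ g fun _ => 0) k (Jet.ofFun s t : Jet n) =
      g t * (symOp ξ c)^[k] s t := by
  induction k generalizing t with
  | zero => simp [Jet.pointMapCoord, Jet.base_ofFun, affineField]
  | succ k ih =>
    have ht := h.self_of_nhds
    have htb : StraightensAt ξ c τ g (Jet.ofFun s t : Jet n).base.1 := by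
      rw [Jet.base_ofFun]; exact ht
    have hd : Jet.totalDeriv (fun J : Jet n => (affineField τ g (fun _ => 0) J.base).1)
        (Jet.ofFun s t) = deriv τ t := totalDeriv_fst (J := Jet.ofFun s t) htb
    have hcd := Jet.contDiffAt_pointMapCoord (j := (Jet.ofFun s t : Jet n)) htb.analyticAt_map
      (by rw [hd]; exact ht.deriv_time_ne_zero) k
    have h1 := Jet.hasDerivAt_comp_ofFun hs (hcd.differentiableAt (by simp))
      ((Jet.indep_pointMapCoord _ k).mono hk)
    have h2 : (fun t => Jet.pointMapCoord (affineField τ g fun _ => 0) k (Jet.ofFun s t : Jet n))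
        =ᶠ[𝓝 t] fun t => g t * (symOp ξ c)^[k] s t := by
      filter_upwards [h.eventually_nhds, hs.eventually_analyticAt] with x h3 h4
      exact ih (by omega) h3 h4
    have han := analyticAt_symOp_iterate ht.analyticAt_fst ht.analyticAt_coeff hs k
    have h3 := (ht.analyticAt_factor.differentiableAt.hasDerivAt.fun_mul
      han.differentiableAt.hasDerivAt)
    have h4 := h1.deriv.symm.trans (h2.deriv_eq.trans h3.deriv)
    simp only [Jet.pointMapCoord, Function.iterate_succ_apply', symOp]
    rw [hd, h4, div_eq_iff ht.deriv_time_ne_zero]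
    linear_combination (-(deriv g t * (symOp ξ c)^[k] s t
      + g t * deriv ((symOp ξ c)^[k] s) t)) * ht.deriv_time
      + deriv τ t * (symOp ξ c)^[k] s t * ht.deriv_factor

end StraightensAt

theorem eventually_linLhs_pointMap_iff (hn : 2 ≤ n) {ξ c τ g : ℂ → ℂ} {t₀ : ℂ} {b : Fin n → ℂ}
    (ha : ∀ k, AnalyticAt ℂ (a k) t₀) (h : ∀ᶠ t in 𝓝 t₀, StraightensAt ξ c τ g t)
    (hb : ∀ s, IsSol a t₀ s → ∀ᶠ t in 𝓝 t₀,
      (symOp ξ c)^[n] s t + ∑ k : Fin n, b k * (symOp ξ c)^[k] s t = 0) :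
    ∀ᶠ t in 𝓝 t₀, ∀ J : Jet n, J 0 = t → (linLhs a J = 0 ↔
      linLhs (fun k _ => b k) (J.pointMap (affineField τ g fun _ => 0)) = 0) := by
  obtain ⟨S, hS, hS'⟩ := exists_fundamental_system (by omega) ha
  have hbS : ∀ᶠ t in 𝓝 t₀, ∀ i, AnalyticAt ℂ (S i) t ∧
      (symOp ξ c)^[n] (S i) t + ∑ k : Fin n, b k * (symOp ξ c)^[k] (S i) t = 0 :=
    eventually_all.2 fun i => (hS i).analyticAt.eventually_analyticAt.and (hb _ (hS i))
  filter_upwards [h.eventually_nhds, hbS, eventually_exists_solution_of_jet hS hS'] with t h hbS hJ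
  have ht := h.self_of_nhds
  set Ψ := affineField τ g fun _ => 0 with hΨ
  have hG : ∀ J : Jet n, linLhs (fun k _ => b k) (J.pointMap Ψ) =
      J.pointMapCoord Ψ n + ∑ k : Fin n, b k * J.pointMapCoord Ψ k := fun J => by
    simp only [linLhs, Jet.dcoord_pointMap le_rfl]
    congr 1
    exact Finset.sum_congr rfl fun k _ => by rw [Jet.dcoord_pointMap k.2.le]
  have hdir : ∀ J : Jet n, J 0 = t → linLhs a J = 0 →
      linLhs (fun k _ => b k) (J.pointMap Ψ) = 0 := by
    intro J h0 h1
    obtain ⟨α, rfl⟩ := hJ J h0 h1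
    have hs : AnalyticAt ℂ (fun t => ∑ i, α i * S i t) t :=
      Finset.analyticAt_fun_sum _ fun i _ => analyticAt_const.mul (hbS i).1
    have h2 : ∀ k, (symOp ξ c)^[k] (fun t => ∑ i, α i * S i t) t =
        ∑ i, α i * (symOp ξ c)^[k] (S i) t := fun k =>
      (symOp_iterate_sum α ht.analyticAt_fst ht.analyticAt_coeff (fun i => (hbS i).1)
        k).eq_of_nhds
    rw [hG, StraightensAt.pointMapCoord_ofFun le_rfl h hs, h2]
    have h3 : ∀ k : Fin n, b k * Jet.pointMapCoord Ψ k
        (Jet.ofFun (fun t => ∑ i, α i * S i t) t : Jet n) =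
        g t * ∑ i, α i * (b k * (symOp ξ c)^[k] (S i) t) := fun k => by
      rw [StraightensAt.pointMapCoord_ofFun k.2.le h hs, h2, Finset.mul_sum, Finset.mul_sum,
        Finset.mul_sum]
      exact Finset.sum_congr rfl fun i _ => by ring
    simp only [h3]
    rw [← Finset.mul_sum, Finset.sum_comm, ← mul_add, ← Finset.sum_add_distrib]
    refine mul_eq_zero_of_right _ (Finset.sum_eq_zero fun i _ => ?_)
    rw [← Finset.mul_sum, ← mul_add, (hbS i).2, mul_zero]
  intro J h0
  refine ⟨hdir J h0, fun h1 => ?_⟩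
  set L := linLhs a J with hL
  -- For the converse the jet is moved onto the linear equation along its top derivative. Its image
  -- then moves by `-L` times a nonzero slope, but both images satisfy the new equation, so `L = 0`.
  set J' : Jet n := J + (-L) • Jet.dirVec n with hJ'
  have hJ'0 : J' 0 = t := by simp [hJ', Jet.dirVec, h0]
  have h2 : linLhs a J' = 0 := by
    rw [hJ', linLhs_add_dirVec, ← hL, add_neg_cancel]
  have h3 := hdir J' hJ'0 h2
  obtain ⟨m, rfl⟩ : ∃ m, n = m + 2 := ⟨n - 2, by omega⟩
  have htb : StraightensAt ξ c τ g J.base.1 := by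
    rw [← h0] at ht; exact ht
  have hD : Jet.totalDeriv (fun J : Jet (m + 2) => (Ψ J.base).1) J ≠ 0 := by
    rw [hΨ, StraightensAt.totalDeriv_fst (J := J) htb]
    exact htb.deriv_time_ne_zero
  have hslope := div_ne_zero (Jet.fderiv_pointMapCoord_dirVec_ne_zero (k := m) (by omega)
    htb.analyticAt_map htb.injective_fderiv hD) hD
  have h4 : ∀ k : Fin (m + 2), J'.pointMapCoord Ψ k = J.pointMapCoord Ψ k := fun k =>
    Jet.indep_pointMapCoord Ψ k J _ fun i hi => by
      have h5 : i.val ≠ m + 2 + 1 := by have := k.2; omega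
      simp [Jet.dirVec, h5]
  rw [hG] at h1 h3
  simp only [h4] at h3
  rw [hJ', Jet.pointMapCoord_add_dirVec le_rfl] at h3
  have h5 : L * (fderiv ℂ (Jet.pointMapCoord Ψ (m + 1)) J (Jet.dirVec (m + 1)) /
      Jet.totalDeriv (fun J : Jet (m + 2) => (Ψ J.base).1) J) = 0 := by
    linear_combination h1 - h3
  exact (mul_eq_zero.1 h5).resolve_right hslope

theorem IsLinearization.comp_straightening (hn : 2 ≤ n) (h : IsLinearization q z₀ a Φ)
    {ξ c τ g : ℂ → ℂ} {b : Fin n → ℂ} (hst : ∀ᶠ t in 𝓝 (Φ z₀).1, StraightensAt ξ c τ g t)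
    (hb : ∀ s, IsSol a (Φ z₀).1 s → ∀ᶠ t in 𝓝 (Φ z₀).1,
      (symOp ξ c)^[n] s t + ∑ k : Fin n, b k * (symOp ξ c)^[k] s t = 0) :
    IsLinearization q z₀ (fun k _ => b k) (affineField τ g (fun _ => 0) ∘ Φ) := by
  set Ψ := affineField τ g fun _ => 0 with hΨ
  have ht := hst.self_of_nhds
  have hΨan : AnalyticAt ℂ Ψ (Φ z₀) := ht.analyticAt_map
  refine ⟨hΨan.comp h.analyticAt, fun h0 => ?_, fun _ => analyticAt_const, ?_⟩
  · rw [fderiv_comp z₀ hΨan.differentiableAt h.analyticAt.differentiableAt] at h0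
    have h1 := LinearMap.bot_lt_ker_of_det_eq_zero h0
    refine h1.ne' (LinearMap.ker_eq_bot.2 ?_)
    exact ht.injective_fderiv.comp h.injective
  · filter_upwards [h.lhs_iff, h.analyticAt.eventually_analyticAt,
      h.analyticAt.continuousAt.fst.eventually hst,
      h.analyticAt.continuousAt.fst.eventually (eventually_linLhs_pointMap_iff hn h.coeff hst hb)]
      with z h1 h2 h3 h4 j hjz hden hD
    subst hjz
    have hG : HasFDerivAt (fun z : ℂ × ℂ => τ (Φ z).1)
        (deriv τ (Φ j.base).1 • fderiv ℂ (fun z => (Φ z).1) j.base) j.base :=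
      HasDerivAt.comp_hasFDerivAt j.base (f := fun z => (Φ z).1)
        h3.analyticAt_time.differentiableAt.hasDerivAt h2.differentiableAt.fst.hasFDerivAt
    -- The composite has total derivative `τ' D_x φ`, so jets regular for it are regular for `Φ`.
    have hD0 : Jet.totalDeriv (fun j : Jet n => (Φ j.base).1) j ≠ 0 := by
      intro h0
      refine hD ?_
      have h5 := Jet.totalDeriv_comp_base (j := j) hG.differentiableAt
      rw [hG.fderiv, smul_apply,
        ← Jet.totalDeriv_comp_base (G := fun z => (Φ z).1) h2.differentiableAt.fst, h0,
        smul_zero] at h5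
      exact h5
    have hD' : Jet.totalDeriv (fun j : Jet n => (Ψ j.base).1) (j.pointMap Φ) ≠ 0 := by
      rw [hΨ, StraightensAt.totalDeriv_fst (J := j.pointMap Φ) h3]
      exact h3.deriv_time_ne_zero
    have h5 : j.pointMap (Ψ ∘ Φ) = (j.pointMap Φ).pointMap Ψ := by
      ext i
      refine Fin.cases ?_ (fun k => ?_) i
      · simp only [Jet.pointMap, Fin.cons_zero, Function.comp_apply]
        exact congrArg (fun p => (Ψ p).1) (Jet.base_pointMap Φ j).symm
      · exact Jet.pointMapCoord_comp (by omega) h2 h3.analyticAt_map hD0 hD'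
    rw [h1 j rfl hden hD0, h5]
    exact h4 _ rfl

/-- A nonscalar action forces `ξ ≠ 0` at the base point, so `ξ ∂_t + c u ∂_u` can be straightened to
`∂_τ`; the component `e` does not affect the action on `D`. The Cayley–Hamilton theorem for that
action is the equation with constant coefficients in `τ`. -/
theorem IsLinearization.equivToLinearAt_charpoly (hn : 3 ≤ n) (h : IsLinearization q z₀ a Φ)
    (hdim : Module.finrank ℂ (q.symmetryAlgebra z₀) = n + 2) {X : q.symmetryAlgebra z₀}
    (B : Module.Basis (Fin n) ℂ (q.derivedAlgebra z₀)) (hns : ¬ q.ActsAsScalar z₀ X) :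
    q.EquivToLinearAt z₀ (fun i _ => (q.adMatrix z₀ X B).charpoly.coeff i) := by
  have hfin : FiniteDimensional ℂ (q.derivedAlgebra z₀) := B.finiteDimensional_of_finite
  obtain ⟨ξ, c, e, hs, hX⟩ := h.exists_represents hn X
  have hξ := h.apply_ne_zero_of_represents hn hdim hX (mt (h.actsAsScalar_iff hn hdim hX).2 hns)
  obtain ⟨τ, g, hst⟩ := exists_straightensAt hs.analyticAt_fst hs.analyticAt_coeff hξ
  refine equivToLinearAt_iff.2 ⟨_, h.comp_straightening (by omega) hst fun s hs => ?_⟩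
  rw [RationalODE.adMatrix, LinearMap.charpoly_toMatrix]
  set T := LieModule.toEnd ℂ (q.symmetryAlgebra z₀) (q.derivedAlgebra z₀) X with hT
  have hdeg : T.charpoly.natDegree = n := by
    rw [T.charpoly_natDegree, h.finrank_derivedAlgebra hn hdim]
  have hmonic := T.charpoly_monic.coeff_natDegree
  rw [hdeg] at hmonic
  obtain ⟨Z, hZ⟩ := h.exists_derived_represents hn hdim hs
  have h1 := h.represents_aeval_toEnd hn hX hZ (p := T.charpoly) (hdeg.trans_lt n.lt_succ_self)
  rw [← hT, LinearMap.aeval_self_charpoly] at h1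
  filter_upwards [h.eventually_eq_zero_of_represents h1] with t ht
  have h2 := ht.2.2
  rw [Finset.sum_range_succ, Finset.sum_range, hmonic, one_mul, add_comm] at h2
  exact h2

end ODESymm
end

theorem mainTheorem3 (n : ℕ) (hn : 3 ≤ n) (q : ODESymm.RationalODE n) (z₀ : ℂ × ℂ)
    (hlin : q.LinearizableAt z₀)
    (hdim : Module.finrank ℂ (q.symmetryAlgebra z₀) = n + 2) :
    IsLieAbelian (q.derivedAlgebra z₀) ∧
    Module.finrank ℂ (q.derivedAlgebra z₀) = n ∧
    (∀ e₁ e₂ : q.symmetryAlgebra z₀,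
      (q.derivedAlgebra z₀).toSubmodule ⊔ Submodule.span ℂ {e₁, e₂} = ⊤ →
        ¬ q.ActsAsScalar z₀ e₁ ∨ ¬ q.ActsAsScalar z₀ e₂) ∧
    (∀ (X : q.symmetryAlgebra z₀) (B : Module.Basis (Fin n) ℂ (q.derivedAlgebra z₀)),
      (∀ c : Fin n → ℂ, q.EquivToLinearAt z₀ (fun i _ => c i) →
        ∃ k b : ℂ, (k = 0 ↔ q.ActsAsScalar z₀ X) ∧
          (q.adMatrix z₀ X B).charpoly = ODESymm.affineRoots (ODESymm.charPoly c) k b) ∧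
      (¬ q.ActsAsScalar z₀ X →
        q.EquivToLinearAt z₀ (fun i _ => (q.adMatrix z₀ X B).charpoly.coeff i))) := by
  obtain ⟨a, ha⟩ := hlin
  obtain ⟨Φ, h⟩ := ODESymm.equivToLinearAt_iff.1 ha
  refine ⟨h.isLieAbelian_derivedAlgebra hn hdim, h.finrank_derivedAlgebra hn hdim,
    h.not_actsAsScalar_or hn hdim, fun X B => ⟨fun c hc => ?_,
      h.equivToLinearAt_charpoly hn hdim B⟩⟩
  -- The eigenvalue statement is proved in the coordinates where the coefficients are constant,
  -- independently of the given linearization.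
  obtain ⟨Φ', h'⟩ := ODESymm.equivToLinearAt_iff.1 hc
  exact h'.exists_charpoly_adMatrix_eq hn hdim X B
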